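/- **Setting.** Let $\Omega=(0,1)^2$, let $E\subset\partial\Omega$ be relatively open, and let $\Gamma_-(E)$ be the set of unit vectors $(x,\theta)$ based at points $x\in E$ and pointing into $\Omega$, with the measure $d\Sigma=|\nu(x)\cdot\theta|\,dS(x)\,d\theta$, $\nu$ being the outward unit normal. Let $T$ be the billiard map (follow the ray to $\partial\Omega$ and reflect optically; at a corner reverse the direction), write $(z_j,\theta_j)=T^j(x,\theta)$ for $(x,\theta)\in\Gamma_-(E)$, and let $N(x,\theta)$ be the number of reflections before the broken ray hits $E$ again, i.e. the least $n\ge 0$ with $z_{n+1}\in E$. The broken ray is regular if such an $n$ exists and the points $z_0,\dots,z_{N(x,\theta)+1}$ avoid the relative boundary $\partial E$ of $E$ in $\partial\Omega$. An *attenuation* is a real $\sigma\in C^2(\Omega\times\mathbb S^1)$ vanishing near $\partial\Omega$ (extended by zero). For $f\in L^2(\Omega)$, extended by zero, $$I_{\sigma,E}f(x,\theta)=\sum_{j=0}^{N(x,\theta)}\int_0^\infty \exp\Big(-\sum_{m=0}^{j-1}\int_0^\infty\sigma(z_m+\tau\theta_m,\theta_m)\,d\tau-\int_0^\infty\sigma(z_j+(t-\tau)\theta_j,\theta_j)\,d\tau\Big)f(z_j+t\theta_j)\,dt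 .$$ Fix $N_{\max}\in\mathbb N$. A *cutoff* is a finite sum $\alpha=\sum_k\alpha_k$ where each real $\alpha_k$ on $\Gamma_-(E)$ extends to a $C^2$ function on $\mathbb R^2\times\mathbb S^1$, constant along directed lines, which vanishes on all directed lines that do not enter $\Omega$ through $E$ or whose broken ray is not regular, and such that for some $N_k\le N_{\max}$ one has $N=N_k$ on all rays with $\alpha_k\ne0$ (except those that are reflected at a corner). Put $I_{\sigma,E,\alpha}=\alpha I_{\sigma,E}$ and $N_{\sigma,E,\alpha}=I_{\sigma,E,\alpha}^*I_{\sigma,E,\alpha}$. The $C^2$ norms of $\sigma$ and of (the extension of) $\alpha$ are taken over $\Omega\times\mathbb S^1$. **Proposition.** Let $K\subset\Omega$ be compact, and let $M,\delta_0\in\mathbb R$. There is a constant $C>0$, depending only on $E,K,N_{\max},M,\delta_0$, such that the following holds. Let $\sigma,\sigma'$ be attenuations and $\alpha,\alpha'$ cutoffs with $\|\sigma\|_{C^2}\le M$, $\|\alpha\|_{C^2}\le M$, and let $0<\delta\le\delta_0$ with $\|\sigma'-\sigma\|_{C^2}\le\delta$ and $\|\alpha'-\alpha\|_{C^2}\le\delta$.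 Then $I_{\sigma,E,\alpha}$ and $I_{\sigma',E,\alpha'}$ are bounded operators $L^2(\Omega)\to L^2(\Gamma_-(E),d\Sigma)$, and for every $f\in L^2(\Omega)$ vanishing a.e. outside $K$ the function $(N_{\sigma',E,\alpha'}-N_{\sigma,E,\alpha})f$ belongs to $H^1(\Omega)$ and $$\big\|(N_{\sigma',E,\alpha'}-N_{\sigma,E,\alpha})f\big\|_{H^1(\Omega)}\le C\,\delta\,\|f\|_{L^2(K)} .$$ -/

import Mathlib

open MeasureTheory Set
open scoped ENNReal ContDiff

noncomputable section

namespace BrokenRay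

/-! ### The unit square and its inflow boundary -/

/-- The Euclidean plane. -/
abbrev Plane := EuclideanSpace ℝ (Fin 2)

/-- The open unit square `Ω = (0,1)²`. -/
def square : Set Plane := {x | ∀ i, 0 < x i ∧ x i < 1}

/-- The unit vector with angle `φ`. -/
def dir (φ : ℝ) : Plane := !₂[Real.cos φ, Real.sin φ]

/-- The corners of the square. -/
def IsCorner (x : Plane) : Prop := ∀ i, x i = 0 ∨ x i = 1

/-- The outward unit normal of the square on its (open) edges; the value at the four corners
is irrelevant. -/
def outwardNormal (x : Plane) : Plane :=
  if x 0 = 0 then !₂[-1, 0] else if x 0 = 1 then !₂[1, 0]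
  else if x 1 = 0 then !₂[0, -1] else !₂[0, 1]

/-- `Γ₋(E)`: the unit vectors based at a point of `E ⊆ ∂Ω` which point into the square. At a point
of an open edge this says `ν(x) · θ < 0`; at a corner it says that `θ` points strictly into `Ω`. -/
def inflow (E : Set Plane) : Set (Plane × Plane) :=
  {p | p.1 ∈ E ∩ frontier square ∧ ‖p.2‖ = 1 ∧ ∃ t : ℝ, 0 < t ∧ p.1 + t • p.2 ∈ square}

/-- Arc length `dS` on the boundary of the square (the four edges one after the other). -/
def boundaryMeasure : Measure Plane :=
  (volume.restrict (Ioo (0 : ℝ) 1)).map (fun s => (!₂[s, 0] : Plane)) +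
  (volume.restrict (Ioo (0 : ℝ) 1)).map (fun s => (!₂[s, 1] : Plane)) +
  (volume.restrict (Ioo (0 : ℝ) 1)).map (fun s => (!₂[0, s] : Plane)) +
  (volume.restrict (Ioo (0 : ℝ) 1)).map (fun s => (!₂[1, s] : Plane))

/-- Arc length `dθ` on the unit circle. -/
def circleMeasure : Measure Plane :=
  (volume.restrict (Ioc (-Real.pi) Real.pi)).map dir

/-- The measure `dΣ = |ν(x) · θ| dS(x) dθ` on `Γ₋(E)`. -/
def inflowMeasure (E : Set Plane) : Measure (Plane × Plane) :=
  ((boundaryMeasure.prod circleMeasure).withDensity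
    (fun p => ‖inner ℝ (outwardNormal p.1) p.2‖ₑ)).restrict (inflow E)

/-! ### Billiards in the square -/

/-- The time at which the ray `x + tθ` leaves the closed square. -/
def exitTime (x θ : Plane) : ℝ := sSup {t : ℝ | 0 ≤ t ∧ x + t • θ ∈ closure square}

/-- The billiard map `T`: follow the ray to the boundary and reflect it there. The optical
reflection law reverses the component of the direction normal to the edge; at a corner both
components are reversed, which is the limit of the nearby broken rays. -/
def billiard (p : Plane × Plane) : Plane × Plane :=
  let y : Plane := p.1 + exitTime p.1 p.2 • p.2
  (y, !₂[if y 0 = 0 ∨ y 0 = 1 then -p.2 0 else p.2 0,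
         if y 1 = 0 ∨ y 1 = 1 then -p.2 1 else p.2 1])

/-- `N(x,θ)`: the number of reflections before the broken ray hits `E` again. The broken ray
hits the boundary at the base points of `T¹(x,θ), T²(x,θ), …`, so this is the least `n` such that
`Tⁿ⁺¹(x,θ)` is based in `E`. -/
def reflections (E : Set Plane) (p : Plane × Plane) : ℕ :=
  sInf {n : ℕ | (billiard^[n + 1] p).1 ∈ E}

/-- The broken ray issued from `p` is regular: it starts in `Γ₋(E)`, it hits `E` again after
finitely many reflections, and up to then it does not meet the boundary of `E` relative
to `∂Ω`. -/
def IsRegular (E : Set Plane) (p : Plane × Plane) : Prop :=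
  p ∈ inflow E ∧ (∃ n : ℕ, (billiard^[n + 1] p).1 ∈ E) ∧
    ∀ j ≤ reflections E p + 1, (billiard^[j] p).1 ∉ closure E ∩ closure (frontier square \ E)

/-! ### Attenuations, cutoffs and their `C²` norm

Functions on `Ω × S¹` or `ℝ² × S¹` are written as functions of a point and a vector; only the
values at unit vectors matter, and smoothness is smoothness in the point and in the angle. -/

/-- A function of a point and a unit vector, in terms of the point and the angle. -/
def angular (g : Plane → Plane → ℝ) (q : Plane × ℝ) : ℝ := g q.1 (dir q.2)

/-- The `C²(Ω × S¹)` norm: the supremum of all derivatives of order at most two. -/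
def c2Norm (g : Plane → Plane → ℝ) : ℝ≥0∞ :=
  ⨆ k : Fin 3, ⨆ x ∈ square, ⨆ φ : ℝ, ‖iteratedFDeriv ℝ (k : ℕ) (angular g) (x, φ)‖ₑ

/-- A `C²` attenuation on `Ω × S¹` which vanishes near `∂Ω`, extended by zero to `ℝ² × S¹`. -/
def IsAttenuation (σ : Plane → Plane → ℝ) : Prop :=
  ContDiff ℝ 2 (angular σ) ∧
    ∃ S ⊆ square, IsCompact S ∧ ∀ x ∉ S, ∀ θ : Plane, ‖θ‖ = 1 → σ x θ = 0

/-- A `C²` cutoff function for one beam of broken rays. A cutoff function on `Γ₋(E)` is given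
through its extension to `ℝ² × S¹` which is constant on directed lines; this makes sense of its
smoothness also for rays which start at a corner. -/
structure IsBeamCutoff (E : Set Plane) (Nmax : ℕ) (a : Plane → Plane → ℝ) : Prop where
  contDiff : ContDiff ℝ 2 (angular a)
  const_on_lines : ∀ (x θ : Plane) (t : ℝ), ‖θ‖ = 1 → a (x + t • θ) θ = a x θ
  /-- It vanishes on the directed lines which do not enter the square through `E`. -/
  support : ∀ x θ : Plane, ‖θ‖ = 1 → a x θ ≠ 0 → ∃ t : ℝ, (x + t • θ, θ) ∈ inflow E
  /-- It vanishes on the broken rays which are not regular. -/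
  regular : ∀ p ∈ inflow E, a p.1 p.2 ≠ 0 → IsRegular E p
  /-- All the broken rays on which it does not vanish have the same number of reflections, at most
  `Nmax`; rays which are reflected at a corner (where two reflections are merged into one)
  are exempt. -/
  constant : ∃ N ≤ Nmax, ∀ p ∈ inflow E, a p.1 p.2 ≠ 0 →
    (∀ j, 1 ≤ j → j ≤ reflections E p → ¬ IsCorner (billiard^[j] p).1) → reflections E p = N

/-- `α = ∑ₖ αₖ` is a finite sum of beam cutoffs. -/
def IsCutoff (E : Set Plane) (Nmax : ℕ) (α : Plane → Plane → ℝ) : Prop :=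
  ∃ (n : ℕ) (a : Fin n → Plane → Plane → ℝ),
    (∀ k, IsBeamCutoff E Nmax (a k)) ∧ α = ∑ k, a k

/-! ### The broken ray transform and the normal operator -/

/-- The weight `w_j` at the point `z_j + tθ_j` of the `j`-th segment of the broken ray issued from
`p`, where `(z_j, θ_j) = T^j p`. -/
def weight (σ : Plane → Plane → ℝ) (p : Plane × Plane) (j : ℕ) (t : ℝ) : ℝ :=
  Real.exp (-∑ m ∈ Finset.range j,
      ∫ τ in Ioi (0 : ℝ), σ ((billiard^[m] p).1 + τ • (billiard^[m] p).2) (billiard^[m] p).2) *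
    Real.exp (-∫ τ in Ioi (0 : ℝ),
      σ ((billiard^[j] p).1 + (t - τ) • (billiard^[j] p).2) (billiard^[j] p).2)

/-- The attenuated broken ray transform `I_{σ,E} f (p)` of a function `f` on the plane that
vanishes outside the square. -/
def rayTransform (σ : Plane → Plane → ℝ) (E : Set Plane) (f : Plane → ℂ) (p : Plane × Plane) : ℂ :=
  ∑ j ∈ Finset.range (reflections E p + 1), ∫ t in Ioi (0 : ℝ),
    (weight σ p j t : ℂ) * f ((billiard^[j] p).1 + t • (billiard^[j] p).2)

/-- `L²(Ω)`. -/
abbrev L2Square := Lp ℂ 2 ((volume : Measure Plane).restrict square)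

/-- `L²(Γ₋(E), dΣ)`. -/
abbrev L2Inflow (E : Set Plane) := Lp ℂ 2 (inflowMeasure E)

/-- The bounded operator `A : L²(Ω) → L²(Γ₋(E), dΣ)` is the operator
`I_{σ,E,α} = α I_{σ,E}`. -/
def IsRayOperator (σ : Plane → Plane → ℝ) (E : Set Plane) (α : Plane → Plane → ℝ)
    (A : L2Square →L[ℂ] L2Inflow E) : Prop :=
  ∀ f : L2Square, A f =ᵐ[inflowMeasure E]
    fun p => (α p.1 p.2 : ℂ) * rayTransform σ E (square.indicator f) p

/-- The normal operator `A* A` of `A`. -/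
def normalOperator {E : Set Plane} (A : L2Square →L[ℂ] L2Inflow E) : L2Square →L[ℂ] L2Square :=
  (ContinuousLinearMap.adjoint A).comp A

/-! ### The Sobolev space `H¹(Ω)` -/

/-- `g` is the weak partial derivative `∂ᵢu` in `Ω`. -/
def IsWeakPartial (u g : L2Square) (i : Fin 2) : Prop :=
  ∀ ψ : Plane → ℝ, ContDiff ℝ ∞ ψ → HasCompactSupport ψ → tsupport ψ ⊆ square →
    ∫ x in square, u x * (fderiv ℝ ψ x (EuclideanSpace.single i 1) : ℂ) =
      -∫ x in square, g x * (ψ x : ℂ)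

/-- The `H¹(Ω)` norm `(‖u‖² + ‖∂₁u‖² + ‖∂₂u‖²)^{1/2}` of `u ∈ L²(Ω)`; it is `∞` when `u` has no weak
gradient in `L²(Ω)`, that is, when `u ∉ H¹(Ω)`. -/
def h1Norm (u : L2Square) : ℝ≥0∞ :=
  ⨅ (g : Fin 2 → L2Square) (_ : ∀ i, IsWeakPartial u (g i) i),
    ENNReal.ofReal (Real.sqrt (‖u‖ ^ 2 + ∑ i, ‖g i‖ ^ 2))

end BrokenRay

end

noncomputable section

namespace BrokenRay

open scoped Topology FourierTransform

/-! ### Truncated directional Hilbert transforms -/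

/-! Reflecting the square across its sides unfolds a broken ray into a straight line crossing unit
cells of the plane. In these coordinates `α I_{σ,E} f` becomes a finite sum, over the cells `c` in
`box Nmax`, of integrals along the line of a weight times the reflected copy of `f` in `c`
(`IsLevels.mul_rayTransform_eq`). The weight is a product of the indicator of the directions
pointing towards `c`, a level function `β` (the part of the cutoff on rays with at least `depth c`
reflections), and the exponential of minus the attenuation accumulated behind the point.

Let `A` be the operator for the data `σ, α` and `A + D` the one for `σ', α'`. The difference of the
normal operators is `(A + D)* D + D* A`, so every term contains a factor `D`, whose weights are
`O(δ)`. The `L²` bound follows from the operator norms. For the gradient, duality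
(`exists_isWeakPartial`, `h1Norm_le`) reduces the claim to bounding pairings such as `⟨D f, A ∂ψ⟩`
by `C δ ‖f‖ ‖ψ‖` for test functions `ψ`, with no derivative of `ψ` on the right.

Santaló's formula turns such a pairing, for two cells `c'` and `c`, into the integral over `y` of
the conjugate of `f_{c'}(y)` times `∫∫ o(φ) A(y,r,φ) ∂ψ_c(y - r dir φ) dr dφ`
(`integral_conj_segInt_mul`), where now `A` denotes a symbol. Without the polar Jacobian the kernel
is singular like `1/|r|`, and a derivative makes it critically singular. The heart of the proof is
`IsSymbol.norm_integral_fderiv_le`. The radial component of the derivative is integrated by parts in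
`r` and is harmless. The angular component is integrated by parts in `φ`, which costs a factor
`1/r`. Freezing the resulting coefficient at `r = 0` leaves a bounded error and an average over
directions of truncated Hilbert transforms. These are Fourier multipliers bounded uniformly in
direction and truncation, because the integrals of `sin u / u` are.

Two points make the constant uniform. First, the direction indicators jump, but where they jump
either the symbol or the test function vanishes, so the integration by parts in `φ` survives.
Second, the pieces of a cutoff are not controlled individually. On generic lines, however, `β j` is
either `0` or `α`, and `β' j - β j` is either `0` or `α' - α`, which forces domination by `α`,
respectively `α' - α`, together with the angular derivative (`abs_le_of_dense`). -/

theorem intervalIntegrable_of_continuousOn_pos {f : ℝ → ℝ} (hf : ContinuousOn f (Ioi 0))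
    {a b : ℝ} (ha : 0 < a) (hb : 0 < b) : IntervalIntegrable f volume a b :=
  (hf.mono fun _ hx => lt_of_lt_of_le (lt_min ha hb) hx.1).intervalIntegrable

theorem continuousOn_sin_div : ContinuousOn (fun u : ℝ => Real.sin u / u) (Ioi 0) :=
  Real.continuous_sin.continuousOn.div continuousOn_id fun _ hx => (ne_of_gt hx)

/-- The derivative of `-cos u / u` is `sin u / u + cos u / u²`. The two boundary terms and the
remaining integral are at most `1/a`, `1/b` and `1/a - 1/b`, which add up to `2/a`. -/
theorem abs_integral_sin_div_le_of_one_le {a b : ℝ} (ha : 1 ≤ a) (hab : a ≤ b) :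
    |∫ u in a..b, Real.sin u / u| ≤ 2 := by
  have ha0 : 0 < a := by linarith
  have hb0 : 0 < b := by linarith
  have hpos : ∀ u ∈ uIcc a b, 0 < u := fun u hu => by
    rw [uIcc_of_le hab] at hu; linarith [hu.1]
  have hcont : ContinuousOn (fun u : ℝ => Real.cos u / u ^ 2) (Ioi 0) :=
    Real.continuous_cos.continuousOn.div (by fun_prop) fun _ hx => pow_ne_zero _ (ne_of_gt hx)
  have hcont2 : ContinuousOn (fun u : ℝ => 1 / u ^ 2) (Ioi 0) :=
    continuousOn_const.div (by fun_prop) fun _ hx => pow_ne_zero _ (ne_of_gt hx)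
  have h1 : ∫ u in a..b, (Real.sin u / u + Real.cos u / u ^ 2) =
      (-(Real.cos b / b)) - (-(Real.cos a / a)) := by
    refine intervalIntegral.integral_eq_sub_of_hasDerivAt (f := fun u => -(Real.cos u / u))
      (fun u hu => ?_) ?_
    · have h0 := (hpos u hu).ne'
      refine ((Real.hasDerivAt_cos u).fun_div (hasDerivAt_id' u) h0).fun_neg.congr_deriv ?_
      field_simp
      ring
    · exact (intervalIntegrable_of_continuousOn_pos continuousOn_sin_div ha0 hb0).add
        (intervalIntegrable_of_continuousOn_pos hcont ha0 hb0)
  rw [intervalIntegral.integral_add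
    (intervalIntegrable_of_continuousOn_pos continuousOn_sin_div ha0 hb0)
    (intervalIntegrable_of_continuousOn_pos hcont ha0 hb0)] at h1
  have h2 : ∫ u in a..b, 1 / u ^ 2 = (-(1 / b)) - (-(1 / a)) := by
    refine intervalIntegral.integral_eq_sub_of_hasDerivAt (f := fun u => -(1 / u))
      (fun u hu => ?_) (intervalIntegrable_of_continuousOn_pos hcont2 ha0 hb0)
    have h0 := (hpos u hu).ne'
    refine ((hasDerivAt_const u (1 : ℝ)).fun_div (hasDerivAt_id' u) h0).fun_neg.congr_deriv ?_
    field_simp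
    ring
  have h3 : |∫ u in a..b, Real.cos u / u ^ 2| ≤ ∫ u in a..b, 1 / u ^ 2 := by
    rw [← Real.norm_eq_abs]
    refine intervalIntegral.norm_integral_le_of_norm_le hab (Filter.Eventually.of_forall
      fun u hu => ?_) (intervalIntegrable_of_continuousOn_pos hcont2 ha0 hb0)
    rw [Real.norm_eq_abs, abs_div, abs_of_nonneg (sq_nonneg u)]
    gcongr
    exact Real.abs_cos_le_one u
  have h4 : |Real.cos b / b| ≤ 1 / b := by
    rw [abs_div, abs_of_pos hb0]; gcongr; exact Real.abs_cos_le_one b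
  have h5 : |Real.cos a / a| ≤ 1 / a := by
    rw [abs_div, abs_of_pos ha0]; gcongr; exact Real.abs_cos_le_one a
  have h6 : 1 / a ≤ 1 := by rw [div_le_one ha0]; exact ha
  have := abs_le.1 h3
  have := abs_le.1 h4
  have := abs_le.1 h5
  rw [abs_le]
  constructor <;> linarith

theorem abs_integral_sin_div_le {a b : ℝ} (ha : 0 < a) (hab : a ≤ b) :
    |∫ u in a..b, Real.sin u / u| ≤ 3 := by
  have small : ∀ c d : ℝ, 0 < c → c ≤ d → d ≤ 1 → |∫ u in c..d, Real.sin u / u| ≤ 1 := by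
    intro c d hc hcd hd
    rw [← Real.norm_eq_abs]
    refine (intervalIntegral.norm_integral_le_of_norm_le_const (C := 1) fun u hu => ?_).trans ?_
    · rw [uIoc_of_le hcd] at hu
      have hu0 : 0 < u := hc.trans hu.1
      rw [Real.norm_eq_abs, abs_div, abs_of_pos hu0, div_le_one hu0]
      exact (Real.abs_sin_le_abs (x := u)).trans (abs_of_pos hu0).le
    · rw [one_mul, abs_of_nonneg (by linarith)]; linarith
  rcases le_total b 1 with hb | hb
  · exact (small a b ha hab hb).trans (by norm_num)
  rcases le_total 1 a with h1 | h1
  · exact (abs_integral_sin_div_le_of_one_le h1 hab).trans (by norm_num)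
  rw [← intervalIntegral.integral_add_adjacent_intervals
    (intervalIntegrable_of_continuousOn_pos continuousOn_sin_div ha one_pos)
    (intervalIntegrable_of_continuousOn_pos continuousOn_sin_div one_pos (ha.trans_le hab))]
  refine (abs_add_le _ _).trans ?_
  linarith [small a 1 ha h1 le_rfl, abs_integral_sin_div_le_of_one_le le_rfl hb]

/-- The measure `dr / r` is invariant under scaling, so the substitution `u = x r` removes the
frequency. The bound is therefore uniform in `x` as well as in the truncation. -/
theorem abs_integral_sin_mul_div_le {ε R : ℝ} (hε : 0 < ε) (hR : ε ≤ R) (x : ℝ) :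
    |∫ r in ε..R, Real.sin (x * r) / r| ≤ 3 := by
  have pos : ∀ x : ℝ, 0 < x → |∫ r in ε..R, Real.sin (x * r) / r| ≤ 3 := by
    intro x hx
    have h := intervalIntegral.integral_comp_mul_left (a := ε) (b := R)
      (fun u => Real.sin u / u) hx.ne'
    have h2 : ∫ r in ε..R, Real.sin (x * r) / r = ∫ u in x * ε..x * R, Real.sin u / u := by
      have : ∀ r, Real.sin (x * r) / r = x * (Real.sin (x * r) / (x * r)) := fun r => by
        field_simp
      simp_rw [this]
      rw [intervalIntegral.integral_const_mul, h, smul_eq_mul, mul_inv_cancel_left₀ hx.ne']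
    rw [h2]
    exact abs_integral_sin_div_le (by positivity) (by gcongr)
  rcases lt_trichotomy x 0 with hx | rfl | hx
  · have := pos (-x) (by linarith)
    simpa [neg_mul, Real.sin_neg, neg_div] using this
  · simp
  · exact pos x hx

/-- The integral of `|f g|` is at most the product of the `L²` norms. -/
theorem integral_norm_mul_norm_le {α : Type*} [MeasurableSpace α] {μ : Measure α} {f g : α → ℂ}
    (hf : MemLp f 2 μ) (hg : MemLp g 2 μ) :
    ∫ x, ‖f x‖ * ‖g x‖ ∂μ ≤ (eLpNorm f 2 μ).toReal * (eLpNorm g 2 μ).toReal := by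
  have h1 : inner ℝ (hf.norm.toLp _) (hg.norm.toLp _) = ∫ x, ‖f x‖ * ‖g x‖ ∂μ := by
    rw [L2.inner_def]
    refine integral_congr_ae ?_
    filter_upwards [hf.norm.coeFn_toLp, hg.norm.coeFn_toLp] with x h1 h2
    rw [h1, h2]
    simp [mul_comm]
  rw [← h1]
  refine (real_inner_le_norm _ _).trans ?_
  rw [Lp.norm_toLp, Lp.norm_toLp, eLpNorm_norm, eLpNorm_norm]

theorem integrable_inner_of_memLp {α : Type*} [MeasurableSpace α] {μ : Measure α} {f g : α → ℂ}
    (hf : MemLp f 2 μ) (hg : MemLp g 2 μ) : Integrable (fun x => inner ℂ (f x) (g x)) μ := by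
  simp only [RCLike.inner_apply]
  exact hg.integrable_mul hf.star

/-- The Hilbert transform in the direction `θ`, truncated to `ε < |r| < R`. -/
def hilbertTrunc (θ : Plane) (ε R : ℝ) (ψ : Plane → ℂ) (y : Plane) : ℂ :=
  ∫ r in ε..R, (r : ℂ)⁻¹ * (ψ (y - r • θ) - ψ (y + r • θ))

/-- A globally continuous replacement for the kernel `1 / r`. -/
theorem inv_max_eq {ε r : ℝ} (hr : ε ≤ r) : ((max ε r : ℝ) : ℂ)⁻¹ = (r : ℂ)⁻¹ := by
  rw [max_eq_right hr]

theorem continuous_inv_max {ε : ℝ} (hε : 0 < ε) :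
    Continuous fun r : ℝ => ((max ε r : ℝ) : ℂ)⁻¹ := by
  refine Continuous.inv₀ (by fun_prop) fun r => ?_
  have : 0 < max ε r := lt_max_of_lt_left hε
  exact_mod_cast this.ne'

theorem hilbertTrunc_eq {θ : Plane} {ε R : ℝ} (hR : ε ≤ R) (ψ : Plane → ℂ) (y : Plane) :
    hilbertTrunc θ ε R ψ y =
      ∫ r in ε..R, ((max ε r : ℝ) : ℂ)⁻¹ * (ψ (y - r • θ) - ψ (y + r • θ)) := by
  refine intervalIntegral.integral_congr fun r hr => ?_
  rw [uIcc_of_le hR] at hr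
  simp only [inv_max_eq hr.1]

theorem continuous_hilbertTrunc {θ : Plane} {ε R : ℝ} (hε : 0 < ε) (hR : ε ≤ R) {ψ : Plane → ℂ}
    (hψ : Continuous ψ) : Continuous (hilbertTrunc θ ε R ψ) := by
  simp_rw [funext (hilbertTrunc_eq hR ψ)]
  refine intervalIntegral.continuous_parametric_intervalIntegral_of_continuous' ?_ _ _
  exact ((continuous_inv_max hε).comp continuous_snd).mul (by fun_prop)

theorem hasCompactSupport_hilbertTrunc {θ : Plane} {ε R : ℝ} (hε : 0 < ε) (hR : ε ≤ R)
    {ψ : Plane → ℂ} (hψ : HasCompactSupport ψ) : HasCompactSupport (hilbertTrunc θ ε R ψ) := by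
  obtain ⟨ρ, hρ⟩ := hψ.isCompact.isBounded.subset_closedBall 0
  refine HasCompactSupport.intro (isCompact_closedBall (0 : Plane) (ρ + R * ‖θ‖)) fun y hy => ?_
  have key : ∀ r ∈ Icc ε R, ∀ z : Plane, ‖z‖ = ‖r • θ‖ → ψ (y + z) = 0 := by
    intro r hr z hz
    by_contra h
    have h1 := hρ (subset_tsupport _ h)
    simp only [Metric.mem_closedBall, dist_zero_right, not_le] at hy h1
    have h2 : ‖y‖ ≤ ‖y + z‖ + ‖z‖ := by simpa using norm_sub_le (y + z) z
    have h3 : ‖r • θ‖ ≤ R * ‖θ‖ := by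
      rw [norm_smul, Real.norm_eq_abs, abs_of_pos (hε.trans_le hr.1)]
      gcongr
      exact hr.2
    linarith
  unfold hilbertTrunc
  rw [intervalIntegral.integral_congr (g := fun _ => 0), intervalIntegral.integral_zero]
  intro r hr
  rw [uIcc_of_le hR] at hr
  simp only [sub_eq_add_neg y]
  rw [key r hr _ (norm_neg _), key r hr _ rfl, sub_zero, mul_zero]

theorem fourier_comp_add (ψ : Plane → ℂ) (v : Plane) (ξ : Plane) :
    𝓕 (fun y => ψ (y + v)) ξ = Complex.exp (2 * Real.pi * inner ℝ v ξ * Complex.I) * 𝓕 ψ ξ := by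
  have h := congrFun (VectorFourier.fourierIntegral_comp_add_right Real.fourierChar
    (volume : Measure Plane) (innerₗ Plane) ψ v) ξ
  have h2 : 𝓕 (fun y => ψ (y + v)) ξ = VectorFourier.fourierIntegral Real.fourierChar
    (volume : Measure Plane) (innerₗ Plane) (ψ ∘ fun y => y + v) ξ := rfl
  rw [h2, h, Circle.smul_def, Real.fourierChar_apply]
  simp only [innerₗ_apply_apply, smul_eq_mul]
  push_cast
  rfl

theorem exp_sub_exp_neg_eq (x : ℝ) :
    Complex.exp (-(x : ℂ) * Complex.I) - Complex.exp (x * Complex.I) =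
      ((-2 * Real.sin x : ℝ) : ℂ) * Complex.I := by
  rw [Complex.exp_mul_I, Complex.exp_mul_I, Complex.cos_neg, Complex.sin_neg]
  push_cast
  ring

/-- The Fourier multiplier of the truncated directional Hilbert transform. -/
def hilbertMultiplier (ε R x : ℝ) : ℂ :=
  ∫ r in ε..R, (r : ℂ)⁻¹ * (((-2 * Real.sin (x * r) : ℝ) : ℂ) * Complex.I)

theorem norm_hilbertMultiplier_le {ε R : ℝ} (hε : 0 < ε) (hR : ε ≤ R) (x : ℝ) :
    ‖hilbertMultiplier ε R x‖ ≤ 6 := by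
  have h : hilbertMultiplier ε R x =
      ((∫ r in ε..R, Real.sin (x * r) / r : ℝ) : ℂ) * (-2 * Complex.I) := by
    rw [hilbertMultiplier, ← intervalIntegral.integral_ofReal,
      ← intervalIntegral.integral_mul_const]
    refine intervalIntegral.integral_congr fun r _ => ?_
    push_cast
    ring
  rw [h, norm_mul, Complex.norm_real, Real.norm_eq_abs]
  have : ‖(-2 * Complex.I : ℂ)‖ = 2 := by simp
  rw [this]
  linarith [abs_integral_sin_mul_div_le hε hR x]

theorem hilbertMultiplier_eq {ε R : ℝ} (hR : ε ≤ R) (x : ℝ) :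
    hilbertMultiplier ε R x = ∫ r in ε..R, ((max ε r : ℝ) : ℂ)⁻¹ *
      (((-2 * Real.sin (x * r) : ℝ) : ℂ) * Complex.I) := by
  refine intervalIntegral.integral_congr fun r hr => ?_
  rw [uIcc_of_le hR] at hr
  simp only [inv_max_eq hr.1]

theorem norm_inv_max_le {ε : ℝ} (hε : 0 < ε) (r : ℝ) : ‖((max ε r : ℝ) : ℂ)⁻¹‖ ≤ ε⁻¹ := by
  rw [norm_inv, Complex.norm_real, Real.norm_eq_abs, abs_of_pos (lt_max_of_lt_left hε)]
  exact inv_anti₀ hε (le_max_left _ _)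

/-- Plancherel: a translation becomes a phase on the Fourier side. -/
theorem inner_comp_add_eq (h ψ : SchwartzMap Plane ℂ) (v : Plane)
    (hψ : HasCompactSupport ψ) :
    ∫ y, inner ℂ (h y) (ψ (y + v)) =
      ∫ ξ, Complex.exp (2 * Real.pi * inner ℝ v ξ * Complex.I) * inner ℂ (𝓕 h ξ) (𝓕 ψ ξ) := by
  have hs : HasCompactSupport fun y => ψ (y + v) := hψ.comp_homeomorph (Homeomorph.addRight v)
  have hc : ContDiff ℝ ∞ fun y => ψ (y + v) := (ψ.smooth _).comp (by fun_prop)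
  have h1 := SchwartzMap.integral_inner_fourier_fourier h (hs.toSchwartzMap hc)
  have h2 : ∀ y, (hs.toSchwartzMap hc) y = ψ (y + v) := fun y => rfl
  simp_rw [h2] at h1
  rw [← h1]
  refine integral_congr_ae (Filter.Eventually.of_forall fun ξ => ?_)
  have h3 : 𝓕 (hs.toSchwartzMap hc) ξ = 𝓕 (fun y => ψ (y + v)) ξ := by
    rw [SchwartzMap.fourier_coe]; rfl
  simp only
  rw [h3, fourier_comp_add, SchwartzMap.fourier_coe ψ]
  simp only [RCLike.inner_apply]
  ring

theorem integrable_inner_fourier (h ψ : SchwartzMap Plane ℂ) :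
    Integrable fun ξ => inner ℂ (𝓕 h ξ) (𝓕 ψ ξ) :=
  integrable_inner_of_memLp ((𝓕 h).memLp 2) ((𝓕 ψ).memLp 2)

/-- Fubini on both sides reduces the identity to a fixed `r`, where it is Plancherel applied to the
two translates by `∓ r θ`; their phases differ by `-2 i sin`. -/
theorem integral_inner_hilbertTrunc {θ : Plane} {ε R : ℝ} (hε : 0 < ε) (hR : ε ≤ R)
    (h ψ : SchwartzMap Plane ℂ) (hψ : HasCompactSupport ψ) :
    ∫ y, inner ℂ (h y) (hilbertTrunc θ ε R ψ y) =
      ∫ ξ, hilbertMultiplier ε R (2 * Real.pi * inner ℝ θ ξ) * inner ℂ (𝓕 h ξ) (𝓕 ψ ξ) := by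
  obtain ⟨B, hB⟩ : ∃ B, ∀ y, ‖ψ y‖ ≤ B := ψ.continuous.bounded_above_of_compact_support hψ
  have hk := continuous_inv_max hε
  have swap1 : ∫ y, inner ℂ (h y) (hilbertTrunc θ ε R ψ y) =
      ∫ r in ε..R, ((max ε r : ℝ) : ℂ)⁻¹ *
        ∫ y, inner ℂ (h y) (ψ (y - r • θ) - ψ (y + r • θ)) := by
    simp_rw [hilbertTrunc_eq hR, intervalIntegral.integral_of_le hR]
    have e1 : ∀ y, inner ℂ (h y) (∫ r in Ioc ε R, ((max ε r : ℝ) : ℂ)⁻¹ *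
        (ψ (y - r • θ) - ψ (y + r • θ))) = ∫ r in Ioc ε R, ((max ε r : ℝ) : ℂ)⁻¹ *
          inner ℂ (h y) (ψ (y - r • θ) - ψ (y + r • θ)) := by
      intro y
      simp only [RCLike.inner_apply]
      rw [← integral_mul_const]
      refine integral_congr_ae (Filter.Eventually.of_forall fun r => ?_)
      simp only
      ring
    simp_rw [e1]
    rw [integral_integral_swap]
    · refine integral_congr_ae (Filter.Eventually.of_forall fun r => ?_)
      simp only
      rw [integral_const_mul]
    · have hi : Integrable (fun p : Plane × ℝ => ‖h p.1‖ * (ε⁻¹ * (2 * B)))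
          (volume.prod (volume.restrict (Ioc ε R))) :=
        (h.integrable.norm).mul_prod (integrable_const _)
      refine hi.mono' ?_ (Filter.Eventually.of_forall fun p => ?_)
      · refine Continuous.aestronglyMeasurable ?_
        refine (hk.comp continuous_snd).mul ?_
        exact Continuous.inner (by fun_prop) (by fun_prop)
      · obtain ⟨y, r⟩ := p
        simp only [Function.uncurry_apply_pair, norm_mul]
        have h1 := norm_inv_max_le hε r
        have h2 := norm_inner_le_norm (𝕜 := ℂ) (h y) (ψ (y - r • θ) - ψ (y + r • θ))
        have h3 : ‖ψ (y - r • θ) - ψ (y + r • θ)‖ ≤ 2 * B :=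
          (norm_sub_le _ _).trans (by linarith [hB (y - r • θ), hB (y + r • θ)])
        calc _ ≤ ε⁻¹ * (‖h y‖ * (2 * B)) := by
              refine mul_le_mul h1 (h2.trans (by gcongr)) (norm_nonneg _) (by positivity)
          _ = _ := by ring
  have swap2 : ∫ ξ, hilbertMultiplier ε R (2 * Real.pi * inner ℝ θ ξ) *
        inner ℂ (𝓕 h ξ) (𝓕 ψ ξ) = ∫ r in ε..R, ((max ε r : ℝ) : ℂ)⁻¹ *
        ∫ ξ, (((-2 * Real.sin (2 * Real.pi * inner ℝ θ ξ * r) : ℝ) : ℂ) * Complex.I) *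
          inner ℂ (𝓕 h ξ) (𝓕 ψ ξ) := by
    simp_rw [hilbertMultiplier_eq hR, intervalIntegral.integral_of_le hR, ← integral_mul_const]
    rw [integral_integral_swap]
    · refine integral_congr_ae (Filter.Eventually.of_forall fun r => ?_)
      simp only
      rw [← integral_const_mul]
      refine integral_congr_ae (Filter.Eventually.of_forall fun ξ => ?_)
      simp only
      ring
    · have hi : Integrable (fun p : Plane × ℝ => ‖inner ℂ (𝓕 h p.1) (𝓕 ψ p.1)‖ * (ε⁻¹ * 2))
          (volume.prod (volume.restrict (Ioc ε R))) :=
        ((integrable_inner_fourier h ψ).norm).mul_prod (integrable_const _)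
      refine hi.mono' ?_ (Filter.Eventually.of_forall fun p => ?_)
      · refine Continuous.aestronglyMeasurable ?_
        refine Continuous.mul ((hk.comp continuous_snd).mul (by fun_prop)) ?_
        exact Continuous.inner ((𝓕 h).continuous.comp continuous_fst)
          ((𝓕 ψ).continuous.comp continuous_fst)
      · obtain ⟨ξ, r⟩ := p
        simp only [Function.uncurry_apply_pair, norm_mul, Complex.norm_I, mul_one,
          Complex.norm_real, norm_neg, Real.norm_eq_abs]
        have h1 := norm_inv_max_le hε r
        have h2 := Real.abs_sin_le_one (2 * Real.pi * inner ℝ θ ξ * r)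
        rw [mul_comm]
        have h3 : |(2 : ℝ)| = 2 := by norm_num
        rw [h3]
        gcongr
        linarith
  rw [swap1, swap2]
  refine intervalIntegral.integral_congr fun r _ => ?_
  congr 1
  have hi : ∀ v : Plane, Integrable fun y => inner ℂ (h y) (ψ (y + v)) := fun v => by
    have h1 : MemLp (fun y => ψ (y + v)) 2 volume :=
      (ψ.memLp 2).comp_measurePreserving (measurePreserving_add_right volume v)
    exact integrable_inner_of_memLp (h.memLp 2) h1
  have hm : ∀ v : Plane, Integrable fun ξ =>
      Complex.exp (2 * Real.pi * inner ℝ v ξ * Complex.I) * inner ℂ (𝓕 h ξ) (𝓕 ψ ξ) := fun v => by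
    refine (integrable_inner_fourier h ψ).bdd_mul (c := 1) ?_ (Filter.Eventually.of_forall
      fun ξ => ?_)
    · exact Continuous.aestronglyMeasurable (by fun_prop)
    · have := Complex.norm_exp_ofReal_mul_I (2 * Real.pi * inner ℝ v ξ)
      push_cast at this
      rw [this]
  simp_rw [inner_sub_right, sub_eq_add_neg _ (r • θ)]
  rw [integral_sub (hi _) (hi _), inner_comp_add_eq h ψ _ hψ, inner_comp_add_eq h ψ _ hψ,
    ← integral_sub (hm _) (hm _)]
  refine integral_congr_ae (Filter.Eventually.of_forall fun ξ => ?_)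
  simp only
  rw [← sub_mul, ← exp_sub_exp_neg_eq, inner_neg_left, real_inner_smul_left]
  push_cast
  congr 4 <;> ring

/-- The truncated directional Hilbert transforms are bounded on `L²`, uniformly in the direction
and in the truncation. -/
theorem norm_integral_mul_hilbertTrunc_le {θ : Plane} {ε R : ℝ} (hε : 0 < ε) (hR : ε ≤ R)
    {ψ : Plane → ℂ} (hψ : ContDiff ℝ ∞ ψ) (hψc : HasCompactSupport ψ) {g : Plane → ℂ}
    (hg : MemLp g 2 volume) :
    ‖∫ y, g y * hilbertTrunc θ ε R ψ y‖ ≤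
      6 * (eLpNorm g 2 volume).toReal * (eLpNorm ψ 2 volume).toReal := by
  set Ψ : SchwartzMap Plane ℂ := hψc.toSchwartzMap hψ with hΨ
  have hΨψ : (Ψ : Plane → ℂ) = ψ := rfl
  have hT : MemLp (hilbertTrunc θ ε R ψ) 2 volume :=
    (continuous_hilbertTrunc hε hR hψ.continuous).memLp_of_hasCompactSupport
      (hasCompactSupport_hilbertTrunc hε hR hψc)
  have schwartz : ∀ h : SchwartzMap Plane ℂ, ‖inner ℂ (h.toLp 2 volume) (hT.toLp _)‖ ≤
      6 * ‖h.toLp 2 volume‖ * ‖Ψ.toLp 2 volume‖ := by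
    intro h
    have e1 : inner ℂ (h.toLp 2 volume) (hT.toLp _) =
        ∫ y, inner ℂ (h y) (hilbertTrunc θ ε R ψ y) := by
      rw [L2.inner_def]
      refine integral_congr_ae ?_
      filter_upwards [h.coeFn_toLp 2 volume, hT.coeFn_toLp] with y h1 h2
      rw [h1, h2]
    rw [e1, ← hΨψ, integral_inner_hilbertTrunc hε hR h Ψ (by rw [hΨψ]; exact hψc)]
    have hi : Integrable fun ξ => ‖(𝓕 h) ξ‖ * ‖(𝓕 Ψ) ξ‖ :=
      ((𝓕 h).memLp 2).norm.integrable_mul ((𝓕 Ψ).memLp 2).norm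
    refine (norm_integral_le_of_norm_le (hi.const_mul 6) (Filter.Eventually.of_forall
      fun ξ => ?_)).trans ?_
    · rw [norm_mul]
      exact mul_le_mul (norm_hilbertMultiplier_le hε hR _) (norm_inner_le_norm _ _)
        (norm_nonneg _) (by norm_num)
    · rw [integral_const_mul, mul_assoc]
      gcongr
      refine (integral_norm_mul_norm_le ((𝓕 h).memLp 2) ((𝓕 Ψ).memLp 2)).trans ?_
      rw [← SchwartzMap.norm_fourier_toL2_eq h, ← SchwartzMap.norm_fourier_toL2_eq Ψ]
      rw [SchwartzMap.norm_toLp, SchwartzMap.norm_toLp]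
  -- Both sides are continuous in `h`, and Schwartz functions are dense in `L²`.
  have all : ∀ h : Lp ℂ 2 (volume : Measure Plane), ‖inner ℂ h (hT.toLp _)‖ ≤
      6 * ‖h‖ * ‖Ψ.toLp 2 volume‖ := by
    intro h
    refine (SchwartzMap.denseRange_toLpCLM (E := Plane) (F := ℂ) (p := 2) (μ := volume)
      ENNReal.ofNat_ne_top).induction_on (p := fun h => ‖inner ℂ h (hT.toLp _)‖ ≤
      6 * ‖h‖ * ‖Ψ.toLp 2 volume‖) h ?_ fun φ => schwartz φ
    exact isClosed_le (by fun_prop) (by fun_prop)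
  -- The inner product is conjugate linear in its first argument, hence the conjugate of `g`.
  have hgc : MemLp (fun y => (starRingEnd ℂ) (g y)) 2 volume := hg.star
  have h2 := all (hgc.toLp _)
  have e2 : inner ℂ (hgc.toLp _) (hT.toLp _) = ∫ y, g y * hilbertTrunc θ ε R ψ y := by
    rw [L2.inner_def]
    refine integral_congr_ae ?_
    filter_upwards [hgc.coeFn_toLp, hT.coeFn_toLp] with y h1 h2
    rw [h1, h2]
    simp [mul_comm]
  have e3 : eLpNorm (fun y => (starRingEnd ℂ) (g y)) 2 volume = eLpNorm g 2 volume :=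
    eLpNorm_congr_norm_ae (Filter.Eventually.of_forall fun y => RCLike.norm_conj _)
  rw [e2, Lp.norm_toLp, SchwartzMap.norm_toLp, e3, hΨψ] at h2
  exact h2

/-! ### Polar coordinates in the plane -/

/-- The derivative of `dir`: the unit vector `dir φ` turned by a right angle. -/
def dirPerp (φ : ℝ) : Plane := !₂[-Real.sin φ, Real.cos φ]

theorem dir_zero (φ : ℝ) : dir φ 0 = Real.cos φ := rfl
theorem dir_one (φ : ℝ) : dir φ 1 = Real.sin φ := rfl
theorem dirPerp_zero (φ : ℝ) : dirPerp φ 0 = -Real.sin φ := rfl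
theorem dirPerp_one (φ : ℝ) : dirPerp φ 1 = Real.cos φ := rfl

theorem norm_dir (φ : ℝ) : ‖dir φ‖ = 1 := by
  rw [EuclideanSpace.norm_eq, Fin.sum_univ_two, dir_zero, dir_one]
  simp

theorem norm_dirPerp (φ : ℝ) : ‖dirPerp φ‖ = 1 := by
  rw [EuclideanSpace.norm_eq, Fin.sum_univ_two, dirPerp_zero, dirPerp_one]
  simp

theorem hasDerivAt_plane {f : ℝ → Plane} {f' : Plane} {t : ℝ}
    (h : ∀ i, HasDerivAt (fun t => f t i) (f' i) t) : HasDerivAt f f' t := by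
  rw [hasDerivAt_iff_hasFDerivAt, ← hasFDerivWithinAt_univ, hasFDerivWithinAt_piLp]
  intro i
  refine (h i).hasFDerivAt.hasFDerivWithinAt.congr_fderiv ?_
  ext
  simp

theorem hasDerivAt_dir (φ : ℝ) : HasDerivAt dir (dirPerp φ) φ := by
  refine hasDerivAt_plane fun i => ?_
  fin_cases i
  · exact Real.hasDerivAt_cos φ
  · exact Real.hasDerivAt_sin φ

theorem hasDerivAt_dirPerp (φ : ℝ) : HasDerivAt dirPerp (-dir φ) φ := by
  refine hasDerivAt_plane fun i => ?_
  fin_cases i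
  · exact (Real.hasDerivAt_sin φ).neg
  · exact Real.hasDerivAt_cos φ

theorem contDiff_dir {n : WithTop ℕ∞} : ContDiff ℝ n dir := by
  rw [contDiff_piLp]
  intro i
  fin_cases i
  · exact Real.contDiff_cos
  · exact Real.contDiff_sin

theorem continuous_dir : Continuous dir := contDiff_dir.continuous (n := 0)

theorem continuous_dirPerp : Continuous dirPerp :=
  continuous_iff_continuousAt.2 fun φ => (hasDerivAt_dirPerp φ).continuousAt

theorem dir_add_two_pi (φ : ℝ) : dir (φ + 2 * Real.pi) = dir φ := by
  simp [dir]

theorem dirPerp_add_two_pi (φ : ℝ) : dirPerp (φ + 2 * Real.pi) = dirPerp φ := by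
  simp [dirPerp]

theorem inner_smul_dir_add (e : Plane) (φ : ℝ) :
    inner ℝ e (dir φ) • dir φ + inner ℝ e (dirPerp φ) • dirPerp φ = e := by
  have h := Real.sin_sq_add_cos_sq φ
  ext i
  fin_cases i
  · simp [PiLp.inner_apply, Fin.sum_univ_two, dir_zero, dir_one, dirPerp_zero, dirPerp_one]
    linear_combination (e 0) * h
  · simp [PiLp.inner_apply, Fin.sum_univ_two, dir_zero, dir_one, dirPerp_zero, dirPerp_one]
    linear_combination (e 1) * h

theorem abs_inner_dir_le {e : Plane} (he : ‖e‖ ≤ 1) (φ : ℝ) : |inner ℝ e (dir φ)| ≤ 1 := by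
  refine (abs_real_inner_le_norm _ _).trans ?_
  rw [norm_dir, mul_one]; exact he

theorem abs_inner_dirPerp_le {e : Plane} (he : ‖e‖ ≤ 1) (φ : ℝ) :
    |inner ℝ e (dirPerp φ)| ≤ 1 := by
  refine (abs_real_inner_le_norm _ _).trans ?_
  rw [norm_dirPerp, mul_one]; exact he

/-! ### Symbols -/

/-- `A y r φ` is a symbol over `D`, with the partial derivatives `Aφ`, `Ar` and the mixed one
`Aφr`, all bounded by `B` for `y ∈ D` and `|r| ≤ R`. -/
structure SymbolBound (D : Set Plane) (R B : ℝ) (A Aφ Ar Aφr : Plane → ℝ → ℝ → ℝ) : Prop where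
  cont : Continuous fun q : Plane × ℝ × ℝ => A q.1 q.2.1 q.2.2
  cont_angle : Continuous fun q : Plane × ℝ × ℝ => Aφ q.1 q.2.1 q.2.2
  cont_radius : Continuous fun q : Plane × ℝ × ℝ => Ar q.1 q.2.1 q.2.2
  cont_mixed : Continuous fun q : Plane × ℝ × ℝ => Aφr q.1 q.2.1 q.2.2
  deriv_angle : ∀ y r φ, HasDerivAt (fun φ => A y r φ) (Aφ y r φ) φ
  deriv_radius : ∀ y r φ, HasDerivAt (fun r => A y r φ) (Ar y r φ) r
  deriv_mixed : ∀ y r φ, HasDerivAt (fun r => Aφ y r φ) (Aφr y r φ) r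
  bound : ∀ y ∈ D, ∀ r φ, |r| ≤ R → |A y r φ| ≤ B
  bound_angle : ∀ y ∈ D, ∀ r φ, |r| ≤ R → |Aφ y r φ| ≤ B
  bound_radius : ∀ y ∈ D, ∀ r φ, |r| ≤ R → |Ar y r φ| ≤ B
  bound_mixed : ∀ y ∈ D, ∀ r φ, |r| ≤ R → |Aφr y r φ| ≤ B
  periodic : ∀ y r φ, A y r (φ + 2 * Real.pi) = A y r φ

/-- `A` is a symbol over `D` with bound `B`. -/
def IsSymbol (D : Set Plane) (R B : ℝ) (A : Plane → ℝ → ℝ → ℝ) : Prop :=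
  ∃ Aφ Ar Aφr, SymbolBound D R B A Aφ Ar Aφr

/-! ### Integration by parts in polar coordinates -/

section Core

variable {D : Set Plane} {R B : ℝ} {A Aφ Ar Aφr : Plane → ℝ → ℝ → ℝ} {o : ℝ → ℝ} {ψ : Plane → ℂ}
  {e : Plane}

/-- The derivative in `φ` of `A ⟨e, dirPerp φ⟩`. -/
def perpDeriv (A Aφ : Plane → ℝ → ℝ → ℝ) (e y : Plane) (r φ : ℝ) : ℝ :=
  Aφ y r φ * inner ℝ e (dirPerp φ) - A y r φ * inner ℝ e (dir φ)

theorem SymbolBound.continuous_perpDeriv (hA : SymbolBound D R B A Aφ Ar Aφr) (e : Plane) :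
    Continuous fun q : Plane × ℝ × ℝ => perpDeriv A Aφ e q.1 q.2.1 q.2.2 := by
  have h1 := continuous_dir
  have h2 := continuous_dirPerp
  exact (hA.cont_angle.mul (by fun_prop)).sub (hA.cont.mul (by fun_prop))

theorem SymbolBound.hasDerivAt_mul_perp (hA : SymbolBound D R B A Aφ Ar Aφr) (e y : Plane)
    (r φ : ℝ) :
    HasDerivAt (fun φ => A y r φ * inner ℝ e (dirPerp φ)) (perpDeriv A Aφ e y r φ) φ := by
  have h := (hasDerivAt_const φ e).inner ℝ (hasDerivAt_dirPerp φ)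
  refine ((hA.deriv_angle y r φ).mul h).congr_deriv ?_
  simp only [inner_neg_right, inner_zero_left, add_zero, perpDeriv]
  ring

theorem abs_mul_sub_mul_le {a b p q B : ℝ} (ha : |a| ≤ B) (hb : |b| ≤ B) (hp : |p| ≤ 1)
    (hq : |q| ≤ 1) : |a * q - b * p| ≤ 2 * B := by
  have hB : 0 ≤ B := (abs_nonneg a).trans ha
  have h1 : |a * q| ≤ B * 1 := by rw [abs_mul]; gcongr
  have h2 : |b * p| ≤ B * 1 := by rw [abs_mul]; gcongr
  exact (abs_sub _ _).trans (by linarith)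

theorem SymbolBound.abs_perpDeriv_le (hA : SymbolBound D R B A Aφ Ar Aφr) (he : ‖e‖ ≤ 1)
    {y : Plane} (hy : y ∈ D) {r : ℝ} (hr : |r| ≤ R) (φ : ℝ) :
    |perpDeriv A Aφ e y r φ| ≤ 2 * B :=
  abs_mul_sub_mul_le (hA.bound_angle y hy r φ hr) (hA.bound y hy r φ hr)
    (abs_inner_dir_le he φ) (abs_inner_dirPerp_le he φ)

theorem SymbolBound.abs_perpDeriv_sub_le (hA : SymbolBound D R B A Aφ Ar Aφr) (he : ‖e‖ ≤ 1)
    {y : Plane} (hy : y ∈ D) {r : ℝ} (hr : |r| ≤ R) (φ : ℝ) :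
    |perpDeriv A Aφ e y r φ - perpDeriv A Aφ e y 0 φ| ≤ 2 * B * |r| := by
  have hR : 0 ≤ R := (abs_nonneg r).trans hr
  have h := (convex_Icc (-R) R).norm_image_sub_le_of_norm_hasDerivWithin_le
    (f := fun r => perpDeriv A Aφ e y r φ)
    (f' := fun r => Aφr y r φ * inner ℝ e (dirPerp φ) - Ar y r φ * inner ℝ e (dir φ))
    (C := 2 * B) (x := 0) (y := r)
    (fun x _ => (((hA.deriv_mixed y x φ).mul_const _).sub
      ((hA.deriv_radius y x φ).mul_const _)).hasDerivWithinAt)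
    (fun x hx => abs_mul_sub_mul_le (hA.bound_mixed y hy x φ (abs_le.2 hx))
      (hA.bound_radius y hy x φ (abs_le.2 hx)) (abs_inner_dir_le he φ)
      (abs_inner_dirPerp_le he φ))
    ⟨by linarith, hR⟩ (abs_le.1 hr)
  simpa using h

/-- Integration by parts in the angle. -/
theorem SymbolBound.integral_angle (hA : SymbolBound D R B A Aφ Ar Aφr)
    (ho : Measurable o) (ho1 : ∀ φ, |o φ| ≤ 1) (hop : o (-Real.pi) = o Real.pi)
    (hψ : ContDiff ℝ ∞ ψ) {y : Plane} {r : ℝ}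
    (hjump : ∀ φ, (∀ᶠ φ' in 𝓝 φ, o φ' = o φ) ∨
      (∀ᶠ φ' in 𝓝 φ, A y r φ' = 0 ∨ ψ (y - r • dir φ') = 0)) :
    r • ∫ φ in -Real.pi..Real.pi, (o φ * A y r φ * inner ℝ e (dirPerp φ)) •
        fderiv ℝ ψ (y - r • dir φ) (dirPerp φ) =
      ∫ φ in -Real.pi..Real.pi, (o φ * perpDeriv A Aφ e y r φ) • ψ (y - r • dir φ) := by
  have h1 := continuous_dir
  have h2 := continuous_dirPerp
  have hA1 : Continuous fun φ => A y r φ :=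
    hA.cont.comp (f := fun φ => ((y, r, φ) : Plane × ℝ × ℝ)) (by fun_prop)
  have hA2 : Continuous fun φ => perpDeriv A Aφ e y r φ :=
    (hA.continuous_perpDeriv e).comp (f := fun φ => ((y, r, φ) : Plane × ℝ × ℝ)) (by fun_prop)
  have hψc := hψ.continuous
  have hdψ : Continuous fun φ => fderiv ℝ ψ (y - r • dir φ) (dirPerp φ) :=
    ((hψ.continuous_fderiv (by simp)).comp (by fun_prop)).clm_apply h2
  have hint : ∀ g : ℝ → ℂ, Continuous g →
      IntervalIntegrable (fun φ => o φ • g φ) volume (-Real.pi) Real.pi := by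
    intro g hg
    refine (hg.intervalIntegrable _ _).norm.mono_fun
      ((ho.aestronglyMeasurable).smul hg.aestronglyMeasurable)
      (Filter.Eventually.of_forall fun φ => ?_)
    simp only [norm_smul, Real.norm_eq_abs, abs_norm]
    exact mul_le_of_le_one_left (norm_nonneg (g φ)) (ho1 φ)
  set w : ℝ → ℂ := fun φ => (A y r φ * inner ℝ e (dirPerp φ)) • ψ (y - r • dir φ) with hw
  set w1 : ℝ → ℂ := fun φ => perpDeriv A Aφ e y r φ • ψ (y - r • dir φ) with hw1
  set w2 : ℝ → ℂ := fun φ => (A y r φ * inner ℝ e (dirPerp φ)) •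
    fderiv ℝ ψ (y - r • dir φ) (dirPerp φ) with hw2
  have hdw : ∀ φ, HasDerivAt w (w1 φ - r • w2 φ) φ := by
    intro φ
    have h3 : HasDerivAt (fun φ => ψ (y - r • dir φ))
        (fderiv ℝ ψ (y - r • dir φ) (-(r • dirPerp φ))) φ := by
      have h4 : HasDerivAt (fun φ => y - r • dir φ) (-(r • dirPerp φ)) φ := by
        simpa using ((hasDerivAt_dir φ).const_smul r).const_sub y
      exact ((hψ.differentiable (by simp)) _).hasFDerivAt.comp_hasDerivAt φ h4
    refine ((hA.hasDerivAt_mul_perp e y r φ).smul h3).congr_deriv ?_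
    simp only [map_neg, map_smul, hw1, hw2, smul_neg]
    rw [smul_comm r]
    abel
  -- Near a jump of `o` the function `w` vanishes identically, so `o • w` is differentiable
  -- everywhere, with derivative `o • w'`.
  have hdv : ∀ φ, HasDerivAt (fun φ => o φ • w φ) (o φ • (w1 φ - r • w2 φ)) φ := by
    intro φ
    rcases hjump φ with h | h
    · refine ((hdw φ).const_smul (o φ)).congr_of_eventuallyEq ?_
      filter_upwards [h] with φ' h'
      rw [h']; rfl
    · have hw0 : w =ᶠ[𝓝 φ] fun _ => 0 := by
        filter_upwards [h] with φ' h'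
        rcases h' with h' | h' <;> simp [hw, h']
      have h5 : w1 φ - r • w2 φ = 0 :=
        (hdw φ).unique ((hasDerivAt_const φ (0 : ℂ)).congr_of_eventuallyEq hw0)
      rw [h5, smul_zero]
      refine (hasDerivAt_const φ (0 : ℂ)).congr_of_eventuallyEq ?_
      filter_upwards [hw0] with φ' h'
      rw [h', smul_zero]
  have c1 : Continuous w1 := by fun_prop
  have c2 : Continuous w2 := by fun_prop
  have hF := intervalIntegral.integral_eq_sub_of_hasDerivAt (a := -Real.pi) (b := Real.pi)
    (fun φ _ => hdv φ) (hint _ (by fun_prop))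
  -- Periodicity, together with `hop`, cancels the boundary terms at `±π`.
  have hper : w Real.pi = w (-Real.pi) := by
    have e1 : Real.pi = -Real.pi + 2 * Real.pi := by ring
    simp only [hw]
    rw [show A y r Real.pi = A y r (-Real.pi) by
        conv_lhs => rw [e1, hA.periodic],
      show dir Real.pi = dir (-Real.pi) by conv_lhs => rw [e1, dir_add_two_pi],
      show dirPerp Real.pi = dirPerp (-Real.pi) by conv_lhs => rw [e1, dirPerp_add_two_pi]]
  rw [hop, hper, sub_self] at hF
  have hs : ∀ φ, o φ • (w1 φ - r • w2 φ) = o φ • w1 φ - r • (o φ • w2 φ) := fun φ => by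
    rw [smul_sub, smul_comm r (o φ) (w2 φ)]
  simp_rw [hs] at hF
  rw [intervalIntegral.integral_sub (hint w1 c1) (show IntervalIntegrable
      (fun φ => r • (o φ • w2 φ)) volume (-Real.pi) Real.pi from (hint w2 c2).smul r),
    intervalIntegral.integral_smul, sub_eq_zero] at hF
  have i1 : ∀ φ, (o φ * A y r φ * inner ℝ e (dirPerp φ)) •
        fderiv ℝ ψ (y - r • dir φ) (dirPerp φ) = o φ • w2 φ := fun φ => by
    rw [hw2, smul_smul, mul_assoc]
  have i2 : ∀ φ, (o φ * perpDeriv A Aφ e y r φ) • ψ (y - r • dir φ) = o φ • w1 φ := fun φ => by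
    rw [hw1, smul_smul]
  simp_rw [i1, i2]
  exact hF.symm

/-- Integration by parts in the radius. -/
theorem SymbolBound.integral_radius (hA : SymbolBound D R B A Aφ Ar Aφr)
    (hψ : ContDiff ℝ ∞ ψ) {y : Plane} (φ : ℝ)
    (hR : ∀ r, R ≤ |r| → ψ (y - r • dir φ) = 0) :
    ∫ r in -R..R, A y r φ • fderiv ℝ ψ (y - r • dir φ) (dir φ) =
      ∫ r in -R..R, Ar y r φ • ψ (y - r • dir φ) := by
  have hA1 : Continuous fun r => A y r φ :=
    hA.cont.comp (f := fun r => ((y, r, φ) : Plane × ℝ × ℝ)) (by fun_prop)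
  have hA2 : Continuous fun r => Ar y r φ :=
    hA.cont_radius.comp (f := fun r => ((y, r, φ) : Plane × ℝ × ℝ)) (by fun_prop)
  have hψc := hψ.continuous
  have hdψ : Continuous fun r => fderiv ℝ ψ (y - r • dir φ) (dir φ) :=
    ((hψ.continuous_fderiv (by simp)).comp (f := fun r : ℝ => y - r • dir φ)
      (by fun_prop)).clm_apply continuous_const
  have hd : ∀ r, HasDerivAt (fun r => A y r φ • ψ (y - r • dir φ))
      (Ar y r φ • ψ (y - r • dir φ) - A y r φ • fderiv ℝ ψ (y - r • dir φ) (dir φ)) r := by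
    intro r
    have h3 : HasDerivAt (fun r => ψ (y - r • dir φ))
        (fderiv ℝ ψ (y - r • dir φ) (-(dir φ))) r := by
      have h4 : HasDerivAt (fun r : ℝ => y - r • dir φ) (-(dir φ)) r := by
        simpa using ((hasDerivAt_id' r).smul_const (dir φ)).const_sub y
      exact ((hψ.differentiable (by simp)) _).hasFDerivAt.comp_hasDerivAt r h4
    refine ((hA.deriv_radius y r φ).smul h3).congr_deriv ?_
    rw [map_neg, smul_neg]
    abel
  have hF := intervalIntegral.integral_eq_sub_of_hasDerivAt (a := -R) (b := R)
    (fun φ _ => hd φ) (Continuous.intervalIntegrable (by fun_prop) _ _)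
  -- The boundary terms vanish because `ψ` does at `|r| = R`.
  rw [hR R (le_abs_self R), hR (-R) (by rw [abs_neg]; exact le_abs_self R), smul_zero, smul_zero,
    sub_zero, intervalIntegral.integral_sub (Continuous.intervalIntegrable (by fun_prop) _ _)
    (Continuous.intervalIntegrable (by fun_prop) _ _), sub_eq_zero] at hF
  exact hF.symm

end Core

/-! ### Integrals over boxes with a bounded measurable weight -/

section Box

variable {o : ℝ → ℝ}

theorem intervalIntegrable_smul (ho : Measurable o) (ho1 : ∀ φ, |o φ| ≤ 1) {g : ℝ → ℂ}
    (hg : Continuous g) (a b : ℝ) : IntervalIntegrable (fun φ => o φ • g φ) volume a b := by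
  refine (hg.intervalIntegrable _ _).norm.mono_fun
    ((ho.aestronglyMeasurable).smul hg.aestronglyMeasurable)
    (Filter.Eventually.of_forall fun φ => ?_)
  simp only [norm_smul, Real.norm_eq_abs, abs_norm]
  exact mul_le_of_le_one_left (norm_nonneg (g φ)) (ho1 φ)

theorem integrable_box (ho : Measurable o) (ho1 : ∀ φ, |o φ| ≤ 1) {g : ℝ × ℝ → ℂ}
    (hg : Continuous g) (a b c d : ℝ) : Integrable (fun z : ℝ × ℝ => o z.1 • g z)
      ((volume.restrict (Ioc c d)).prod (volume.restrict (Ioc a b))) := by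
  rw [Measure.prod_restrict]
  have h1 : IntegrableOn g (Ioc c d ×ˢ Ioc a b) (volume.prod volume) :=
    (hg.continuousOn.integrableOn_compact (isCompact_Icc.prod isCompact_Icc)).mono_set
      (prod_mono Ioc_subset_Icc_self Ioc_subset_Icc_self)
  refine h1.norm.mono' (((ho.comp measurable_fst).aestronglyMeasurable).smul
    hg.aestronglyMeasurable) (Filter.Eventually.of_forall fun z => ?_)
  simp only [norm_smul, Real.norm_eq_abs]
  exact mul_le_of_le_one_left (norm_nonneg (g z)) (ho1 z.1)

theorem box_swap (ho : Measurable o) (ho1 : ∀ φ, |o φ| ≤ 1) {g : ℝ × ℝ → ℂ}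
    (hg : Continuous g) {a b c d : ℝ} (hab : a ≤ b) (hcd : c ≤ d) :
    ∫ φ in c..d, ∫ r in a..b, o φ • g (φ, r) = ∫ r in a..b, ∫ φ in c..d, o φ • g (φ, r) := by
  simp_rw [intervalIntegral.integral_of_le hab, intervalIntegral.integral_of_le hcd]
  exact integral_integral_swap (integrable_box ho ho1 hg a b c d)

theorem box_intervalIntegrable (ho : Measurable o) (ho1 : ∀ φ, |o φ| ≤ 1) {g : ℝ × ℝ → ℂ}
    (hg : Continuous g) {a b c d : ℝ} (hab : a ≤ b) (hcd : c ≤ d) :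
    IntervalIntegrable (fun r => ∫ φ in c..d, o φ • g (φ, r)) volume a b := by
  simp_rw [intervalIntegral.integral_of_le hcd]
  rw [intervalIntegrable_iff_integrableOn_Ioc_of_le hab]
  exact (integrable_box ho ho1 hg a b c d).integral_prod_right

theorem box_intervalIntegrable' (ho : Measurable o) (ho1 : ∀ φ, |o φ| ≤ 1) {g : ℝ × ℝ → ℂ}
    (hg : Continuous g) {a b c d : ℝ} (hab : a ≤ b) (hcd : c ≤ d) :
    IntervalIntegrable (fun φ => ∫ r in a..b, o φ • g (φ, r)) volume c d := by
  simp_rw [intervalIntegral.integral_of_le hab]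
  rw [intervalIntegrable_iff_integrableOn_Ioc_of_le hcd]
  exact (integrable_box ho ho1 hg a b c d).integral_prod_left

theorem norm_smul_le_of_abs_le {t B : ℝ} (ht : |t| ≤ B) (z : ℂ) : ‖t • z‖ ≤ B * ‖z‖ := by
  rw [norm_smul, Real.norm_eq_abs]; gcongr

theorem abs_mul_le_of_abs_le_one {s t B : ℝ} (hs : |s| ≤ 1) (ht : |t| ≤ B) : |s * t| ≤ B := by
  rw [abs_mul]
  exact (mul_le_of_le_one_left (abs_nonneg t) hs).trans ht

end Box

/-! ### Reduction to directional Hilbert transforms -/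

section Core

variable {D : Set Plane} {R B : ℝ} {A Aφ Ar Aφr : Plane → ℝ → ℝ → ℝ} {o : ℝ → ℝ} {ψ : Plane → ℂ}
  {e : Plane}

/-- The integral of `|ψ|` over the disc of radius `R` around `y`, in polar coordinates and without
the Jacobian. -/
def polarMass (R : ℝ) (ψ : Plane → ℂ) (y : Plane) : ℝ :=
  ∫ φ in -Real.pi..Real.pi, ∫ r in -R..R, ‖ψ (y - r • dir φ)‖

/-- The principal part: an average of directional Hilbert transforms. -/
def hilbertPart (A Aφ : Plane → ℝ → ℝ → ℝ) (o : ℝ → ℝ) (ψ : Plane → ℂ) (e : Plane) (ε R : ℝ)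
    (y : Plane) : ℂ :=
  ∫ φ in -Real.pi..Real.pi, (o φ * perpDeriv A Aφ e y 0 φ) • hilbertTrunc (dir φ) ε R ψ y

theorem neg_pi_le_pi : -Real.pi ≤ Real.pi := by linarith [Real.pi_pos]

theorem continuous_shift (y : Plane) :
    Continuous fun z : ℝ × ℝ => y - z.2 • dir z.1 := by
  have := continuous_dir
  fun_prop

/-- The derivative along `e` splits into a radial and an angular component. The radial one
contributes `B` times the polar mass after integration by parts. For the angular one, the region
`|r| < ε` costs `O(ε)`; elsewhere, integration by parts and freezing the coefficient at `r = 0`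
leave an error of `2 B` times the polar mass, besides the Hilbert part. -/
theorem SymbolBound.norm_polar_sub_le (hA : SymbolBound D R B A Aφ Ar Aφr)
    (ho : Measurable o) (ho1 : ∀ φ, |o φ| ≤ 1) (hop : o (-Real.pi) = o Real.pi)
    (hψ : ContDiff ℝ ∞ ψ) (he : ‖e‖ ≤ 1) {M : ℝ} (hM : ∀ x, ‖fderiv ℝ ψ x‖ ≤ M) {y : Plane}
    (hy : y ∈ D)
    (hjump : ∀ r φ, (∀ᶠ φ' in 𝓝 φ, o φ' = o φ) ∨
      (∀ᶠ φ' in 𝓝 φ, A y r φ' = 0 ∨ ψ (y - r • dir φ') = 0))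
    (hsupp : ∀ r φ, R ≤ |r| → ψ (y - r • dir φ) = 0) {ε : ℝ} (hε : 0 < ε) (hεR : ε ≤ R) :
    ‖(∫ φ in -Real.pi..Real.pi, ∫ r in -R..R,
        (o φ * A y r φ) • fderiv ℝ ψ (y - r • dir φ) e) - hilbertPart A Aφ o ψ e ε R y‖ ≤
      3 * B * polarMass R ψ y + 4 * Real.pi * B * M * ε := by
  have hR : 0 < R := hε.trans_le hεR
  have hRR : -R ≤ R := by linarith
  have hεε : -ε ≤ ε := by linarith
  have hpi := neg_pi_le_pi
  have hB : 0 ≤ B := (abs_nonneg _).trans (hA.bound y hy 0 0 (by simpa using hR.le))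
  have hM0 : 0 ≤ M := (norm_nonneg _).trans (hM 0)
  have hd := continuous_dir
  have hdp := continuous_dirPerp
  have hs := continuous_shift y
  have hψc := hψ.continuous
  have hdψ : Continuous fun z : ℝ × ℝ => fderiv ℝ ψ (y - z.2 • dir z.1) :=
    (hψ.continuous_fderiv (by simp)).comp hs
  have hψs : Continuous fun z : ℝ × ℝ => ψ (y - z.2 • dir z.1) := hψc.comp hs
  have hy3 : Continuous fun z : ℝ × ℝ => ((y, z.2, z.1) : Plane × ℝ × ℝ) := by fun_prop
  have cA : Continuous fun z : ℝ × ℝ => A y z.2 z.1 := hA.cont.comp hy3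
  have cAr : Continuous fun z : ℝ × ℝ => Ar y z.2 z.1 := hA.cont_radius.comp hy3
  have cb : Continuous fun z : ℝ × ℝ => perpDeriv A Aφ e y z.2 z.1 :=
    (hA.continuous_perpDeriv e).comp hy3
  have hAr' : ∀ φ : ℝ, ∀ r ∈ Ioc (-R) R, |Ar y r φ| ≤ B := fun φ r hr =>
    hA.bound_radius y hy r φ (abs_le.2 ⟨hr.1.le, hr.2⟩)
  -- the two components of the derivative
  set g1 : ℝ × ℝ → ℂ := fun z => (A y z.2 z.1 * inner ℝ e (dir z.1)) •
    fderiv ℝ ψ (y - z.2 • dir z.1) (dir z.1) with hg1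
  set g2 : ℝ × ℝ → ℂ := fun z => (A y z.2 z.1 * inner ℝ e (dirPerp z.1)) •
    fderiv ℝ ψ (y - z.2 • dir z.1) (dirPerp z.1) with hg2
  have cg1 : Continuous g1 := (cA.mul (by fun_prop)).smul (hdψ.clm_apply (by fun_prop))
  have cg2 : Continuous g2 := (cA.mul (by fun_prop)).smul (hdψ.clm_apply (by fun_prop))
  have hsplit : ∀ φ r, (o φ * A y r φ) • fderiv ℝ ψ (y - r • dir φ) e =
      o φ • g1 (φ, r) + o φ • g2 (φ, r) := by
    intro φ r
    conv_lhs => rw [← inner_smul_dir_add e φ]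
    simp only [hg1, hg2, map_add, map_smul, smul_add, smul_smul]
    simp only [mul_assoc]
  have e1 : ∫ φ in -Real.pi..Real.pi, ∫ r in -R..R,
        (o φ * A y r φ) • fderiv ℝ ψ (y - r • dir φ) e =
      (∫ φ in -Real.pi..Real.pi, ∫ r in -R..R, o φ • g1 (φ, r)) +
        ∫ φ in -Real.pi..Real.pi, ∫ r in -R..R, o φ • g2 (φ, r) := by
    rw [← intervalIntegral.integral_add (box_intervalIntegrable' ho ho1 cg1 hRR hpi)
      (box_intervalIntegrable' ho ho1 cg2 hRR hpi)]
    refine intervalIntegral.integral_congr fun φ _ => ?_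
    rw [← intervalIntegral.integral_add]
    · exact intervalIntegral.integral_congr fun r _ => hsplit φ r
    · exact ((cg1.comp (by fun_prop : Continuous fun r : ℝ => (φ, r))).const_smul
        (o φ)).intervalIntegrable _ _
    · exact ((cg2.comp (by fun_prop : Continuous fun r : ℝ => (φ, r))).const_smul
        (o φ)).intervalIntegrable _ _
  -- the radial part
  have n1 : ‖∫ φ in -Real.pi..Real.pi, ∫ r in -R..R, o φ • g1 (φ, r)‖ ≤
      B * polarMass R ψ y := by
    rw [polarMass, ← intervalIntegral.integral_const_mul]
    refine intervalIntegral.norm_integral_le_of_norm_le hpi (Filter.Eventually.of_forall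
      fun φ _ => ?_) (Continuous.intervalIntegrable ?_ _ _)
    · have h1 : ∫ r in -R..R, o φ • g1 (φ, r) =
          (o φ * inner ℝ e (dir φ)) • ∫ r in -R..R, Ar y r φ • ψ (y - r • dir φ) := by
        rw [← hA.integral_radius hψ φ (fun r => hsupp r φ), ← intervalIntegral.integral_smul]
        refine intervalIntegral.integral_congr fun r _ => ?_
        simp only [hg1, smul_smul]
        congr 1
        ring
      rw [h1]
      have h2 : |o φ * inner ℝ e (dir φ)| ≤ 1 :=
        abs_mul_le_of_abs_le_one (ho1 φ) (abs_inner_dir_le he φ)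
      refine (norm_smul_le_of_abs_le h2 _).trans ?_
      rw [one_mul, ← intervalIntegral.integral_const_mul]
      refine intervalIntegral.norm_integral_le_of_norm_le hRR (Filter.Eventually.of_forall
        fun r hr => norm_smul_le_of_abs_le (hAr' φ r hr) _)
        (Continuous.intervalIntegrable ?_ _ _)
      exact (hψs.comp (by fun_prop : Continuous fun r : ℝ => (φ, r))).norm.const_mul B
    · refine Continuous.const_mul ?_ B
      exact intervalIntegral.continuous_parametric_intervalIntegral_of_continuous' hψs.norm _ _
  -- the angular part
  set J : ℝ → ℂ := fun r => ∫ φ in -Real.pi..Real.pi, o φ • g2 (φ, r) with hJ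
  have iJ : ∀ a b : ℝ, a ≤ b → IntervalIntegrable J volume a b := fun a b hab =>
    box_intervalIntegrable ho ho1 cg2 hab hpi
  -- The times `r` and `-r` are paired, so that the odd kernel `1/r` acts on the difference of the
  -- two values of `ψ`.
  have e2 : ∫ φ in -Real.pi..Real.pi, ∫ r in -R..R, o φ • g2 (φ, r) =
      (∫ r in -ε..ε, J r) + ∫ r in ε..R, (J r + J (-r)) := by
    rw [box_swap ho ho1 cg2 hRR hpi]
    change ∫ r in -R..R, J r = _
    have i1 := iJ (-R) (-ε) (by linarith)
    have i2 := iJ (-ε) ε hεε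
    have i3 := iJ ε R hεR
    have i4 : IntervalIntegrable (fun r => J (-r)) volume ε R :=
      box_intervalIntegrable ho ho1 (g := fun z => g2 (z.1, -z.2)) (by fun_prop) hεR hpi
    rw [intervalIntegral.integral_add i3 i4, intervalIntegral.integral_comp_neg,
      ← intervalIntegral.integral_add_adjacent_intervals i1 (i2.trans i3),
      ← intervalIntegral.integral_add_adjacent_intervals i2 i3]
    abel
  have nJ : ∀ r ∈ Ioc (-ε) ε, ‖J r‖ ≤ 2 * Real.pi * B * M := by
    intro r hr
    have hr1 : |r| ≤ R := (abs_le.2 ⟨hr.1.le, hr.2⟩).trans hεR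
    refine (intervalIntegral.norm_integral_le_of_norm_le_const (C := B * M) fun φ _ => ?_).trans ?_
    · simp only [hg2, smul_smul]
      refine (norm_smul_le_of_abs_le (B := B) (abs_mul_le_of_abs_le_one (ho1 φ) ?_) _).trans ?_
      · rw [mul_comm]
        exact abs_mul_le_of_abs_le_one (abs_inner_dirPerp_le he φ) (hA.bound y hy r φ hr1)
      · gcongr
        refine (ContinuousLinearMap.le_opNorm _ _).trans ?_
        rw [norm_dirPerp, mul_one]
        exact hM _
    · rw [abs_of_nonneg (by linarith)]
      linarith
  -- Only on this short interval is the gradient of `ψ` bounded by its supremum `M`; the term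
  -- disappears as `ε → 0`.
  have n2 : ‖∫ r in -ε..ε, J r‖ ≤ 4 * Real.pi * B * M * ε := by
    refine (intervalIntegral.norm_integral_le_of_norm_le_const (C := 2 * Real.pi * B * M)
      fun r hr => nJ r (by rwa [uIoc_of_le hεε] at hr)).trans ?_
    rw [abs_of_nonneg (by linarith)]
    linarith
  -- away from the origin
  set b : ℝ → ℝ → ℝ := fun r φ => perpDeriv A Aφ e y r φ with hb
  have cbr : ∀ r, Continuous fun φ => b r φ := fun r =>
    cb.comp (f := fun φ : ℝ => (φ, r)) (by fun_prop)
  have cψr : ∀ r : ℝ, Continuous fun φ => ψ (y - r • dir φ) := fun r =>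
    hψs.comp (f := fun φ : ℝ => (φ, r)) (by fun_prop)
  -- The factor `r` is the length of the tangent vector of the circle `φ ↦ y - r dir φ`; dividing by
  -- it produces the kernel `1/r`.
  have hL : ∀ r, r • J r = ∫ φ in -Real.pi..Real.pi, o φ • (b r φ • ψ (y - r • dir φ)) := by
    intro r
    have h := hA.integral_angle (e := e) ho ho1 hop hψ (hjump r)
    simp_rw [smul_smul, hb]
    rw [← h]
    simp only [hJ, hg2, smul_smul, mul_assoc]
  -- The error of freezing the coefficient at `r = 0`: the differences of `b` are `O(r)` and
  -- compensate `1/r`. The function `k` below is the frozen part. Replacing `r` by `max ε r` changes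
  -- nothing for `r ≥ ε` and keeps both continuous.
  set c : ℝ × ℝ → ℂ := fun z => (max ε z.2)⁻¹ • ((b z.2 z.1 - b 0 z.1) • ψ (y - z.2 • dir z.1) -
    (b (-z.2) z.1 - b 0 z.1) • ψ (y + z.2 • dir z.1)) with hc
  set k : ℝ × ℝ → ℂ := fun z => b 0 z.1 • ((max ε z.2)⁻¹ •
    (ψ (y - z.2 • dir z.1) - ψ (y + z.2 • dir z.1))) with hk
  have cmax : Continuous fun z : ℝ × ℝ => (max ε z.2)⁻¹ := by
    refine Continuous.inv₀ (by fun_prop) fun z => (lt_max_of_lt_left hε).ne'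
  have cb0 : Continuous fun z : ℝ × ℝ => b 0 z.1 :=
    cb.comp (f := fun z : ℝ × ℝ => (z.1, (0 : ℝ))) (by fun_prop)
  have cbm : Continuous fun z : ℝ × ℝ => b (-z.2) z.1 :=
    cb.comp (f := fun z : ℝ × ℝ => (z.1, -z.2)) (by fun_prop)
  have hψs' : Continuous fun z : ℝ × ℝ => ψ (y + z.2 • dir z.1) := by fun_prop
  have cc : Continuous c :=
    cmax.smul (((cb.sub cb0).smul hψs).sub ((cbm.sub cb0).smul hψs'))
  have ck : Continuous k := cb0.smul (cmax.smul (hψs.sub hψs'))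
  have hsum : ∀ r ∈ Icc ε R, J r + J (-r) = (∫ φ in -Real.pi..Real.pi, o φ • c (φ, r)) +
      ∫ φ in -Real.pi..Real.pi, o φ • k (φ, r) := by
    intro r hr
    have hr0 : r ≠ 0 := (hε.trans_le hr.1).ne'
    have h1 : J r + J (-r) = r⁻¹ • (r • J r - (-r) • J (-r)) := by
      rw [neg_smul, sub_neg_eq_add, ← smul_add, smul_smul, inv_mul_cancel₀ hr0, one_smul]
    have i1 := intervalIntegrable_smul ho ho1 (g := fun φ => b r φ • ψ (y - r • dir φ))
      ((cbr r).smul (cψr r)) (-Real.pi) Real.pi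
    have i2 := intervalIntegrable_smul ho ho1 (g := fun φ => b (-r) φ • ψ (y - (-r) • dir φ))
      ((cbr (-r)).smul (cψr (-r))) (-Real.pi) Real.pi
    rw [h1, hL, hL, ← intervalIntegral.integral_sub i1 i2, ← intervalIntegral.integral_smul,
      ← intervalIntegral.integral_add
        (intervalIntegrable_smul ho ho1 (g := fun φ => c (φ, r)) (by fun_prop) _ _)
        (intervalIntegrable_smul ho ho1 (g := fun φ => k (φ, r)) (by fun_prop) _ _)]
    refine intervalIntegral.integral_congr fun φ _ => ?_
    simp only [hc, hk, max_eq_right hr.1, neg_smul, sub_neg_eq_add, Complex.real_smul,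
      Complex.ofReal_sub, Complex.ofReal_inv]
    ring
  have e3 : ∫ r in ε..R, (J r + J (-r)) =
      (∫ r in ε..R, ∫ φ in -Real.pi..Real.pi, o φ • c (φ, r)) + hilbertPart A Aφ o ψ e ε R y := by
    have h1 : hilbertPart A Aφ o ψ e ε R y =
        ∫ r in ε..R, ∫ φ in -Real.pi..Real.pi, o φ • k (φ, r) := by
      rw [← box_swap ho ho1 ck hεR hpi, hilbertPart]
      refine intervalIntegral.integral_congr fun φ _ => ?_
      simp only [hk]
      rw [hilbertTrunc_eq hεR, ← intervalIntegral.integral_smul]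
      refine intervalIntegral.integral_congr fun r _ => ?_
      simp only [hb, Complex.real_smul, Complex.ofReal_mul, Complex.ofReal_inv]
      ring
    rw [h1, ← intervalIntegral.integral_add (box_intervalIntegrable ho ho1 cc hεR hpi)
      (box_intervalIntegrable ho ho1 ck hεR hpi)]
    refine intervalIntegral.integral_congr fun r hr => ?_
    rw [uIcc_of_le hεR] at hr
    exact hsum r hr
  have n3 : ‖∫ r in ε..R, ∫ φ in -Real.pi..Real.pi, o φ • c (φ, r)‖ ≤
      2 * B * polarMass R ψ y := by
    rw [← box_swap ho ho1 cc hεR hpi, polarMass, ← intervalIntegral.integral_const_mul]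
    refine intervalIntegral.norm_integral_le_of_norm_le hpi (Filter.Eventually.of_forall
      fun φ _ => ?_) (Continuous.intervalIntegrable ?_ _ _)
    · have cn : Continuous fun r : ℝ => ‖ψ (y - r • dir φ)‖ :=
        (hψs.comp (by fun_prop : Continuous fun r : ℝ => (φ, r))).norm
      -- The mass on `ε < |r| < R` is part of the mass on `|r| < R`; the middle interval is dropped
      -- by positivity.
      have h1 : ∫ r in -R..R, ‖ψ (y - r • dir φ)‖ =
          (∫ r in -ε..ε, ‖ψ (y - r • dir φ)‖) +
            ∫ r in ε..R, (‖ψ (y - r • dir φ)‖ + ‖ψ (y + r • dir φ)‖) := by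
        have i : ∀ a b : ℝ, IntervalIntegrable (fun r : ℝ => ‖ψ (y - r • dir φ)‖) volume a b :=
          fun a b => cn.intervalIntegrable a b
        have i4 : IntervalIntegrable (fun r : ℝ => ‖ψ (y + r • dir φ)‖) volume ε R :=
          Continuous.intervalIntegrable (by fun_prop) _ _
        have h2 : ∫ r in ε..R, ‖ψ (y + r • dir φ)‖ = ∫ r in -R..-ε, ‖ψ (y - r • dir φ)‖ := by
          rw [← intervalIntegral.integral_comp_neg]
          simp
        rw [intervalIntegral.integral_add (i _ _) i4, h2,
          ← intervalIntegral.integral_add_adjacent_intervals (i (-R) (-ε)) (i (-ε) R),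
          ← intervalIntegral.integral_add_adjacent_intervals (i (-ε) ε) (i ε R)]
        ring
      have h3 : 0 ≤ ∫ r in -ε..ε, ‖ψ (y - r • dir φ)‖ :=
        intervalIntegral.integral_nonneg hεε fun _ _ => norm_nonneg _
      have h4 : ‖∫ r in ε..R, o φ • c (φ, r)‖ ≤
          ∫ r in ε..R, 2 * B * (‖ψ (y - r • dir φ)‖ + ‖ψ (y + r • dir φ)‖) := by
        refine intervalIntegral.norm_integral_le_of_norm_le hεR (Filter.Eventually.of_forall
          fun r hr => ?_) (Continuous.intervalIntegrable (by fun_prop) _ _)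
        have hr0 : 0 < r := hε.trans hr.1
        have hrR : |r| ≤ R := by rw [abs_of_pos hr0]; exact hr.2
        have hrR' : |(-r)| ≤ R := by rwa [abs_neg]
        refine (norm_smul_le_of_abs_le (ho1 φ) _).trans ?_
        rw [one_mul]
        simp only [hc, max_eq_right hr.1.le, norm_smul, norm_inv, Real.norm_eq_abs,
          abs_of_pos hr0]
        rw [inv_mul_le_iff₀ hr0]
        have h5 := hA.abs_perpDeriv_sub_le he hy hrR φ
        have h6 := hA.abs_perpDeriv_sub_le he hy hrR' φ
        rw [abs_neg] at h6
        rw [abs_of_pos hr0] at h5 h6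
        refine (norm_sub_le _ _).trans ?_
        have h7 := norm_smul_le_of_abs_le h5 (ψ (y - r • dir φ))
        have h8 := norm_smul_le_of_abs_le h6 (ψ (y + r • dir φ))
        simp only [hb]
        linarith
      refine h4.trans ?_
      rw [intervalIntegral.integral_const_mul, h1]
      have : 0 ≤ 2 * B := by linarith
      gcongr
      linarith
    · refine Continuous.const_mul ?_ _
      exact intervalIntegral.continuous_parametric_intervalIntegral_of_continuous' hψs.norm _ _
  rw [e1, e2, e3]
  have : ∀ a b c d : ℂ, a + (b + (c + d)) - d = a + b + c := fun a b c d => by ring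
  rw [this]
  refine (norm_add₃_le).trans ?_
  linarith

end Core

/-! ### `L²` bounds after integration over the base point -/

section Core

variable {D : Set Plane} {R B : ℝ} {A Aφ Ar Aφr : Plane → ℝ → ℝ → ℝ} {o : ℝ → ℝ} {ψ : Plane → ℂ}
  {e : Plane}

theorem integral_norm_mul_shift_le {f : Plane → ℂ} (hf : MemLp f 2 volume)
    (hψ : MemLp ψ 2 volume) (v : Plane) (D : Set Plane) :
    ∫ y in D, ‖f y‖ * ‖ψ (y - v)‖ ≤ (eLpNorm f 2 volume).toReal * (eLpNorm ψ 2 volume).toReal := by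
  have hmp : MeasurePreserving (fun y : Plane => y - v) volume volume :=
    measurePreserving_sub_right volume v
  have h1 : MemLp (fun y => ψ (y - v)) 2 volume := hψ.comp_measurePreserving hmp
  have h2 : eLpNorm (fun y => ψ (y - v)) 2 volume = eLpNorm ψ 2 volume :=
    eLpNorm_comp_measurePreserving hψ.1 hmp
  calc ∫ y in D, ‖f y‖ * ‖ψ (y - v)‖ ≤ ∫ y, ‖f y‖ * ‖ψ (y - v)‖ :=
        setIntegral_le_integral (hf.norm.integrable_mul h1.norm)
          (Filter.Eventually.of_forall fun y => by positivity)
    _ ≤ _ := by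
        rw [← h2]
        exact integral_norm_mul_norm_le hf h1

/-- For fixed `(φ, r)` the integral over `y` pairs `f` with a translate of `ψ`, and Cauchy–Schwarz
applies. The factor `4 π R` is the area of the parameter rectangle. -/
theorem integral_mul_polarMass_le (hR : 0 ≤ R) {f : Plane → ℂ} (hf : MemLp f 2 volume)
    (hf1 : IntegrableOn f D) (hψ : Continuous ψ) (hψc : HasCompactSupport ψ) :
    IntegrableOn (fun y => ‖f y‖ * polarMass R ψ y) D ∧
    ∫ y in D, ‖f y‖ * polarMass R ψ y ≤
      4 * Real.pi * R * ((eLpNorm f 2 volume).toReal * (eLpNorm ψ 2 volume).toReal) := by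
  have hd := continuous_dir
  have hRR : -R ≤ R := by linarith
  obtain ⟨M, hM⟩ := hψ.bounded_above_of_compact_support hψc
  have hψ2 : MemLp ψ 2 volume := hψ.memLp_of_hasCompactSupport hψc
  set μ := (volume.restrict (Ioc (-Real.pi) Real.pi)).prod (volume.restrict (Ioc (-R) R)) with hμ
  set F : Plane → ℝ × ℝ → ℝ := fun y z => ‖f y‖ * ‖ψ (y - z.2 • dir z.1)‖ with hF
  have hint : Integrable (Function.uncurry F) ((volume.restrict D).prod μ) := by
    have h1 : Integrable (fun q : Plane × ℝ × ℝ => ‖f q.1‖ * (1 : ℝ))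
      ((volume.restrict D).prod μ) := hf1.norm.mul_prod (integrable_const (1 : ℝ))
    simp_rw [mul_one] at h1
    refine h1.mul_bdd (c := M) (Continuous.aestronglyMeasurable (by fun_prop))
      (Filter.Eventually.of_forall fun q => ?_)
    rw [norm_norm]
    exact hM _
  have hZ : ∀ y, ‖f y‖ * polarMass R ψ y = ∫ z, F y z ∂μ := by
    intro y
    simp only [hF]
    rw [integral_const_mul, polarMass]
    congr 1
    rw [hμ, integral_prod]
    · simp_rw [intervalIntegral.integral_of_le hRR, intervalIntegral.integral_of_le neg_pi_le_pi]
    · refine Integrable.of_bound (Continuous.aestronglyMeasurable (by fun_prop)) M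
        (Filter.Eventually.of_forall fun q => ?_)
      rw [norm_norm]
      exact hM _
  refine ⟨?_, ?_⟩
  · simp_rw [hZ]
    exact hint.integral_prod_left
  · simp_rw [hZ]
    rw [integral_integral_swap hint]
    set N := (eLpNorm f 2 volume).toReal * (eLpNorm ψ 2 volume).toReal
    have h2 : ∫ z, (∫ y in D, F y z) ∂μ ≤ ∫ z, N ∂μ := by
      refine integral_mono hint.integral_prod_right (integrable_const _) fun z => ?_
      exact integral_norm_mul_shift_le hf hψ2 _ _
    refine h2.trans_eq ?_
    rw [integral_const, smul_eq_mul]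
    congr 1
    rw [hμ, ← univ_prod_univ, measureReal_prod_prod]
    simp only [measureReal_restrict_apply_univ, Real.volume_real_Ioc]
    rw [max_eq_left (by linarith [Real.pi_pos]), max_eq_left (by linarith)]
    ring

/-- For a fixed direction the coefficient depends on `y` only and is absorbed into `f`, so the
uniform bound of the Hilbert transform suffices and no regularity of `o` is needed. The constant is
`6` from the transform, `2 B` from the coefficient and `2 π` from the directions. -/
theorem SymbolBound.norm_integral_hilbertPart_le (hA : SymbolBound D R B A Aφ Ar Aφr)
    (hD : MeasurableSet D) (ho : Measurable o) (ho1 : ∀ φ, |o φ| ≤ 1)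
    (hψ : ContDiff ℝ ∞ ψ) (hψc : HasCompactSupport ψ) (he : ‖e‖ ≤ 1) (hB : 0 ≤ B)
    {ε : ℝ} (hε : 0 < ε) (hεR : ε ≤ R) {f : Plane → ℂ} (hf : MemLp f 2 volume)
    (hf1 : IntegrableOn f D) :
    IntegrableOn (fun y => f y * hilbertPart A Aφ o ψ e ε R y) D ∧
    ‖∫ y in D, f y * hilbertPart A Aφ o ψ e ε R y‖ ≤
      24 * Real.pi * B * ((eLpNorm f 2 volume).toReal * (eLpNorm ψ 2 volume).toReal) := by
  have hd := continuous_dir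
  have hR : 0 < R := hε.trans_le hεR
  set b : Plane → ℝ → ℝ := fun y φ => perpDeriv A Aφ e y 0 φ with hb
  have cb : Continuous fun q : Plane × ℝ => b q.1 q.2 :=
    (hA.continuous_perpDeriv e).comp (f := fun q : Plane × ℝ => (q.1, (0 : ℝ), q.2)) (by fun_prop)
  have hbB : ∀ y ∈ D, ∀ φ, |o φ * b y φ| ≤ 2 * B := fun y hy φ =>
    abs_mul_le_of_abs_le_one (ho1 φ) (hA.abs_perpDeriv_le he hy (by simpa using hR.le) φ)
  have cH : Continuous fun q : Plane × ℝ => hilbertTrunc (dir q.2) ε R ψ q.1 := by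
    simp_rw [hilbertTrunc_eq hεR]
    refine intervalIntegral.continuous_parametric_intervalIntegral_of_continuous' ?_ _ _
    have hψ' := hψ.continuous
    exact ((continuous_inv_max hε).comp continuous_snd).mul (by fun_prop)
  obtain ⟨M, hM⟩ := hψ.continuous.bounded_above_of_compact_support hψc
  have hM0 : 0 ≤ M := (norm_nonneg _).trans (hM 0)
  have hHM : ∀ θ y, ‖hilbertTrunc θ ε R ψ y‖ ≤ ε⁻¹ * (2 * M) * (R - ε) := by
    intro θ y
    rw [hilbertTrunc_eq hεR, ← abs_of_nonneg (by linarith : 0 ≤ R - ε)]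
    refine intervalIntegral.norm_integral_le_of_norm_le_const fun r _ => ?_
    rw [norm_mul]
    refine mul_le_mul (norm_inv_max_le hε r) ((norm_sub_le _ _).trans ?_) (norm_nonneg _)
      (by positivity)
    linarith [hM (y - r • θ), hM (y + r • θ)]
  set μ := volume.restrict (Ioc (-Real.pi) Real.pi) with hμ
  set F : Plane → ℝ → ℂ := fun y φ => f y * ((o φ * b y φ) • hilbertTrunc (dir φ) ε R ψ y) with hF
  have hoM : AEStronglyMeasurable (fun q : Plane × ℝ => o q.2 * b q.1 q.2)
      ((volume.restrict D).prod μ) :=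
    (ho.comp measurable_snd).aestronglyMeasurable.mul cb.aestronglyMeasurable
  have hDae : ∀ᵐ q ∂((volume.restrict D).prod μ), q.1 ∈ D :=
    Measure.quasiMeasurePreserving_fst.ae (ae_restrict_mem hD)
  have hint : Integrable (Function.uncurry F) ((volume.restrict D).prod μ) := by
    have h1 : Integrable (fun q : Plane × ℝ => f q.1 * (1 : ℂ))
      ((volume.restrict D).prod μ) := hf1.mul_prod (integrable_const (1 : ℂ))
    simp_rw [mul_one] at h1
    refine h1.mul_bdd (c := 2 * B * (ε⁻¹ * (2 * M) * (R - ε)))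
      (hoM.smul cH.aestronglyMeasurable) ?_
    filter_upwards [hDae] with q hq
    refine (norm_smul_le_of_abs_le (hbB q.1 hq q.2) _).trans ?_
    have : 0 ≤ 2 * B := (abs_nonneg _).trans (hbB q.1 hq q.2)
    gcongr
    exact hHM _ _
  have hZ : ∀ y, f y * hilbertPart A Aφ o ψ e ε R y = ∫ φ, F y φ ∂μ := by
    intro y
    simp only [hF]
    rw [integral_const_mul, hilbertPart, intervalIntegral.integral_of_le neg_pi_le_pi]
  simp_rw [hZ]
  refine ⟨hint.integral_prod_left, ?_⟩
  rw [integral_integral_swap hint, hμ, ← intervalIntegral.integral_of_le neg_pi_le_pi]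
  set N := (eLpNorm f 2 volume).toReal * (eLpNorm ψ 2 volume).toReal with hN
  have key : ∀ φ, ‖∫ y in D, F y φ‖ ≤ 12 * B * N := by
    intro φ
    set g : Plane → ℂ := D.indicator fun y => (o φ * b y φ) • f y with hg
    have hg_le : ∀ y, ‖g y‖ ≤ 2 * B * ‖f y‖ := by
      intro y
      by_cases hy : y ∈ D
      · rw [hg, indicator_of_mem hy]
        exact norm_smul_le_of_abs_le (hbB y hy φ) _
      · rw [hg, indicator_of_notMem hy, norm_zero]
        positivity
    have hgm : MemLp g 2 volume := by
      refine hf.of_le_mul (c := 2 * B) ?_ (Filter.Eventually.of_forall hg_le)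
      refine AEStronglyMeasurable.indicator ?_ hD
      refine AEStronglyMeasurable.smul (f := fun y => o φ * b y φ) ?_ hf.1
      exact (cb.comp (f := fun y : Plane => (y, φ)) (by fun_prop)).aestronglyMeasurable.const_mul _
    have h1 : ∫ y in D, F y φ = ∫ y, g y * hilbertTrunc (dir φ) ε R ψ y := by
      rw [← integral_indicator hD]
      refine integral_congr_ae (Filter.Eventually.of_forall fun y => ?_)
      simp only [hg, hF, indicator]
      split_ifs
      · simp only [Complex.real_smul]; ring
      · simp
    rw [h1]
    refine (norm_integral_mul_hilbertTrunc_le hε hεR hψ hψc hgm).trans ?_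
    have h2 : (eLpNorm g 2 volume).toReal ≤ 2 * B * (eLpNorm f 2 volume).toReal := by
      have h3 := eLpNorm_le_mul_eLpNorm_of_ae_le_mul (μ := volume)
        (Filter.Eventually.of_forall hg_le) 2
      have h4 := ENNReal.toReal_mono (ENNReal.mul_ne_top ENNReal.ofReal_ne_top hf.2.ne) h3
      rwa [ENNReal.toReal_mul, ENNReal.toReal_ofReal (by positivity)] at h4
    calc _ ≤ 6 * (2 * B * (eLpNorm f 2 volume).toReal) * (eLpNorm ψ 2 volume).toReal := by gcongr
      _ = _ := by rw [hN]; ring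
  refine (intervalIntegral.norm_integral_le_of_norm_le_const fun φ _ => key φ).trans ?_
  rw [abs_of_nonneg (by linarith [Real.pi_pos])]
  exact le_of_eq (by ring)

/-- The key estimate: the derivative of `ψ`, averaged against a symbol along the lines through `y`,
is bounded by the `L²` norm of `ψ` itself. -/
theorem IsSymbol.norm_integral_fderiv_le (hA : IsSymbol D R B A) (hR : 0 < R) (hB : 0 ≤ B)
    (hD : MeasurableSet D) (ho : Measurable o) (ho1 : ∀ φ, |o φ| ≤ 1)
    (hop : o (-Real.pi) = o Real.pi) (hψ : ContDiff ℝ ∞ ψ) (hψc : HasCompactSupport ψ)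
    (he : ‖e‖ ≤ 1)
    (hjump : ∀ y ∈ D, ∀ r φ, (∀ᶠ φ' in 𝓝 φ, o φ' = o φ) ∨
      (∀ᶠ φ' in 𝓝 φ, A y r φ' = 0 ∨ ψ (y - r • dir φ') = 0))
    (hsupp : ∀ y ∈ D, ∀ r φ, R ≤ |r| → ψ (y - r • dir φ) = 0)
    {f : Plane → ℂ} (hf : MemLp f 2 volume) (hf1 : IntegrableOn f D) :
    ‖∫ y in D, f y * ∫ φ in -Real.pi..Real.pi, ∫ r in -R..R,
        (o φ * A y r φ) • fderiv ℝ ψ (y - r • dir φ) e‖ ≤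
      12 * Real.pi * (R + 2) * B *
        ((eLpNorm f 2 volume).toReal * (eLpNorm ψ 2 volume).toReal) := by
  obtain ⟨Aφ, Ar, Aφr, hA⟩ := hA
  have hRR : -R ≤ R := by linarith
  have hd := continuous_dir
  have hdψ : Continuous (fderiv ℝ ψ) := hψ.continuous_fderiv (by simp)
  obtain ⟨M, hM⟩ : ∃ M, ∀ x, ‖fderiv ℝ ψ x‖ ≤ M :=
    hdψ.bounded_above_of_compact_support (hψc.fderiv ℝ)
  have hM0 : 0 ≤ M := (norm_nonneg _).trans (hM 0)
  set N := (eLpNorm f 2 volume).toReal * (eLpNorm ψ 2 volume).toReal with hN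
  set X : Plane → ℂ := fun y => ∫ φ in -Real.pi..Real.pi, ∫ r in -R..R,
        (o φ * A y r φ) • fderiv ℝ ψ (y - r • dir φ) e with hX
  -- measurability
  set μ := (volume.restrict (Ioc (-Real.pi) Real.pi)).prod (volume.restrict (Ioc (-R) R)) with hμ
  have hg : Continuous fun q : Plane × ℝ × ℝ =>
      A q.1 q.2.2 q.2.1 • fderiv ℝ ψ (q.1 - q.2.2 • dir q.2.1) e := by
    refine Continuous.smul (hA.cont.comp (f := fun q : Plane × ℝ × ℝ => (q.1, q.2.2, q.2.1))
      (by fun_prop)) ?_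
    exact (hdψ.comp (f := fun q : Plane × ℝ × ℝ => q.1 - q.2.2 • dir q.2.1)
      (by fun_prop)).clm_apply continuous_const
  have hXe : X = fun y => ∫ z, o z.1 • (A y z.2 z.1 • fderiv ℝ ψ (y - z.2 • dir z.1) e) ∂μ := by
    funext y
    rw [hμ, integral_prod _ (integrable_box ho ho1 (g := fun z : ℝ × ℝ =>
      A y z.2 z.1 • fderiv ℝ ψ (y - z.2 • dir z.1) e) (hg.comp (f := fun z : ℝ × ℝ => (y, z))
      (by fun_prop)) (-R) R (-Real.pi) Real.pi)]
    simp only [hX, intervalIntegral.integral_of_le hRR,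
      intervalIntegral.integral_of_le neg_pi_le_pi, smul_smul]
  have hXm : StronglyMeasurable X := by
    rw [hXe]
    refine StronglyMeasurable.integral_prod_right' (f := fun q : Plane × ℝ × ℝ =>
      o q.2.1 • (A q.1 q.2.2 q.2.1 • fderiv ℝ ψ (q.1 - q.2.2 • dir q.2.1) e)) ?_
    exact ((ho.comp (measurable_fst.comp measurable_snd)).stronglyMeasurable).smul
      hg.stronglyMeasurable
  have hXb : ∀ y ∈ D, ‖X y‖ ≤ B * M * |R - -R| * |Real.pi - -Real.pi| := by
    intro y hy
    refine intervalIntegral.norm_integral_le_of_norm_le_const fun φ _ => ?_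
    refine intervalIntegral.norm_integral_le_of_norm_le_const fun r hr => ?_
    rw [uIoc_of_le hRR] at hr
    have h1 := abs_mul_le_of_abs_le_one (ho1 φ)
      (hA.bound y hy r φ (abs_le.2 ⟨hr.1.le, hr.2⟩))
    refine (norm_smul_le_of_abs_le h1 _).trans ?_
    gcongr
    refine (ContinuousLinearMap.le_opNorm _ _).trans ?_
    exact (mul_le_of_le_one_right (norm_nonneg _) he).trans (hM _)
  have hfX : IntegrableOn (fun y => f y * X y) D :=
    hf1.mul_bdd hXm.aestronglyMeasurable (by
      filter_upwards [ae_restrict_mem hD] with y hy using hXb y hy)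
  obtain ⟨iZ, hZ⟩ := integral_mul_polarMass_le hR.le hf hf1 hψ.continuous hψc
  -- The truncation error contains `M = sup ‖∇ψ‖`, which must not enter the bound. The truncation
  -- `ε` is therefore chosen last, depending on `M`, to make that error at most `η`.
  refine le_of_forall_pos_le_add fun η hη => ?_
  set L := 4 * Real.pi * B * M * ∫ y in D, ‖f y‖ with hL
  have hL0 : 0 ≤ L := by
    have : 0 ≤ ∫ y in D, ‖f y‖ := integral_nonneg fun _ => norm_nonneg _
    positivity
  set ε := min R (η / (L + 1)) with hε'
  have hε : 0 < ε := lt_min hR (by positivity)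
  have hεR : ε ≤ R := min_le_left _ _
  have hLε : L * ε ≤ η := by
    have h1 : ε ≤ η / (L + 1) := min_le_right _ _
    have h2 : L * (η / (L + 1)) ≤ η := by
      rw [mul_div_assoc', div_le_iff₀ (by linarith)]
      nlinarith
    exact (mul_le_mul_of_nonneg_left h1 hL0).trans h2
  obtain ⟨iH, hH⟩ := hA.norm_integral_hilbertPart_le hD ho ho1 hψ hψc he hB hε hεR hf hf1
  have hdiff : ‖∫ y in D, (f y * X y - f y * hilbertPart A Aφ o ψ e ε R y)‖ ≤
      3 * B * (4 * Real.pi * R * N) + L * ε := by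
    refine (norm_integral_le_of_norm_le (g := fun y => 3 * B * (‖f y‖ * polarMass R ψ y) +
      4 * Real.pi * B * M * ε * ‖f y‖) ((iZ.const_mul _).add (hf1.norm.const_mul _)) ?_).trans ?_
    · filter_upwards [ae_restrict_mem hD] with y hy
      rw [← mul_sub, norm_mul]
      have h := hA.norm_polar_sub_le ho ho1 hop hψ he hM hy (hjump y hy) (hsupp y hy) hε hεR
      calc _ ≤ ‖f y‖ * (3 * B * polarMass R ψ y + 4 * Real.pi * B * M * ε) := by gcongr
        _ = _ := by ring
    · rw [integral_add (iZ.const_mul _) (hf1.norm.const_mul _), integral_const_mul,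
        integral_const_mul]
      have h3 : 0 ≤ 3 * B := by linarith
      have h4 := mul_le_mul_of_nonneg_left hZ h3
      rw [hL]
      linarith
  rw [integral_sub hfX iH] at hdiff
  have h5 := norm_le_norm_sub_add (∫ y in D, f y * X y)
    (∫ y in D, f y * hilbertPart A Aφ o ψ e ε R y)
  linarith

end Core

/-! ### The square and its boundary -/

theorem isOpen_square : IsOpen square := by
  have : square = ⋂ i, {x : Plane | 0 < x i ∧ x i < 1} := by ext; simp [square]
  rw [this]
  refine isOpen_iInter_of_finite fun i => ?_
  have hi : Continuous fun x : Plane => x i := by fun_prop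
  exact (isOpen_lt continuous_const hi).inter (isOpen_lt hi continuous_const)

theorem mem_closure_square {x : Plane} : x ∈ closure square ↔ ∀ i, 0 ≤ x i ∧ x i ≤ 1 := by
  constructor
  · intro h
    have hc : IsClosed {x : Plane | ∀ i, 0 ≤ x i ∧ x i ≤ 1} := by
      simp only [ofPred_forall]
      refine isClosed_iInter fun i => ?_
      have hi : Continuous fun x : Plane => x i := by fun_prop
      exact (isClosed_le continuous_const hi).inter (isClosed_le hi continuous_const)
    exact closure_minimal (fun x hx i => ⟨(hx i).1.le, (hx i).2.le⟩) hc h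
  · intro h
    -- The segment from a point of the closed square to the centre lies in the open square, except
    -- possibly for its starting point.
    set c : Plane := !₂[1 / 2, 1 / 2] with hc
    have hci : ∀ i, c i = 1 / 2 := fun i => by fin_cases i <;> rfl
    have h1 : Filter.Tendsto (fun t : ℝ => x + t • (c - x)) (𝓝[>] 0) (𝓝 x) := by
      have : Filter.Tendsto (fun t : ℝ => x + t • (c - x)) (𝓝 0) (𝓝 (x + (0 : ℝ) • (c - x))) :=
        Continuous.tendsto (by fun_prop) 0
      rw [zero_smul, add_zero] at this
      exact this.mono_left nhdsWithin_le_nhds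
    refine mem_closure_of_tendsto h1 ?_
    filter_upwards [Ioo_mem_nhdsGT (zero_lt_one' ℝ)] with t ht i
    obtain ⟨h2, h3⟩ := h i
    simp only [PiLp.add_apply, PiLp.smul_apply, PiLp.sub_apply, smul_eq_mul, hci]
    constructor <;> nlinarith [ht.1, ht.2]

theorem mem_frontier_square {x : Plane} :
    x ∈ frontier square ↔ (∀ i, 0 ≤ x i ∧ x i ≤ 1) ∧ ∃ i, x i = 0 ∨ x i = 1 := by
  rw [isOpen_square.frontier_eq, mem_sdiff, mem_closure_square]
  refine and_congr_right fun h => ?_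
  simp only [square, mem_ofPred_eq, not_forall]
  refine exists_congr fun i => ?_
  obtain ⟨h1, h2⟩ := h i
  constructor
  · intro h3
    by_contra! h4
    exact h3 ⟨lt_of_le_of_ne h1 (Ne.symm h4.1), lt_of_le_of_ne h2 h4.2⟩
  · rintro (h3 | h3) <;> simp [h3]

/-- A ray which enters the square is oriented inwards at each edge through its base point. -/
theorem pos_of_mem_inflow {E : Set Plane} {x θ : Plane} (h : (x, θ) ∈ inflow E) {i : Fin 2}
    (hi : x i = 0) : 0 < θ i := by
  obtain ⟨-, -, t, ht, hs⟩ := h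
  have := (hs i).1
  simp only [PiLp.add_apply, PiLp.smul_apply, smul_eq_mul, hi, zero_add] at this
  exact pos_of_mul_pos_right this ht.le

theorem neg_of_mem_inflow {E : Set Plane} {x θ : Plane} (h : (x, θ) ∈ inflow E) {i : Fin 2}
    (hi : x i = 1) : θ i < 0 := by
  obtain ⟨-, -, t, ht, hs⟩ := h
  have := (hs i).2
  simp only [PiLp.add_apply, PiLp.smul_apply, smul_eq_mul, hi] at this
  nlinarith

theorem measurableSet_inflow {E : Set Plane} (hE : MeasurableSet E) :
    MeasurableSet (inflow E) := by
  have h1 : MeasurableSet {p : Plane × Plane | p.1 ∈ E ∩ frontier square} :=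
    measurable_fst (hE.inter isClosed_frontier.measurableSet)
  have h2 : MeasurableSet {p : Plane × Plane | ‖p.2‖ = 1} :=
    (isClosed_eq (by fun_prop) continuous_const).measurableSet
  have h3 : IsOpen {p : Plane × Plane | ∃ t : ℝ, 0 < t ∧ p.1 + t • p.2 ∈ square} := by
    have : {p : Plane × Plane | ∃ t : ℝ, 0 < t ∧ p.1 + t • p.2 ∈ square} =
        ⋃ t : ℝ, ⋃ _ : 0 < t, (fun p : Plane × Plane => p.1 + t • p.2) ⁻¹' square := by
      ext; simp
    rw [this]
    exact isOpen_iUnion fun t => isOpen_iUnion fun _ => isOpen_square.preimage (by fun_prop)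
  exact h1.inter (h2.inter h3.measurableSet)

/-- The angle of a vector, in `(-π, π]`. -/
def angle (θ : Plane) : ℝ := Complex.arg ⟨θ 0, θ 1⟩

theorem measurable_angle : Measurable angle := by
  refine Complex.measurable_arg.comp ?_
  have : (fun θ : Plane => (⟨θ 0, θ 1⟩ : ℂ)) = fun θ => (θ 0 : ℂ) + (θ 1 : ℂ) * Complex.I := by
    funext θ
    exact Complex.mk_eq_add_mul_I _ _
  rw [this]
  fun_prop

theorem angle_dir {φ : ℝ} (hφ : φ ∈ Ioc (-Real.pi) Real.pi) : angle (dir φ) = φ := by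
  rw [angle, dir_zero, dir_one, Complex.mk_eq_add_mul_I]
  push_cast
  exact Complex.arg_cos_add_sin_mul_I hφ

theorem dir_angle {θ : Plane} (hθ : ‖θ‖ = 1) : dir (angle θ) = θ := by
  have hn : ‖(⟨θ 0, θ 1⟩ : ℂ)‖ = 1 := by
    rw [EuclideanSpace.norm_eq, Fin.sum_univ_two] at hθ
    rw [Complex.norm_eq_sqrt_sq_add_sq]
    simpa using hθ
  have h0 : (⟨θ 0, θ 1⟩ : ℂ) ≠ 0 := fun h => by rw [h] at hn; simp at hn
  ext i
  fin_cases i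
  · change Real.cos _ = _
    rw [angle, Complex.cos_arg h0, hn]; simp
  · change Real.sin _ = _
    rw [angle, Complex.sin_arg, hn]; simp

/-! ### Santaló's formula -/

theorem lintegral_comp_affine {a : ℝ} (ha : a ≠ 0) (e : ℝ) {f : ℝ → ℝ≥0∞} (hf : Measurable f) :
    ENNReal.ofReal |a| * ∫⁻ t, f (e + t * a) = ∫⁻ y, f y := by
  have h1 : ∫⁻ t, f (e + t * a) = ∫⁻ t, (fun u => f (e + u)) (a * t) := by simp_rw [mul_comm a]
  rw [h1, ← lintegral_map (f := fun u => f (e + u)) (by fun_prop) (by fun_prop),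
    Real.map_volume_mul_left ha, lintegral_smul_measure, smul_eq_mul, ← mul_assoc,
    ← ENNReal.ofReal_mul (abs_nonneg _), ← abs_mul, mul_inv_cancel₀ ha, abs_one,
    ENNReal.ofReal_one, one_mul, lintegral_add_left_eq_self]

/-- The map `(s, t) ↦ (s + t b, e + t a)` has Jacobian `|a|` and maps the strip `0 < s < 1` onto the
tube of lines through the edge. The computation is a shear at each height followed by an affine
change of variables. -/
theorem lintegral_tube {a : ℝ} (ha : a ≠ 0) (b e : ℝ) {G : ℝ × ℝ → ℝ≥0∞} (hG : Measurable G) :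
    ENNReal.ofReal |a| * ∫⁻ s in Ioo (0 : ℝ) 1, ∫⁻ t, G (s + t * b, e + t * a) =
      ∫⁻ y in {y : ℝ × ℝ | y.1 - (y.2 - e) * b / a ∈ Ioo (0 : ℝ) 1}, G y := by
  have hS : MeasurableSet {y : ℝ × ℝ | y.1 - (y.2 - e) * b / a ∈ Ioo (0 : ℝ) 1} :=
    measurableSet_Ioo.preimage (by fun_prop)
  rw [← lintegral_indicator hS, Measure.volume_eq_prod,
    lintegral_prod_symm _ (hG.indicator hS).aemeasurable]
  have h1 : ∀ y, ∫⁻ x, {y : ℝ × ℝ | y.1 - (y.2 - e) * b / a ∈ Ioo (0 : ℝ) 1}.indicator G (x, y) =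
      ∫⁻ s in Ioo (0 : ℝ) 1, G (s + (y - e) * b / a, y) := by
    intro y
    rw [← lintegral_add_right_eq_self _ ((y - e) * b / a), ← lintegral_indicator measurableSet_Ioo]
    refine lintegral_congr fun s => ?_
    simp only [indicator, mem_ofPred_eq, add_sub_cancel_right]
  simp_rw [h1]
  rw [← lintegral_comp_affine ha e (f := fun y => ∫⁻ s in Ioo (0 : ℝ) 1,
    G (s + (y - e) * b / a, y))]
  · congr 1
    rw [lintegral_lintegral_swap]
    · refine lintegral_congr fun t => lintegral_congr fun s => ?_
      congr 3
      field_simp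
      ring
    · exact (hG.comp (by fun_prop)).aemeasurable
  · exact Measurable.lintegral_prod_right' (f := fun q : ℝ × ℝ =>
      G (q.2 + (q.1 - e) * b / a, q.1)) (hG.comp (by fun_prop))

theorem measurePreserving_coords :
    MeasurePreserving (fun y : Plane => ((y 0, y 1) : ℝ × ℝ)) volume volume :=
  (volume_preserving_finTwoArrow ℝ).comp
    (EuclideanSpace.volume_preserving_symm_measurableEquiv_toLp (Fin 2))

theorem measurable_mk : Measurable fun z : ℝ × ℝ => (!₂[z.1, z.2] : Plane) := by
  refine Continuous.measurable ?_
  refine (PiLp.continuous_toLp 2 _).comp (continuous_pi fun i => ?_)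
  fin_cases i
  · exact continuous_fst
  · exact continuous_snd

theorem measurable_mk_left (e : ℝ) : Measurable fun s : ℝ => (!₂[s, e] : Plane) :=
  measurable_mk.comp (f := fun s : ℝ => ((s, e) : ℝ × ℝ)) (by fun_prop)

theorem measurable_mk_right (e : ℝ) : Measurable fun s : ℝ => (!₂[e, s] : Plane) :=
  measurable_mk.comp (f := fun s : ℝ => ((e, s) : ℝ × ℝ)) (by fun_prop)

theorem mk_coords (y : Plane) : (!₂[y 0, y 1] : Plane) = y := by
  ext i; fin_cases i <;> rfl

/-- The coordinate of the horizontal edge through which lines of direction `φ` enter. -/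
def entryY (φ : ℝ) : ℝ := if 0 < Real.sin φ then 0 else 1

/-- The coordinate of the vertical edge through which lines of direction `φ` enter. -/
def entryX (φ : ℝ) : ℝ := if 0 < Real.cos φ then 0 else 1

/-- The lines of direction `φ` entering through a horizontal edge. -/
def tubeY (φ : ℝ) : Set Plane :=
  {y | y 0 - (y 1 - entryY φ) * Real.cos φ / Real.sin φ ∈ Ioo (0 : ℝ) 1}

/-- The lines of direction `φ` entering through a vertical edge. -/
def tubeX (φ : ℝ) : Set Plane :=
  {y | y 1 - (y 0 - entryX φ) * Real.sin φ / Real.cos φ ∈ Ioo (0 : ℝ) 1}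

/-- The directed lines which enter the square through an open edge. -/
def tube : Set (Plane × ℝ) := {q | q.1 ∈ tubeY q.2 ∪ tubeX q.2}

theorem measurable_entryY : Measurable entryY :=
  Measurable.ite (measurableSet_lt measurable_const Real.measurable_sin) measurable_const
    measurable_const

theorem measurable_entryX : Measurable entryX :=
  Measurable.ite (measurableSet_lt measurable_const Real.measurable_cos) measurable_const
    measurable_const

theorem measurableSet_tube : MeasurableSet tube := by
  have h1 := measurable_entryX
  have h2 := measurable_entryY
  refine MeasurableSet.union (s₁ := {q : Plane × ℝ | q.1 ∈ tubeY q.2})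
    (s₂ := {q : Plane × ℝ | q.1 ∈ tubeX q.2}) ?_ ?_
  · refine measurableSet_Ioo.preimage (f := fun q : Plane × ℝ =>
      q.1 0 - (q.1 1 - entryY q.2) * Real.cos q.2 / Real.sin q.2) ?_
    fun_prop
  · refine measurableSet_Ioo.preimage (f := fun q : Plane × ℝ =>
      q.1 1 - (q.1 0 - entryX q.2) * Real.sin q.2 / Real.cos q.2) ?_
    fun_prop

/-- If a line entered through the interiors of both a horizontal and a vertical edge, each crossing
would have to precede the other. -/
theorem disjoint_tubes {φ : ℝ} (hc : Real.cos φ ≠ 0) (hs : Real.sin φ ≠ 0) :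
    Disjoint (tubeY φ) (tubeX φ) := by
  rw [Set.disjoint_left]
  rintro y ⟨h1, h2⟩ ⟨h3, h4⟩
  set t1 := (y 1 - entryY φ) / Real.sin φ with ht1
  set t0 := (y 0 - entryX φ) / Real.cos φ with ht0
  have e1 : (y 1 - entryY φ) * Real.cos φ / Real.sin φ = t1 * Real.cos φ := by rw [ht1]; ring
  have e0 : (y 0 - entryX φ) * Real.sin φ / Real.cos φ = t0 * Real.sin φ := by rw [ht0]; ring
  have f1 : y 1 - entryY φ = t1 * Real.sin φ := by rw [ht1, div_mul_cancel₀ _ hs]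
  have f0 : y 0 - entryX φ = t0 * Real.cos φ := by rw [ht0, div_mul_cancel₀ _ hc]
  rw [e1] at h1 h2
  rw [e0] at h3 h4
  have k0 : t1 < t0 := by
    unfold entryX at f0
    split_ifs at f0 with h
    · by_contra! h5; nlinarith
    · have : Real.cos φ < 0 := lt_of_le_of_ne (not_lt.1 h) hc
      by_contra! h5; nlinarith
  have k1 : t0 < t1 := by
    unfold entryY at f1
    split_ifs at f1 with h
    · by_contra! h5; nlinarith
    · have : Real.sin φ < 0 := lt_of_le_of_ne (not_lt.1 h) hs
      by_contra! h5; nlinarith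
  linarith

theorem exists_add_smul_mem_square {x θ : Plane} (h : ∀ i, (0 < x i ∧ x i < 1) ∨
    (x i = 0 ∧ 0 < θ i) ∨ (x i = 1 ∧ θ i < 0)) : ∃ t : ℝ, 0 < t ∧ x + t • θ ∈ square := by
  have hi : ∀ i, ∀ᶠ t : ℝ in 𝓝[>] 0, 0 < (x + t • θ) i ∧ (x + t • θ) i < 1 := by
    intro i
    simp only [PiLp.add_apply, PiLp.smul_apply, smul_eq_mul]
    have h0 : Filter.Tendsto (fun t : ℝ => x i + t * θ i) (𝓝[>] 0) (𝓝 (x i)) := by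
      have : Filter.Tendsto (fun t : ℝ => x i + t * θ i) (𝓝 0) (𝓝 (x i + 0 * θ i)) :=
        Continuous.tendsto (by fun_prop) 0
      rw [zero_mul, add_zero] at this
      exact this.mono_left nhdsWithin_le_nhds
    rcases h i with h | h | h
    · exact (h0.eventually_const_lt h.1).and (h0.eventually_lt_const h.2)
    · filter_upwards [h0.eventually_lt_const (u := 1) (by rw [h.1]; norm_num),
        self_mem_nhdsWithin] with t h1 h2
      refine ⟨?_, h1⟩
      rw [h.1, zero_add]
      exact mul_pos h2 h.2
    · filter_upwards [h0.eventually_const_lt (u := 0) (by rw [h.1]; norm_num),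
        self_mem_nhdsWithin] with t h1 h2
      refine ⟨h1, ?_⟩
      rw [h.1]
      have := mul_neg_of_pos_of_neg h2 h.2
      linarith
  obtain ⟨t, ht, ht0⟩ := ((Filter.eventually_all.2 hi).and self_mem_nhdsWithin).exists
  exact ⟨t, ht0, ht⟩

/-- The contribution of the boundary point `x` and the direction `φ` to Santaló's formula. -/
def boundaryTerm (G : Plane → ℝ≥0∞) (φ : ℝ) (x : Plane) : ℝ≥0∞ :=
  {x | (x, dir φ) ∈ inflow univ}.indicator
    (fun x => ‖inner ℝ (outwardNormal x) (dir φ)‖ₑ * ∫⁻ t : ℝ, G (x + t • dir φ)) x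

theorem mk_mem_inflow {s e φ : ℝ} (hs : s ∈ Ioo (0 : ℝ) 1)
    (he : (e = 0 ∧ 0 < Real.sin φ) ∨ (e = 1 ∧ Real.sin φ < 0)) :
    ((!₂[s, e] : Plane), dir φ) ∈ inflow univ := by
  refine ⟨⟨mem_univ _, mem_frontier_square.2 ⟨fun i => ?_, 1, ?_⟩⟩, norm_dir φ,
    exists_add_smul_mem_square fun i => ?_⟩
  · fin_cases i
    · exact ⟨hs.1.le, hs.2.le⟩
    · rcases he with ⟨rfl, -⟩ | ⟨rfl, -⟩ <;> simp
  · rcases he with ⟨rfl, -⟩ | ⟨rfl, -⟩ <;> simp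
  · fin_cases i
    · exact Or.inl hs
    · exact Or.inr he

theorem mk_mem_inflow' {s e φ : ℝ} (hs : s ∈ Ioo (0 : ℝ) 1)
    (he : (e = 0 ∧ 0 < Real.cos φ) ∨ (e = 1 ∧ Real.cos φ < 0)) :
    ((!₂[e, s] : Plane), dir φ) ∈ inflow univ := by
  refine ⟨⟨mem_univ _, mem_frontier_square.2 ⟨fun i => ?_, 0, ?_⟩⟩, norm_dir φ,
    exists_add_smul_mem_square fun i => ?_⟩
  · fin_cases i
    · rcases he with ⟨rfl, -⟩ | ⟨rfl, -⟩ <;> simp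
    · exact ⟨hs.1.le, hs.2.le⟩
  · rcases he with ⟨rfl, -⟩ | ⟨rfl, -⟩ <;> simp
  · fin_cases i
    · exact Or.inr he
    · exact Or.inl hs

/-- Lines of direction `φ` enter only through the horizontal edge with coordinate `entryY φ`. There
the flux factor is `|sin φ|`, exactly the Jacobian in `lintegral_tube`. -/
theorem lintegral_boundaryTerm_Y {φ : ℝ} (hs : Real.sin φ ≠ 0) {G : Plane → ℝ≥0∞}
    (hG : Measurable G) :
    (∫⁻ s in Ioo (0 : ℝ) 1, boundaryTerm G φ !₂[s, 0]) +
      ∫⁻ s in Ioo (0 : ℝ) 1, boundaryTerm G φ !₂[s, 1] = ∫⁻ y in tubeY φ, G y := by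
  have hGm : Measurable fun z : ℝ × ℝ => G !₂[z.1, z.2] := hG.comp measurable_mk
  have active : ∀ e, e = entryY φ → ∫⁻ s in Ioo (0 : ℝ) 1, boundaryTerm G φ !₂[s, e] =
      ∫⁻ y in tubeY φ, G y := by
    intro e he
    have hcase : (e = 0 ∧ 0 < Real.sin φ) ∨ (e = 1 ∧ Real.sin φ < 0) := by
      rw [he, entryY]
      split_ifs with h
      · exact Or.inl ⟨rfl, h⟩
      · exact Or.inr ⟨rfl, lt_of_le_of_ne (not_lt.1 h) hs⟩
    have h1 : ∀ s ∈ Ioo (0 : ℝ) 1, boundaryTerm G φ !₂[s, e] =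
        ENNReal.ofReal |Real.sin φ| *
          ∫⁻ t, G !₂[s + t * Real.cos φ, e + t * Real.sin φ] := by
      intro s hs'
      rw [boundaryTerm, indicator_of_mem (by exact mk_mem_inflow hs' hcase)]
      congr 1
      · have h2 : ‖inner ℝ (outwardNormal !₂[s, e]) (dir φ)‖ = |Real.sin φ| := by
          rw [outwardNormal, if_neg (by simpa using hs'.1.ne'), if_neg (by simpa using hs'.2.ne)]
          rcases hcase with ⟨rfl, -⟩ | ⟨rfl, -⟩ <;>
            simp [PiLp.inner_apply, Fin.sum_univ_two, dir]
        rw [← ofReal_norm, h2]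
      · refine lintegral_congr fun t => ?_
        congr 1
        ext i
        fin_cases i <;> simp [dir]
    rw [setLIntegral_congr_fun measurableSet_Ioo h1, lintegral_const_mul',
      lintegral_tube (G := fun z => G !₂[z.1, z.2]) hs _ _ hGm,
      ← measurePreserving_coords.setLIntegral_comp_preimage]
    · rw [he]
      simp only [mk_coords]
      rfl
    · exact measurableSet_Ioo.preimage (by fun_prop)
    · exact hGm
    · exact ENNReal.ofReal_ne_top
  have inactive : ∀ e, (e = 0 ∨ e = 1) → e ≠ entryY φ →
      ∫⁻ s in Ioo (0 : ℝ) 1, boundaryTerm G φ !₂[s, e] = 0 := by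
    intro e he hne
    rw [setLIntegral_congr_fun (g := fun _ => 0) measurableSet_Ioo, lintegral_zero]
    intro s _
    refine indicator_of_notMem (fun hmem => hne ?_) _
    rcases he with rfl | rfl
    · have : 0 < Real.sin φ := pos_of_mem_inflow (i := 1) hmem rfl
      rw [entryY, if_pos this]
    · have : Real.sin φ < 0 := neg_of_mem_inflow (i := 1) hmem rfl
      rw [entryY, if_neg this.not_gt]
  by_cases h : 0 < Real.sin φ
  · rw [active 0 (by rw [entryY, if_pos h]), inactive 1 (Or.inr rfl) (by simp [entryY, h]), add_zero]
  · rw [active 1 (by rw [entryY, if_neg h]), inactive 0 (Or.inl rfl) (by simp [entryY, h]), zero_add]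

theorem lintegral_boundaryTerm_X {φ : ℝ} (hc : Real.cos φ ≠ 0) {G : Plane → ℝ≥0∞}
    (hG : Measurable G) :
    (∫⁻ s in Ioo (0 : ℝ) 1, boundaryTerm G φ !₂[0, s]) +
      ∫⁻ s in Ioo (0 : ℝ) 1, boundaryTerm G φ !₂[1, s] = ∫⁻ y in tubeX φ, G y := by
  have hGm : Measurable fun z : ℝ × ℝ => G !₂[z.2, z.1] := hG.comp (measurable_mk.comp
    measurable_swap)
  have active : ∀ e, e = entryX φ → ∫⁻ s in Ioo (0 : ℝ) 1, boundaryTerm G φ !₂[e, s] =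
      ∫⁻ y in tubeX φ, G y := by
    intro e he
    have hcase : (e = 0 ∧ 0 < Real.cos φ) ∨ (e = 1 ∧ Real.cos φ < 0) := by
      rw [he, entryX]
      split_ifs with h
      · exact Or.inl ⟨rfl, h⟩
      · exact Or.inr ⟨rfl, lt_of_le_of_ne (not_lt.1 h) hc⟩
    have h1 : ∀ s ∈ Ioo (0 : ℝ) 1, boundaryTerm G φ !₂[e, s] =
        ENNReal.ofReal |Real.cos φ| *
          ∫⁻ t, G !₂[e + t * Real.cos φ, s + t * Real.sin φ] := by
      intro s hs'
      rw [boundaryTerm, indicator_of_mem (by exact mk_mem_inflow' hs' hcase)]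
      congr 1
      · have h2 : ‖inner ℝ (outwardNormal !₂[e, s]) (dir φ)‖ = |Real.cos φ| := by
          rw [outwardNormal]
          rcases hcase with ⟨rfl, -⟩ | ⟨rfl, -⟩ <;>
            simp [PiLp.inner_apply, Fin.sum_univ_two, dir]
        rw [← ofReal_norm, h2]
      · refine lintegral_congr fun t => ?_
        congr 1
        ext i
        fin_cases i <;> simp [dir]
    have hmp : MeasurePreserving (fun y : Plane => ((y 1, y 0) : ℝ × ℝ)) volume volume :=
      (Measure.measurePreserving_swap (μ := volume) (ν := volume)).comp measurePreserving_coords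
    rw [setLIntegral_congr_fun measurableSet_Ioo h1, lintegral_const_mul',
      lintegral_tube (G := fun z => G !₂[z.2, z.1]) hc _ _ hGm,
      ← hmp.setLIntegral_comp_preimage]
    · rw [he]
      simp only [mk_coords]
      rfl
    · exact measurableSet_Ioo.preimage (by fun_prop)
    · exact hGm
    · exact ENNReal.ofReal_ne_top
  have inactive : ∀ e, (e = 0 ∨ e = 1) → e ≠ entryX φ →
      ∫⁻ s in Ioo (0 : ℝ) 1, boundaryTerm G φ !₂[e, s] = 0 := by
    intro e he hne
    rw [setLIntegral_congr_fun (g := fun _ => 0) measurableSet_Ioo, lintegral_zero]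
    intro s _
    refine indicator_of_notMem (fun hmem => hne ?_) _
    rcases he with rfl | rfl
    · have : 0 < Real.cos φ := pos_of_mem_inflow (i := 0) hmem rfl
      rw [entryX, if_pos this]
    · have : Real.cos φ < 0 := neg_of_mem_inflow (i := 0) hmem rfl
      rw [entryX, if_neg this.not_gt]
  by_cases h : 0 < Real.cos φ
  · rw [active 0 (by rw [entryX, if_pos h]), inactive 1 (Or.inr rfl) (by simp [entryX, h]), add_zero]
  · rw [active 1 (by rw [entryX, if_neg h]), inactive 0 (Or.inl rfl) (by simp [entryX, h]), zero_add]

instance : IsFiniteMeasure boundaryMeasure := by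
  unfold boundaryMeasure; infer_instance

instance : IsFiniteMeasure circleMeasure := by
  unfold circleMeasure; infer_instance

theorem lintegral_boundaryMeasure {H : Plane → ℝ≥0∞} (hH : Measurable H) :
    ∫⁻ x, H x ∂boundaryMeasure =
      ((∫⁻ s in Ioo (0 : ℝ) 1, H !₂[s, 0]) + ∫⁻ s in Ioo (0 : ℝ) 1, H !₂[s, 1]) +
      ((∫⁻ s in Ioo (0 : ℝ) 1, H !₂[0, s]) + ∫⁻ s in Ioo (0 : ℝ) 1, H !₂[1, s]) := by
  rw [boundaryMeasure, lintegral_add_measure, lintegral_add_measure, lintegral_add_measure,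
    lintegral_map hH (measurable_mk_left 0), lintegral_map hH (measurable_mk_left 1),
    lintegral_map hH (measurable_mk_right 0), lintegral_map hH (measurable_mk_right 1)]
  ring

theorem measurable_outwardNormal : Measurable outwardNormal := by
  have h : ∀ (i : Fin 2) (a : ℝ), MeasurableSet {x : Plane | x i = a} := fun i a =>
    (measurableSet_singleton a).preimage (f := fun x : Plane => x i) (by fun_prop)
  exact Measurable.ite (h 0 0) measurable_const (Measurable.ite (h 0 1) measurable_const
    (Measurable.ite (h 1 0) measurable_const measurable_const))

theorem ae_sin_cos_ne_zero : ∀ᵐ φ : ℝ, Real.sin φ ≠ 0 ∧ Real.cos φ ≠ 0 := by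
  have h1 : {φ : ℝ | Real.sin φ = 0}.Countable := by
    have : {φ : ℝ | Real.sin φ = 0} = range fun n : ℤ => (n : ℝ) * Real.pi := by
      ext φ
      simp [Real.sin_eq_zero_iff]
    rw [this]
    exact countable_range _
  have h2 : {φ : ℝ | Real.cos φ = 0}.Countable := by
    have : {φ : ℝ | Real.cos φ = 0} = range fun n : ℤ => (2 * (n : ℝ) + 1) * Real.pi / 2 := by
      ext φ
      simp only [mem_ofPred_eq, Real.cos_eq_zero_iff, mem_range]
      exact exists_congr fun k => eq_comm
    rw [this]
    exact countable_range _
  filter_upwards [h1.ae_notMem volume, h2.ae_notMem volume] with φ h1 h2 using ⟨h1, h2⟩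

/-- The Liouville measure on `ℝ² × (-π, π]`. -/
def phaseMeasure : Measure (Plane × ℝ) :=
  (volume : Measure Plane).prod (volume.restrict (Ioc (-Real.pi) Real.pi))

instance : SFinite phaseMeasure := by
  unfold phaseMeasure; infer_instance

theorem lintegral_inflowMeasure {E : Set Plane} (hE : MeasurableSet E)
    {F : Plane × Plane → ℝ≥0∞} (hF : Measurable F) :
    ∫⁻ p, F p ∂inflowMeasure E = ∫⁻ φ in Ioc (-Real.pi) Real.pi, ∫⁻ x,
      (inflow E).indicator (fun p => ‖inner ℝ (outwardNormal p.1) p.2‖ₑ * F p) (x, dir φ)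
        ∂boundaryMeasure := by
  have hd : Measurable fun p : Plane × Plane => ‖inner ℝ (outwardNormal p.1) p.2‖ₑ :=
    ((measurable_outwardNormal.comp measurable_fst).inner measurable_snd).enorm
  have hI := measurableSet_inflow hE
  have hm : Measurable ((inflow E).indicator
    (fun p => ‖inner ℝ (outwardNormal p.1) p.2‖ₑ * F p)) := (hd.mul hF).indicator hI
  have hpr : boundaryMeasure.prod circleMeasure = Measure.map (Prod.map id dir)
      (boundaryMeasure.prod (volume.restrict (Ioc (-Real.pi) Real.pi))) := by
    rw [← Measure.map_prod_map _ _ measurable_id continuous_dir.measurable, Measure.map_id]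
    rfl
  rw [inflowMeasure, ← lintegral_indicator hI,
    lintegral_withDensity_eq_lintegral_mul _ hd (hF.indicator hI), hpr,
    lintegral_map (hd.mul (hF.indicator hI)) (measurable_id.prodMap continuous_dir.measurable),
    lintegral_prod_symm]
  · refine lintegral_congr fun φ => lintegral_congr fun x => ?_
    by_cases h : (x, dir φ) ∈ inflow E
    · simp [h]
    · simp [h]
  · exact ((hd.mul (hF.indicator hI)).comp
      (measurable_id.prodMap continuous_dir.measurable)).aemeasurable

/-- For almost every direction the tubes over the horizontal and the vertical entry edge are
disjoint, and the density of `dΣ` is the Jacobian of the parametrisation of each by edge point and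
time. The time runs over the whole line, not only over the chord in the square, as the unfolded
picture requires. -/
theorem santalo {G : Plane × ℝ → ℝ≥0∞} (hG : Measurable G) :
    ∫⁻ p, (∫⁻ t : ℝ, G (p.1 + t • p.2, angle p.2)) ∂inflowMeasure univ =
      ∫⁻ q in tube, G q ∂phaseMeasure := by
  have ha := measurable_angle
  have hGm : Measurable fun p : Plane × Plane => ∫⁻ t : ℝ, G (p.1 + t • p.2, angle p.2) :=
    Measurable.lintegral_prod_right' (f := fun q : (Plane × Plane) × ℝ =>
      G (q.1.1 + q.2 • q.1.2, angle q.1.2)) (hG.comp (by fun_prop))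
  rw [lintegral_inflowMeasure MeasurableSet.univ hGm, ← lintegral_indicator measurableSet_tube,
    phaseMeasure, lintegral_prod_symm _ (hG.indicator measurableSet_tube).aemeasurable]
  refine lintegral_congr_ae ?_
  filter_upwards [ae_restrict_mem measurableSet_Ioc, ae_restrict_of_ae ae_sin_cos_ne_zero]
    with φ hφ hsc
  have hGφ : Measurable fun y => G (y, φ) := hG.comp (by fun_prop)
  have h1 : ∀ x, (inflow univ).indicator (fun p => ‖inner ℝ (outwardNormal p.1) p.2‖ₑ *
      ∫⁻ t : ℝ, G (p.1 + t • p.2, angle p.2)) (x, dir φ) =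
      boundaryTerm (fun y => G (y, φ)) φ x := by
    intro x
    simp only [boundaryTerm, indicator, mem_ofPred_eq, angle_dir hφ]
  simp_rw [h1]
  have hbm : Measurable (boundaryTerm (fun y => G (y, φ)) φ) := by
    refine Measurable.indicator ?_ ?_
    · have h2 : Measurable fun x : Plane => ∫⁻ t : ℝ, G (x + t • dir φ, φ) :=
        Measurable.lintegral_prod_right' (f := fun q : Plane × ℝ => G (q.1 + q.2 • dir φ, φ))
          (hG.comp (by fun_prop))
      exact (measurable_outwardNormal.inner measurable_const).enorm.mul h2
    · exact (measurableSet_inflow MeasurableSet.univ).preimage (by fun_prop)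
  rw [lintegral_boundaryMeasure hbm, lintegral_boundaryTerm_Y hsc.1 hGφ,
    lintegral_boundaryTerm_X hsc.2 hGφ]
  have mX : MeasurableSet (tubeX φ) := measurableSet_Ioo.preimage (by fun_prop)
  have mY : MeasurableSet (tubeY φ) := measurableSet_Ioo.preimage (by fun_prop)
  rw [← lintegral_union mX (disjoint_tubes hsc.2 hsc.1),
    ← lintegral_indicator (mY.union mX)]
  rfl

/-! ### Unfolding the square -/

/-- The sign of the reflection which identifies the `n`-th unit interval with `(0,1)`. -/
def paritySign (n : ℤ) : ℝ := if Even n then 1 else -1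

theorem abs_paritySign (n : ℤ) : |paritySign n| = 1 := by
  unfold paritySign; split_ifs <;> norm_num

/-- The reflection which identifies the directions in the cell `c` with those in the square. -/
def flip (c : Fin 2 → ℤ) : Plane ≃ₗᵢ[ℝ] Plane :=
  LinearIsometryEquiv.piLpCongrRight 2 fun i =>
    if Even (c i) then LinearIsometryEquiv.refl ℝ ℝ else LinearIsometryEquiv.neg ℝ

theorem flip_apply (c : Fin 2 → ℤ) (θ : Plane) (i : Fin 2) :
    flip c θ i = paritySign (c i) * θ i := by
  unfold flip paritySign
  rw [LinearIsometryEquiv.piLpCongrRight_apply]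
  simp only
  split_ifs <;> simp

/-- The corner of the cell `c` which corresponds to the origin, seen from the origin. -/
def foldOffset (c : Fin 2 → ℤ) : Plane :=
  WithLp.toLp 2 fun i => if Even (c i) then -(c i : ℝ) else c i + 1

/-- The isometry which maps the cell `c` of the unfolded plane to the square. -/
def fold (c : Fin 2 → ℤ) (y : Plane) : Plane := flip c y + foldOffset c

theorem fold_apply (c : Fin 2 → ℤ) (y : Plane) (i : Fin 2) :
    fold c y i = if Even (c i) then y i - c i else c i + 1 - y i := by
  rw [fold, PiLp.add_apply, flip_apply, foldOffset, paritySign]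
  simp only
  split_ifs <;> ring

theorem fold_add_smul (c : Fin 2 → ℤ) (y θ : Plane) (t : ℝ) :
    fold c (y + t • θ) = fold c y + t • flip c θ := by
  rw [fold, fold, map_add, map_smul]
  abel

theorem continuous_fold (c : Fin 2 → ℤ) : Continuous (fold c) :=
  (flip c).continuous.add continuous_const

theorem contDiff_fold (c : Fin 2 → ℤ) {n : WithTop ℕ∞} : ContDiff ℝ n (fold c) :=
  ((flip c).toContinuousLinearEquiv.contDiff).add contDiff_const

theorem hasFDerivAt_fold (c : Fin 2 → ℤ) (y : Plane) :
    HasFDerivAt (fold c) ((flip c).toContinuousLinearEquiv : Plane →L[ℝ] Plane) y :=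
  ((flip c).toContinuousLinearEquiv.hasFDerivAt).add_const _

theorem measurePreserving_fold (c : Fin 2 → ℤ) : MeasurePreserving (fold c) volume volume :=
  (measurePreserving_add_right volume (foldOffset c)).comp (flip c).measurePreserving

/-- The cell `c` of the unfolded plane. -/
def cell (c : Fin 2 → ℤ) : Set Plane := {y | ∀ i, (c i : ℝ) < y i ∧ y i < c i + 1}

theorem fold_mem_square {c : Fin 2 → ℤ} {y : Plane} : fold c y ∈ square ↔ y ∈ cell c := by
  simp only [square, cell, mem_ofPred_eq]
  refine forall_congr' fun i => ?_
  rw [fold_apply]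
  split_ifs
  · constructor <;> rintro ⟨h1, h2⟩ <;> constructor <;> linarith
  · constructor <;> rintro ⟨h1, h2⟩ <;> constructor <;> linarith

theorem isOpen_cell (c : Fin 2 → ℤ) : IsOpen (cell c) := by
  have : cell c = fold c ⁻¹' square := by ext; exact fold_mem_square.symm
  rw [this]
  exact isOpen_square.preimage (continuous_fold c)

theorem flip_zero_cell (θ : Plane) : flip 0 θ = θ := by
  ext i
  rw [flip_apply]
  simp [paritySign]

theorem fold_zero_cell (y : Plane) : fold 0 y = y := by
  ext i
  rw [fold_apply]
  simp

/-- A function on the square, transplanted to the cell `c`. -/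
def lift (c : Fin 2 → ℤ) (f : Plane → ℂ) (y : Plane) : ℂ := square.indicator f (fold c y)

theorem lift_of_notMem {c : Fin 2 → ℤ} {f : Plane → ℂ} {y : Plane} (hy : y ∉ cell c) :
    lift c f y = 0 :=
  indicator_of_notMem (fun h => hy (fold_mem_square.1 h)) _

theorem stronglyMeasurable_lift (c : Fin 2 → ℤ) {f : Plane → ℂ} (hf : StronglyMeasurable f) :
    StronglyMeasurable (lift c f) :=
  (hf.indicator isOpen_square.measurableSet).comp_measurable (continuous_fold c).measurable

theorem lintegral_enorm_lift (c : Fin 2 → ℤ) {f : Plane → ℂ} (hf : StronglyMeasurable f) :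
    ∫⁻ y, ‖lift c f y‖ₑ ^ 2 = ∫⁻ x in square, ‖f x‖ₑ ^ 2 := by
  have hs := isOpen_square.measurableSet
  rw [← lintegral_indicator hs]
  have h1 : ∀ y, ‖lift c f y‖ₑ ^ 2 = (square.indicator fun x => ‖f x‖ₑ ^ 2) (fold c y) := by
    intro y
    by_cases h : fold c y ∈ square <;> simp [lift, h]
  simp_rw [h1]
  exact (measurePreserving_fold c).lintegral_comp ((hf.enorm.pow_const 2).indicator hs)

theorem eLpNorm_lift (c : Fin 2 → ℤ) {f : Plane → ℂ} (hf : StronglyMeasurable f) :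
    eLpNorm (lift c f) 2 volume = eLpNorm f 2 (volume.restrict square) := by
  rw [← eLpNorm_indicator_eq_eLpNorm_restrict isOpen_square.measurableSet]
  exact eLpNorm_comp_measurePreserving
    (hf.indicator isOpen_square.measurableSet).aestronglyMeasurable (measurePreserving_fold c)

theorem lift_ae_eq (c : Fin 2 → ℤ) {f g : Plane → ℂ} (h : f =ᵐ[volume.restrict square] g) :
    lift c f =ᵐ[volume] lift c g := by
  have h1 : square.indicator f =ᵐ[volume] square.indicator g :=
    (ae_eq_restrict_iff_indicator_ae_eq isOpen_square.measurableSet).1 h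
  exact (measurePreserving_fold c).quasiMeasurePreserving.ae_eq_comp h1

theorem norm_cell_sub_le {c : Fin 2 → ℤ} {y z : Plane} (hy : y ∈ cell c) (hz : z ∈ cell c) :
    ‖y - z‖ ≤ 2 := by
  rw [EuclideanSpace.norm_eq, Fin.sum_univ_two, Real.sqrt_le_left (by norm_num)]
  have h : ∀ i, ‖(y - z) i‖ ^ 2 ≤ 1 := by
    intro i
    rw [Real.norm_eq_abs, sq_abs, PiLp.sub_apply]
    obtain ⟨h1, h2⟩ := hy i
    obtain ⟨h3, h4⟩ := hz i
    nlinarith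
  linarith [h 0, h 1]

/-- A line meets a cell in a set of length at most four. -/
theorem volume_chord_le (c : Fin 2 → ℤ) (x : Plane) {θ : Plane} (hθ : ‖θ‖ = 1) :
    volume {t : ℝ | x + t • θ ∈ cell c} ≤ 4 := by
  rcases Set.eq_empty_or_nonempty {t : ℝ | x + t • θ ∈ cell c} with h | ⟨t₀, h₀⟩
  · rw [h, measure_empty]; exact zero_le
  · have : {t : ℝ | x + t • θ ∈ cell c} ⊆ Icc (t₀ - 2) (t₀ + 2) := by
      intro t ht
      have h1 := norm_cell_sub_le (mem_ofPred_eq ▸ ht) h₀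
      rw [add_sub_add_left_eq_sub, ← sub_smul, norm_smul, hθ, mul_one, Real.norm_eq_abs,
        abs_le] at h1
      exact ⟨by linarith [h1.1], by linarith [h1.2]⟩
    refine (measure_mono this).trans ?_
    rw [Real.volume_Icc]
    norm_num

/-! ### Generic lines -/

/-- The line is not parallel to an edge and does not meet a point with integral coordinates. -/
def Generic (x θ : Plane) : Prop :=
  θ 0 ≠ 0 ∧ θ 1 ≠ 0 ∧ ∀ a b : ℤ, θ 1 * (x 0 - a) ≠ θ 0 * (x 1 - b)

theorem generic_add_smul {x θ : Plane} (t : ℝ) : Generic (x + t • θ) θ ↔ Generic x θ := by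
  unfold Generic
  refine and_congr_right fun _ => and_congr_right fun _ =>
    forall_congr' fun a => forall_congr' fun b => not_congr ?_
  simp only [PiLp.add_apply, PiLp.smul_apply, smul_eq_mul]
  constructor <;> intro h <;> linarith

theorem volume_line_eq_zero {p q r : ℝ} (hq : q ≠ 0) :
    volume {y : Plane | p * y 0 + q * y 1 = r} = 0 := by
  have hm : MeasurableSet {z : ℝ × ℝ | p * z.1 + q * z.2 = r} :=
    (isClosed_eq (by fun_prop) continuous_const).measurableSet
  have h1 : {y : Plane | p * y 0 + q * y 1 = r} =
      (fun y : Plane => ((y 0, y 1) : ℝ × ℝ)) ⁻¹' {z : ℝ × ℝ | p * z.1 + q * z.2 = r} := rfl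
  rw [h1, measurePreserving_coords.measure_preimage hm.nullMeasurableSet, Measure.volume_eq_prod,
    Measure.measure_prod_null hm]
  refine Filter.Eventually.of_forall fun x => ?_
  have : Prod.mk x ⁻¹' {z : ℝ × ℝ | p * z.1 + q * z.2 = r} ⊆ {(r - p * x) / q} := by
    intro y hy
    simp only [mem_preimage, mem_ofPred_eq] at hy
    rw [mem_singleton_iff, eq_div_iff hq]
    linarith
  exact measure_mono_null this Real.volume_singleton

/-- For a direction not parallel to an axis, the exceptional base points lie on the countably many
lines through lattice points. -/
theorem ae_generic_phase : ∀ᵐ q ∂phaseMeasure, Generic q.1 (dir q.2) := by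
  have hm : MeasurableSet {q : Plane × ℝ | Generic q.1 (dir q.2)} := by
    have hd := continuous_dir
    unfold Generic
    simp only [ofPred_and, ofPred_forall]
    have h0 : Continuous fun q : Plane × ℝ => dir q.2 0 := by fun_prop
    have h1 : Continuous fun q : Plane × ℝ => dir q.2 1 := by fun_prop
    have h2 : ∀ a : ℤ, Continuous fun q : Plane × ℝ => q.1 0 - (a : ℝ) := fun a => by fun_prop
    have h3 : ∀ a : ℤ, Continuous fun q : Plane × ℝ => q.1 1 - (a : ℝ) := fun a => by fun_prop
    refine (isOpen_ne_fun h0 continuous_const).measurableSet.inter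
      ((isOpen_ne_fun h1 continuous_const).measurableSet.inter ?_)
    exact MeasurableSet.iInter fun a => MeasurableSet.iInter fun b =>
      (isOpen_ne_fun (h1.mul (h2 a)) (h0.mul (h3 b))).measurableSet
  rw [ae_iff, phaseMeasure, ← compl_ofPred, Measure.prod_apply_symm hm.compl, lintegral_eq_zero_iff'
    (measurable_measure_prodMk_right hm.compl).aemeasurable]
  filter_upwards [ae_restrict_of_ae ae_sin_cos_ne_zero] with φ hφ
  have h1 : (fun y : Plane => (y, φ)) ⁻¹' {q : Plane × ℝ | Generic q.1 (dir q.2)}ᶜ ⊆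
      ⋃ a : ℤ, ⋃ b : ℤ, {y : Plane | Real.sin φ * y 0 + (-Real.cos φ) * y 1 =
        Real.sin φ * a - Real.cos φ * b} := by
    intro y hy
    by_contra hn
    refine hy ⟨hφ.2, hφ.1, fun a b hab => hn ?_⟩
    simp only [mem_iUnion, mem_ofPred_eq]
    refine ⟨a, b, ?_⟩
    rw [dir_zero, dir_one] at hab
    linarith
  exact measure_mono_null h1 (measure_iUnion_null fun a => measure_iUnion_null fun b =>
    volume_line_eq_zero (neg_ne_zero.2 hφ.2))

/-! ### Integrals over the lines through the inflow boundary -/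

theorem inflow_subset (E : Set Plane) : inflow E ⊆ inflow univ := by
  rintro p ⟨⟨-, h1⟩, h2⟩
  exact ⟨⟨mem_univ _, h1⟩, h2⟩

theorem inflowMeasure_le (E : Set Plane) : inflowMeasure E ≤ inflowMeasure univ :=
  Measure.restrict_mono (inflow_subset E) le_rfl

instance (E : Set Plane) : SFinite (inflowMeasure E) := by
  unfold inflowMeasure; infer_instance

theorem ae_mem_inflow {E : Set Plane} (hE : MeasurableSet E) :
    ∀ᵐ p ∂inflowMeasure E, p ∈ inflow E :=
  ae_restrict_mem (measurableSet_inflow hE)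

theorem ae_norm_eq_one (E : Set Plane) : ∀ᵐ p ∂inflowMeasure E, ‖p.2‖ = 1 := by
  have h : ∀ᵐ p ∂inflowMeasure univ, ‖p.2‖ = 1 :=
    (ae_mem_inflow MeasurableSet.univ).mono fun p hp => hp.2.1
  exact ae_mono (inflowMeasure_le E) h

/-- The point of phase space at time `t` on the line of `z.1`. -/
def flow (z : (Plane × Plane) × ℝ) : Plane × ℝ := (z.1.1 + z.2 • z.1.2, angle z.1.2)

theorem measurable_flow : Measurable flow := by
  have := measurable_angle
  unfold flow
  fun_prop

theorem lintegral_flow_le (E : Set Plane) {G : Plane × ℝ → ℝ≥0∞} (hG : Measurable G) :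
    ∫⁻ p, (∫⁻ t : ℝ, G (flow (p, t))) ∂inflowMeasure E ≤ ∫⁻ q, G q ∂phaseMeasure :=
  (lintegral_mono' (inflowMeasure_le E) le_rfl).trans
    ((santalo hG).le.trans (setLIntegral_le_lintegral _ _))

/-- Santaló's formula for the indicator of a measurable null set. This carries statements valid
almost everywhere in the plane to almost every line. -/
theorem ae_flow (E : Set Plane) {P : Plane × ℝ → Prop} (hP : ∀ᵐ q ∂phaseMeasure, P q) :
    ∀ᵐ p ∂inflowMeasure E, ∀ᵐ t : ℝ, P (flow (p, t)) := by
  obtain ⟨N, hN, hm, h0⟩ := exists_measurable_superset_of_null (ae_iff.1 hP)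
  have h1 := lintegral_flow_le E (G := N.indicator 1) (measurable_one.indicator hm)
  rw [lintegral_indicator_one hm, h0, nonpos_iff_eq_zero] at h1
  have h2 : Measurable fun z : (Plane × Plane) × ℝ => N.indicator (1 : Plane × ℝ → ℝ≥0∞) (flow z) :=
    (measurable_one.indicator hm).comp measurable_flow
  rw [lintegral_eq_zero_iff h2.lintegral_prod_right'] at h1
  filter_upwards [h1] with p hp
  have h3 : Measurable fun t : ℝ => N.indicator (1 : Plane × ℝ → ℝ≥0∞) (flow (p, t)) :=
    h2.comp measurable_prodMk_left
  rw [Pi.zero_apply, lintegral_eq_zero_iff h3] at hp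
  filter_upwards [hp] with t ht
  by_contra h
  have : flow (p, t) ∈ N := hN h
  simp [this] at ht

theorem ae_phase_of_ae {P : Plane → Prop} (hP : ∀ᵐ y, P y) : ∀ᵐ q ∂phaseMeasure, P q.1 :=
  Measure.quasiMeasurePreserving_fst.ae hP

/-- Genericity is a property of the line, so one good time on it is enough. -/
theorem ae_generic (E : Set Plane) : ∀ᵐ p ∂inflowMeasure E, Generic p.1 p.2 := by
  filter_upwards [ae_flow E ae_generic_phase, ae_norm_eq_one E] with p hp h1
  obtain ⟨t, ht⟩ := hp.exists
  rw [flow, dir_angle h1] at ht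
  exact (generic_add_smul t).1 ht

theorem lintegral_phase_fst (g : Plane → ℝ≥0∞) (hg : Measurable g) :
    ∫⁻ q, g q.1 ∂phaseMeasure = ENNReal.ofReal (2 * Real.pi) * ∫⁻ y, g y := by
  rw [phaseMeasure, lintegral_prod _ (by fun_prop)]
  simp only [lintegral_const, Measure.restrict_apply_univ, Real.volume_Ioc]
  rw [lintegral_mul_const _ hg, mul_comm]
  congr 2
  ring

/-! ### Integral operators along the lines -/

/-- The integral over the line of `p` of a function on the cell `c`, with a weight. -/
def segInt (c : Fin 2 → ℤ) (w : Plane × ℝ → ℝ) (f : Plane → ℂ) (p : Plane × Plane) : ℂ :=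
  ∫ t : ℝ, w (flow (p, t)) • lift c f (p.1 + t • p.2)

section Operator

variable {c : Fin 2 → ℤ} {w : Plane × ℝ → ℝ} {f g : Plane → ℂ} {B : ℝ}

theorem stronglyMeasurable_integrand (c : Fin 2 → ℤ) (hw : Measurable w)
    (hf : StronglyMeasurable f) : StronglyMeasurable fun q : Plane × ℝ => w q • lift c f q.1 :=
  hw.stronglyMeasurable.smul ((stronglyMeasurable_lift c hf).comp_measurable measurable_fst)

theorem stronglyMeasurable_segInt (hw : Measurable w) (hf : StronglyMeasurable f) :
    StronglyMeasurable (segInt c w f) :=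
  StronglyMeasurable.integral_prod_right' (f := fun z : (Plane × Plane) × ℝ =>
    w (flow z) • lift c f (flow z).1)
    ((stronglyMeasurable_integrand c hw hf).comp_measurable measurable_flow)

theorem norm_smul_lift_le (hB : ∀ q : Plane × ℝ, q.1 ∈ cell c → |w q| ≤ B) (q : Plane × ℝ) :
    ‖w q • lift c f q.1‖ ≤ B * ‖lift c f q.1‖ := by
  by_cases h : q.1 ∈ cell c
  · exact norm_smul_le_of_abs_le (hB q h) _
  · simp [lift_of_notMem h]

/-- Cauchy–Schwarz against the indicator of the chord, whose length is at most `4`. -/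
theorem sq_lintegral_chord_le (x : Plane) {θ : Plane} (hθ : ‖θ‖ = 1) (hf : StronglyMeasurable f) :
    (∫⁻ t : ℝ, ‖lift c f (x + t • θ)‖ₑ) ^ 2 ≤ 4 * ∫⁻ t : ℝ, ‖lift c f (x + t • θ)‖ₑ ^ 2 := by
  set S := {t : ℝ | x + t • θ ∈ cell c} with hS
  have hSm : MeasurableSet S := (isOpen_cell c).measurableSet.preimage (by fun_prop)
  have hm : AEMeasurable (fun t : ℝ => ‖lift c f (x + t • θ)‖ₑ) volume :=
    ((stronglyMeasurable_lift c hf).comp_measurable (by fun_prop)).enorm.aemeasurable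
  have h1 : ∀ t : ℝ, ‖lift c f (x + t • θ)‖ₑ =
      S.indicator (1 : ℝ → ℝ≥0∞) t * ‖lift c f (x + t • θ)‖ₑ := by
    intro t
    by_cases h : t ∈ S
    · simp [h]
    · rw [lift_of_notMem h]; simp
  have h2 := ENNReal.lintegral_mul_le_Lp_mul_Lq volume Real.HolderConjugate.two_two
    (measurable_one.indicator hSm).aemeasurable hm
  have h3 : ∫⁻ t : ℝ, ‖lift c f (x + t • θ)‖ₑ ≤
      (4 : ℝ≥0∞) ^ (1 / 2 : ℝ) * (∫⁻ t : ℝ, ‖lift c f (x + t • θ)‖ₑ ^ 2) ^ (1 / 2 : ℝ) := by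
    calc _ = ∫⁻ t : ℝ, (S.indicator (1 : ℝ → ℝ≥0∞) * fun t => ‖lift c f (x + t • θ)‖ₑ : ℝ → ℝ≥0∞) t :=
          lintegral_congr h1
      _ ≤ _ := h2
      _ ≤ _ := by
        gcongr
        · have : ∀ t, (S.indicator (1 : ℝ → ℝ≥0∞) t) ^ (2 : ℝ) = S.indicator 1 t := by
            intro t
            by_cases h : t ∈ S <;> simp [h]
          simp_rw [this]
          rw [lintegral_indicator_one hSm]
          exact volume_chord_le c x hθ
        · exact le_of_eq (ENNReal.rpow_two _)
  refine (pow_le_pow_left' h3 2).trans_eq ?_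
  rw [mul_pow, ← ENNReal.rpow_natCast, ← ENNReal.rpow_natCast, ← ENNReal.rpow_mul,
    ← ENNReal.rpow_mul]
  norm_num

theorem lintegral_enorm_sq_segInt_le (E : Set Plane)
    (hf : StronglyMeasurable f) (hB : ∀ q : Plane × ℝ, q.1 ∈ cell c → |w q| ≤ B) :
    ∫⁻ p, ‖segInt c w f p‖ₑ ^ 2 ∂inflowMeasure E ≤
      ENNReal.ofReal (6 * B) ^ 2 * ∫⁻ x in square, ‖f x‖ₑ ^ 2 := by
  have hlm : Measurable fun y => ‖lift c f y‖ₑ := (stronglyMeasurable_lift c hf).enorm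
  have hl2 : Measurable fun y => ‖lift c f y‖ₑ ^ 2 := hlm.pow_const 2
  have h1 : ∀ᵐ p ∂inflowMeasure E, ‖segInt c w f p‖ₑ ^ 2 ≤
      ENNReal.ofReal B ^ 2 * 4 * ∫⁻ t : ℝ, ‖lift c f (flow (p, t)).1‖ₑ ^ 2 := by
    filter_upwards [ae_norm_eq_one E] with p hp
    have h2 : ‖segInt c w f p‖ₑ ≤ ENNReal.ofReal B * ∫⁻ t : ℝ, ‖lift c f (p.1 + t • p.2)‖ₑ := by
      refine (enorm_integral_le_lintegral_enorm _).trans ?_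
      have hl : Measurable fun t : ℝ => ‖lift c f (p.1 + t • p.2)‖ₑ := hlm.comp (by fun_prop)
      rw [← lintegral_const_mul _ hl]
      refine lintegral_mono fun t => ?_
      have h3 := norm_smul_lift_le (f := f) hB (flow (p, t))
      rw [← ofReal_norm, ← ofReal_norm]
      refine (ENNReal.ofReal_le_ofReal h3).trans ?_
      rw [ENNReal.ofReal_mul' (norm_nonneg _)]
      rfl
    calc ‖segInt c w f p‖ₑ ^ 2 ≤
          (ENNReal.ofReal B * ∫⁻ t : ℝ, ‖lift c f (p.1 + t • p.2)‖ₑ) ^ 2 :=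
          pow_le_pow_left' h2 2
      _ ≤ _ := by
        rw [mul_pow, mul_assoc]
        gcongr
        exact sq_lintegral_chord_le p.1 hp hf
  have hm : Measurable fun q : Plane × ℝ => ‖lift c f q.1‖ₑ ^ 2 := hl2.comp measurable_fst
  calc _ ≤ ∫⁻ p, ENNReal.ofReal B ^ 2 * 4 * (∫⁻ t : ℝ, ‖lift c f (flow (p, t)).1‖ₑ ^ 2)
          ∂inflowMeasure E := lintegral_mono_ae h1
    _ = ENNReal.ofReal B ^ 2 * 4 * ∫⁻ p, (∫⁻ t : ℝ, ‖lift c f (flow (p, t)).1‖ₑ ^ 2)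
          ∂inflowMeasure E := by
        rw [lintegral_const_mul]
        exact Measurable.lintegral_prod_right' (f := fun z => ‖lift c f (flow z).1‖ₑ ^ 2)
          (hm.comp measurable_flow)
    _ ≤ ENNReal.ofReal B ^ 2 * 4 * (ENNReal.ofReal (2 * Real.pi) *
          ∫⁻ x in square, ‖f x‖ₑ ^ 2) := by
        gcongr
        refine (lintegral_flow_le E hm).trans_eq ?_
        rw [lintegral_phase_fst _ hl2, lintegral_enorm_lift c hf]
    _ ≤ _ := by
        rw [← mul_assoc]
        gcongr
        rw [ENNReal.ofReal_mul (p := 6) (by norm_num), mul_pow, mul_assoc, mul_comm (ENNReal.ofReal 6 ^ 2)]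
        gcongr
        rw [← ENNReal.ofReal_pow (by norm_num), show (4 : ℝ≥0∞) = ENNReal.ofReal 4 by norm_num,
          ← ENNReal.ofReal_mul (by norm_num)]
        -- The constant is `4` from the chord times `2 π` from the directions, which is less than
        -- `6²`.
        refine ENNReal.ofReal_le_ofReal ?_
        linarith [Real.pi_lt_four]

theorem eLpNorm_segInt_le (E : Set Plane)
    (hf : StronglyMeasurable f) (hB : ∀ q : Plane × ℝ, q.1 ∈ cell c → |w q| ≤ B) :
    eLpNorm (segInt c w f) 2 (inflowMeasure E) ≤
      ENNReal.ofReal (6 * B) * eLpNorm f 2 (volume.restrict square) := by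
  have h := lintegral_enorm_sq_segInt_le E hf hB
  have e : ∀ {α : Type} [MeasurableSpace α] (μ : Measure α) (g : α → ℂ),
      ∫⁻ x, ‖g x‖ₑ ^ 2 ∂μ = eLpNorm g 2 μ ^ 2 := by
    intro α _ μ g
    have := eLpNorm_nnreal_pow_eq_lintegral (μ := μ) (f := g) (p := 2) (by norm_num)
    simpa using this.symm
  rw [e, e, ← mul_pow] at h
  exact (ENNReal.pow_le_pow_left_iff two_ne_zero).1 h

theorem memLp_segInt (E : Set Plane) (hw : Measurable w) (hf : StronglyMeasurable f)
    (hf2 : MemLp f 2 (volume.restrict square))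
    (hB : ∀ q : Plane × ℝ, q.1 ∈ cell c → |w q| ≤ B) :
    MemLp (segInt c w f) 2 (inflowMeasure E) :=
  ⟨(stronglyMeasurable_segInt hw hf).aestronglyMeasurable,
    (eLpNorm_segInt_le E hf hB).trans_lt (ENNReal.mul_lt_top ENNReal.ofReal_lt_top hf2.2)⟩

/-- Makes the line integrals well defined on `L²` classes, although a single line is a null set. -/
theorem segInt_ae_congr (E : Set Plane) (h : f =ᵐ[volume.restrict square] g) :
    segInt c w f =ᵐ[inflowMeasure E] segInt c w g := by
  filter_upwards [ae_flow E (ae_phase_of_ae (lift_ae_eq c h))] with p hp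
  refine integral_congr_ae ?_
  filter_upwards [hp] with t ht
  change w (flow (p, t)) • lift c f (flow (p, t)).1 = w (flow (p, t)) • lift c g (flow (p, t)).1
  rw [ht]

theorem integrable_lift (c : Fin 2 → ℤ)
    (hf2 : MemLp f 2 (volume.restrict square)) : Integrable (lift c f) := by
  have h1 : Integrable f (volume.restrict square) := by
    have : IsFiniteMeasure ((volume : Measure Plane).restrict square) := by
      refine ⟨?_⟩
      rw [Measure.restrict_apply_univ]
      have hb : square ⊆ Metric.ball (0 : Plane) 2 := by
        intro x hx
        rw [mem_ball_zero_iff, EuclideanSpace.norm_eq, Fin.sum_univ_two, Real.sqrt_lt' (by norm_num)]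
        have hi : ∀ i, ‖x i‖ ^ 2 ≤ 1 := fun i => by
          rw [Real.norm_eq_abs, sq_abs]
          nlinarith [(hx i).1, (hx i).2]
        linarith [hi 0, hi 1]
      exact (measure_mono hb).trans_lt measure_ball_lt_top
    exact hf2.integrable (by norm_num)
  have h2 : Integrable (square.indicator f) volume :=
    (integrable_indicator_iff isOpen_square.measurableSet).2 h1
  exact (measurePreserving_fold c).integrable_comp_of_integrable h2

theorem memLp_lift (c : Fin 2 → ℤ) (hf : StronglyMeasurable f)
    (hf2 : MemLp f 2 (volume.restrict square)) : MemLp (lift c f) 2 volume :=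
  ⟨(stronglyMeasurable_lift c hf).aestronglyMeasurable, (eLpNorm_lift c hf).trans_lt hf2.2⟩

/-- Needed for additivity: integrability in the plane gives integrability on almost every line by
Santaló's formula. -/
theorem ae_integrable_line (E : Set Plane) (hw : Measurable w) (hf : StronglyMeasurable f)
    (hf2 : MemLp f 2 (volume.restrict square))
    (hB : ∀ q : Plane × ℝ, q.1 ∈ cell c → |w q| ≤ B) :
    ∀ᵐ p ∂inflowMeasure E,
      Integrable fun t : ℝ => w (flow (p, t)) • lift c f (p.1 + t • p.2) := by
  have hl := stronglyMeasurable_lift c hf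
  have hm : Measurable fun q : Plane × ℝ => ‖lift c f q.1‖ₑ := hl.enorm.comp measurable_fst
  have h1 := lintegral_flow_le E hm
  rw [lintegral_phase_fst _ hl.enorm] at h1
  have h2 : ∫⁻ p, (∫⁻ t : ℝ, ‖lift c f (flow (p, t)).1‖ₑ) ∂inflowMeasure E ≠ ⊤ :=
    (h1.trans_lt (ENNReal.mul_lt_top ENNReal.ofReal_lt_top
      (integrable_lift c hf2).2)).ne
  filter_upwards [ae_lt_top (Measurable.lintegral_prod_right'
    (f := fun z => ‖lift c f (flow z).1‖ₑ) (hm.comp measurable_flow)) h2] with p hp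
  have h3 : Integrable fun t : ℝ => lift c f (p.1 + t • p.2) :=
    ⟨(hl.comp_measurable (by fun_prop)).aestronglyMeasurable, hp⟩
  refine (h3.norm.const_mul B).mono'
    (((stronglyMeasurable_integrand c hw hf).comp_measurable
      (measurable_flow.comp measurable_prodMk_left)).aestronglyMeasurable)
    (Filter.Eventually.of_forall fun t => norm_smul_lift_le hB (flow (p, t)))

/-- The operator `f ↦ ∫ w f` along the lines, from `L²(Ω)` to `L²(Γ₋(E))`. -/
theorem exists_segmentOperator (E : Set Plane) (c : Fin 2 → ℤ) (hw : Measurable w) (hB0 : 0 ≤ B)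
    (hB : ∀ q : Plane × ℝ, q.1 ∈ cell c → |w q| ≤ B) :
    ∃ J : L2Square →L[ℂ] L2Inflow E, ‖J‖ ≤ 6 * B ∧
      ∀ f : L2Square, J f =ᵐ[inflowMeasure E] segInt c w f := by
  have hf : ∀ f : L2Square, StronglyMeasurable f := fun f => Lp.stronglyMeasurable f
  have hm : ∀ f : L2Square, MemLp (segInt c w f) 2 (inflowMeasure E) := fun f =>
    memLp_segInt E hw (hf f) (Lp.memLp f) hB
  let J₀ : L2Square →ₗ[ℂ] L2Inflow E :=
    { toFun := fun f => (hm f).toLp _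
      map_add' := by
        intro f g
        rw [← MemLp.toLp_add, MemLp.toLp_eq_toLp_iff]
        refine (segInt_ae_congr E (Lp.coeFn_add f g)).trans ?_
        filter_upwards [ae_integrable_line E hw (hf f) (Lp.memLp f) hB,
          ae_integrable_line E hw (hf g) (Lp.memLp g) hB] with p h1 h2
        rw [Pi.add_apply, segInt, segInt, segInt, ← integral_add h1 h2]
        refine integral_congr_ae (Filter.Eventually.of_forall fun t => ?_)
        simp only [lift, indicator_add', Pi.add_apply, smul_add]
      map_smul' := by
        intro a f
        rw [RingHom.id_apply, ← MemLp.toLp_const_smul, MemLp.toLp_eq_toLp_iff]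
        refine (segInt_ae_congr E (Lp.coeFn_smul a f)).trans
          (Filter.Eventually.of_forall fun p => ?_)
        rw [Pi.smul_apply, segInt, segInt, ← integral_smul]
        refine integral_congr_ae (Filter.Eventually.of_forall fun t => ?_)
        have h : lift c (a • (f : Plane → ℂ)) (p.1 + t • p.2) = a • lift c f (p.1 + t • p.2) := by
          unfold lift indicator
          split_ifs <;> simp
        change w (flow (p, t)) • lift c (a • (f : Plane → ℂ)) (p.1 + t • p.2) = _
        rw [h, smul_comm] }
  refine ⟨J₀.mkContinuous (6 * B) fun f => ?_, LinearMap.mkContinuous_norm_le _ (by positivity) _,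
    fun f => (hm f).coeFn_toLp⟩
  change ‖(hm f).toLp _‖ ≤ _
  rw [Lp.norm_toLp, Lp.norm_def]
  have h := ENNReal.toReal_mono (ENNReal.mul_ne_top ENNReal.ofReal_ne_top (Lp.memLp f).2.ne)
    (eLpNorm_segInt_le E (hf f) hB)
  rwa [ENNReal.toReal_mul, ENNReal.toReal_ofReal (by positivity)] at h

end Operator

/-! ### The bilinear form of two integral operators -/

/-- At an entry point the direction points inwards across some edge, so at earlier times the line is
outside the closed square. -/
theorem nonneg_of_mem_inflow_add {E E' : Set Plane} {x θ : Plane} {s : ℝ} (h : (x, θ) ∈ inflow E)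
    (h' : (x + s • θ, θ) ∈ inflow E') : 0 ≤ s := by
  obtain ⟨i, hi⟩ := (mem_frontier_square.1 h.1.2).2
  obtain ⟨h1, h2⟩ := (mem_frontier_square.1 h'.1.2).1 i
  simp only [PiLp.add_apply, PiLp.smul_apply, smul_eq_mul] at h1 h2
  rcases hi with hi | hi
  · have := pos_of_mem_inflow h hi
    rw [hi] at h1
    by_contra hs
    nlinarith
  · have := neg_of_mem_inflow h hi
    rw [hi] at h2
    by_contra hs
    nlinarith

/-- A line enters the square at most once. -/
theorem inflow_unique {E E' : Set Plane} {x θ : Plane} {s : ℝ} (h : (x, θ) ∈ inflow E)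
    (h' : (x + s • θ, θ) ∈ inflow E') : s = 0 := by
  refine le_antisymm ?_ (nonneg_of_mem_inflow_add h h')
  have h2 : (x + s • θ + (-s) • θ, θ) ∈ inflow E := by
    rwa [neg_smul, add_neg_cancel_right]
  linarith [nonneg_of_mem_inflow_add h' h2]

/-- The tubes only record lines entering through open edges; a generic line does not enter at a
corner, so none is missed. -/
theorem mem_tube_of_inflow {E : Set Plane} {y : Plane} {φ t : ℝ} (hg : Generic y (dir φ))
    (h : (y + t • dir φ, dir φ) ∈ inflow E) : (y, φ) ∈ tube := by
  have hg' := (generic_add_smul t).2 hg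
  obtain ⟨hb, i, hi⟩ := mem_frontier_square.1 h.1.2
  set x := y + t • dir φ with hx
  have hn : ∀ a b : ℤ, ¬ (x 0 = a ∧ x 1 = b) := fun a b ⟨h1, h2⟩ => hg'.2.2 a b (by simp [h1, h2])
  have e0 : x 0 = y 0 + t * Real.cos φ := by simp [hx, dir_zero]
  have e1 : x 1 = y 1 + t * Real.sin φ := by simp [hx, dir_one]
  have hc : Real.cos φ ≠ 0 := by simpa [dir_zero] using hg.1
  have hs : Real.sin φ ≠ 0 := by simpa [dir_one] using hg.2.1
  have hint : ∀ {a b : ℝ}, (a = 0 ∨ a = 1) → ∃ n : ℤ, a = n := by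
    rintro a - (h | h)
    · exact ⟨0, by simp [h]⟩
    · exact ⟨1, by simp [h]⟩
  have open0 : ∀ i j : Fin 2, (∀ a b : ℤ, ¬ (x i = a ∧ x j = b)) → (x i = 0 ∨ x i = 1) →
      x j ∈ Ioo (0 : ℝ) 1 := by
    intro i j hij hi
    obtain ⟨a, ha⟩ := hint (b := 0) hi
    refine ⟨lt_of_le_of_ne (hb j).1 fun h0 => hij a 0 ⟨ha, by simp [← h0]⟩,
      lt_of_le_of_ne (hb j).2 fun h0 => hij a 1 ⟨ha, by simp [h0]⟩⟩
  have entry : ∀ {z u : ℝ}, (z = 0 → 0 < u) → (z = 1 → u < 0) → (z = 0 ∨ z = 1) →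
      (if 0 < u then (0 : ℝ) else 1) = z := by
    rintro z u h0 h1 (h | h)
    · rw [if_pos (h0 h), h]
    · rw [if_neg (h1 h).not_gt, h]
  fin_cases i
  · right
    have hE : entryX φ = x 0 := entry (fun h0 => by simpa [dir_zero] using pos_of_mem_inflow h h0)
      (fun h0 => by simpa [dir_zero] using neg_of_mem_inflow h h0) hi
    have := open0 0 1 hn hi
    change y 1 - (y 0 - entryX φ) * Real.sin φ / Real.cos φ ∈ Ioo (0 : ℝ) 1
    convert this using 1
    rw [hE, e0, e1]
    field_simp
    ring
  · left
    have hE : entryY φ = x 1 := entry (fun h0 => by simpa [dir_one] using pos_of_mem_inflow h h0)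
      (fun h0 => by simpa [dir_one] using neg_of_mem_inflow h h0) hi
    have := open0 1 0 (fun a b hab => hn b a hab.symm) hi
    change y 0 - (y 1 - entryY φ) * Real.cos φ / Real.sin φ ∈ Ioo (0 : ℝ) 1
    convert this using 1
    rw [hE, e0, e1]
    field_simp
    ring

theorem measurePreserving_flow : MeasurePreserving flow
    ((inflowMeasure univ).prod volume) (phaseMeasure.restrict tube) := by
  refine ⟨measurable_flow, Measure.ext fun S hS => ?_⟩
  have hi : Measurable (S.indicator (1 : Plane × ℝ → ℝ≥0∞)) := measurable_one.indicator hS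
  have hi' : Measurable fun z => S.indicator (1 : Plane × ℝ → ℝ≥0∞) (flow z) :=
    hi.comp measurable_flow
  rw [← lintegral_indicator_one hS, lintegral_map hi measurable_flow,
    lintegral_prod _ hi'.aemeasurable, ← lintegral_indicator_one hS]
  exact santalo hi

section Bilinear

variable {E : Set Plane} {c c' : Fin 2 → ℤ} {w w' : Plane × ℝ → ℝ} {f h : Plane → ℂ} {B B' H : ℝ}

/-- The integral over the whole line through a point of phase space. -/
def lineInt (c : Fin 2 → ℤ) (w : Plane × ℝ → ℝ) (h : Plane → ℂ) (q : Plane × ℝ) : ℂ :=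
  ∫ r : ℝ, w (q.1 - r • dir q.2, q.2) • lift c h (q.1 - r • dir q.2)

/-- Integrating over the whole line makes the result independent of the base point. This allows one
of the two line integrals to be moved inside the other and evaluated at the point `y`. -/
theorem lineInt_flow {p : Plane × Plane} (hp : ‖p.2‖ = 1) (t : ℝ) :
    lineInt c w h (flow (p, t)) = segInt c w h p := by
  rw [lineInt, segInt, ← integral_sub_left_eq_self _ _ t]
  refine integral_congr_ae (Filter.Eventually.of_forall fun r => ?_)
  simp only [flow, dir_angle hp, sub_smul, add_sub_assoc, sub_sub_cancel]

theorem stronglyMeasurable_lineInt (hw : Measurable w) (hh : StronglyMeasurable h) :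
    StronglyMeasurable (lineInt c w h) := by
  refine StronglyMeasurable.integral_prod_right' (f := fun z : (Plane × ℝ) × ℝ =>
    w (z.1.1 - z.2 • dir z.1.2, z.1.2) • lift c h (z.1.1 - z.2 • dir z.1.2)) ?_
  have hd := continuous_dir.measurable
  exact (stronglyMeasurable_integrand c hw hh).comp_measurable
    (g := fun z : (Plane × ℝ) × ℝ => (z.1.1 - z.2 • dir z.1.2, z.1.2)) (by fun_prop)

/-- The line meets the cell in a set of length at most `4`. The supremum bound on `h` provides the
integrability for Fubini in the bilinear form. -/
theorem norm_lineInt_le (hB0 : 0 ≤ B) (hB : ∀ q : Plane × ℝ, q.1 ∈ cell c → |w q| ≤ B)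
    (hH0 : 0 ≤ H) (hH : ∀ x ∈ square, ‖h x‖ ≤ H) (q : Plane × ℝ) :
    ‖lineInt c w h q‖ ≤ 4 * (B * H) := by
  set S := {t : ℝ | q.1 + t • (-dir q.2) ∈ cell c} with hS
  have hSm : MeasurableSet S := (isOpen_cell c).measurableSet.preimage (by fun_prop)
  have hv : volume S ≤ 4 := volume_chord_le c q.1 (by rw [norm_neg, norm_dir])
  have h0 : ∀ r ∉ S, w (q.1 - r • dir q.2, q.2) • lift c h (q.1 - r • dir q.2) = 0 := by
    intro r hr
    rw [lift_of_notMem, smul_zero]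
    intro hc
    exact hr (by simpa [hS, sub_eq_add_neg] using hc)
  rw [lineInt, ← setIntegral_eq_integral_of_forall_compl_eq_zero h0]
  have h1 : ∀ r ∈ S, ‖w (q.1 - r • dir q.2, q.2) • lift c h (q.1 - r • dir q.2)‖ ≤ B * H := by
    intro r hr
    have hr' : q.1 - r • dir q.2 ∈ cell c := by simpa [hS, sub_eq_add_neg] using hr
    rw [norm_smul, Real.norm_eq_abs]
    refine mul_le_mul (hB (_, _) hr') ?_ (norm_nonneg _) hB0
    rw [lift, indicator_of_mem (fold_mem_square.2 hr')]
    exact hH _ (fold_mem_square.2 hr')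
  refine (norm_setIntegral_le_of_norm_le_const (hv.trans_lt (by norm_num)) h1).trans ?_
  rw [mul_comm]
  gcongr
  exact ENNReal.toReal_mono (by norm_num) hv

/-- The first line integral is written out as an integral over time and the second, constant along
the line, is taken under it. The flow then maps `dΣ dt` to Liouville measure, with `y` as new base
point. -/
theorem integral_conj_segInt_mul (hE : MeasurableSet E) (hw : Measurable w) (hw' : Measurable w')
    (hB0 : 0 ≤ B) (hB : ∀ q : Plane × ℝ, q.1 ∈ cell c → |w q| ≤ B)
    (hB' : ∀ q : Plane × ℝ, q.1 ∈ cell c' → |w' q| ≤ B')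
    (hs : ∀ q : Plane × ℝ, w' q ≠ 0 → ∃ t : ℝ, (q.1 + t • dir q.2, dir q.2) ∈ inflow E)
    (hf : StronglyMeasurable f) (hf2 : MemLp f 2 (volume.restrict square))
    (hh : StronglyMeasurable h) (hH0 : 0 ≤ H) (hH : ∀ x ∈ square, ‖h x‖ ≤ H) :
    ∫ p, (starRingEnd ℂ) (segInt c' w' f p) * segInt c w h p ∂inflowMeasure E =
      ∫ y in cell c', (starRingEnd ℂ) (lift c' f y) *
        ∫ φ in (-Real.pi)..Real.pi, w' (y, φ) • lineInt c w h (y, φ) := by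
  set F : Plane × ℝ → ℂ := fun q => (starRingEnd ℂ) (w' q • lift c' f q.1) * lineInt c w h q
    with hF
  have hFm : StronglyMeasurable F :=
    (RCLike.continuous_conj.comp_stronglyMeasurable (stronglyMeasurable_integrand c' hw' hf)).mul
      (stronglyMeasurable_lineInt hw hh)
  have hFi : Integrable F phaseMeasure := by
    have h1 : Integrable (fun q : Plane × ℝ => lift c' f q.1) phaseMeasure :=
      (integrable_lift c' hf2).comp_fst _
    refine (h1.norm.const_mul (B' * (4 * (B * H)))).mono' hFm.aestronglyMeasurable
      (Filter.Eventually.of_forall fun q => ?_)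
    rw [hF]
    simp only [norm_mul, RCLike.norm_conj]
    calc _ ≤ (B' * ‖lift c' f q.1‖) * (4 * (B * H)) := by
          refine mul_le_mul (norm_smul_lift_le hB' q) (norm_lineInt_le hB0 hB hH0 hH q)
            (norm_nonneg _) ?_
          exact (norm_nonneg _).trans (norm_smul_lift_le (f := f) hB' q)
      _ = _ := by ring
  have hF0 : ∀ q, F q ≠ 0 → ∃ t : ℝ, (q.1 + t • dir q.2, dir q.2) ∈ inflow E := by
    intro q hq
    refine hs q fun h0 => hq ?_
    simp [hF, h0]
  have hline : ∀ E' : Set Plane, ∀ᵐ p ∂inflowMeasure E', ∫ t : ℝ, F (flow (p, t)) =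
      (starRingEnd ℂ) (segInt c' w' f p) * segInt c w h p := by
    intro E'
    filter_upwards [ae_norm_eq_one E'] with p hp
    simp only [hF, lineInt_flow hp]
    rw [integral_mul_const, integral_conj]
    rfl
  -- Passing from `E` to the whole boundary adds nothing: the integrand lives on lines entering
  -- through `E`, and a line has only one entry point.
  have hflow : ∫ p, (starRingEnd ℂ) (segInt c' w' f p) * segInt c w h p ∂inflowMeasure E =
      ∫ p, (∫ t : ℝ, F (flow (p, t))) ∂inflowMeasure univ := by
    rw [← integral_congr_ae (hline E)]
    have e1 : inflowMeasure E = (inflowMeasure univ).restrict (inflow E) := by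
      rw [inflowMeasure, inflowMeasure, Measure.restrict_restrict (measurableSet_inflow hE),
        inter_eq_left.2 (inflow_subset E)]
    rw [e1, setIntegral_eq_integral_of_ae_compl_eq_zero]
    filter_upwards [ae_mem_inflow MeasurableSet.univ, ae_norm_eq_one univ] with p hp h1 hpE
    refine integral_eq_zero_of_ae (Filter.Eventually.of_forall fun t => ?_)
    by_contra hne
    obtain ⟨s, hs⟩ := hF0 _ hne
    simp only [flow, dir_angle h1, add_assoc, ← add_smul] at hs
    have h0 := inflow_unique hp hs
    rw [h0, zero_smul, add_zero] at hs
    exact hpE hs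
  rw [hflow, integral_integral (f := fun p t => F (flow (p, t)))
      (measurePreserving_flow.integrable_comp_of_integrable hFi.restrict),
    ← integral_map (f := F) measurable_flow.aemeasurable (by
      rw [measurePreserving_flow.map_eq]; exact hFm.aestronglyMeasurable),
    measurePreserving_flow.map_eq]
  -- Generic lines on which the integrand does not vanish enter the square and hence lie in the
  -- tube.
  rw [setIntegral_eq_integral_of_ae_compl_eq_zero]
  · rw [phaseMeasure] at hFi ⊢
    rw [integral_prod _ hFi, ← setIntegral_eq_integral_of_forall_compl_eq_zero (s := cell c')]
    · refine setIntegral_congr_fun (isOpen_cell c').measurableSet fun y _ => ?_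
      rw [intervalIntegral.integral_of_le (by linarith [Real.pi_pos]), ← integral_const_mul]
      refine integral_congr_ae (Filter.Eventually.of_forall fun φ => ?_)
      simp only [hF, Complex.real_smul, map_mul, Complex.conj_ofReal]
      ring
    · intro y hy
      simp [hF, lift_of_notMem hy]
  · filter_upwards [ae_generic_phase] with q hq hqt
    by_contra hne
    obtain ⟨t, ht⟩ := hF0 _ hne
    exact hqt (mem_tube_of_inflow hq ht)

end Bilinear

/-! ### The calculus of symbols -/

section Calculus

variable {D D' : Set Plane} {R B B' : ℝ} {P Q : Plane → ℝ → ℝ → ℝ}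

theorem IsSymbol.mono (h : IsSymbol D R B P) (hD : D' ⊆ D) (hB : B ≤ B') : IsSymbol D' R B' P := by
  obtain ⟨Pφ, Pr, Pφr, h⟩ := h
  exact ⟨Pφ, Pr, Pφr, h.cont, h.cont_angle, h.cont_radius, h.cont_mixed, h.deriv_angle,
    h.deriv_radius, h.deriv_mixed, fun y hy r φ hr => (h.bound y (hD hy) r φ hr).trans hB,
    fun y hy r φ hr => (h.bound_angle y (hD hy) r φ hr).trans hB,
    fun y hy r φ hr => (h.bound_radius y (hD hy) r φ hr).trans hB,
    fun y hy r φ hr => (h.bound_mixed y (hD hy) r φ hr).trans hB, h.periodic⟩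

theorem isSymbol_one : IsSymbol D R 1 fun _ _ _ => 1 := by
  refine ⟨fun _ _ _ => 0, fun _ _ _ => 0, fun _ _ _ => 0, by fun_prop, by fun_prop, by fun_prop,
    by fun_prop, fun y r φ => hasDerivAt_const _ _, fun y r φ => hasDerivAt_const _ _,
    fun y r φ => hasDerivAt_const _ _, ?_, ?_, ?_, ?_, fun _ _ _ => rfl⟩ <;> intros <;> simp

theorem IsSymbol.add (hP : IsSymbol D R B P) (hQ : IsSymbol D R B' Q) :
    IsSymbol D R (B + B') fun y r φ => P y r φ + Q y r φ := by
  obtain ⟨Pφ, Pr, Pφr, p⟩ := hP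
  obtain ⟨Qφ, Qr, Qφr, q⟩ := hQ
  refine ⟨fun y r φ => Pφ y r φ + Qφ y r φ, fun y r φ => Pr y r φ + Qr y r φ,
    fun y r φ => Pφr y r φ + Qφr y r φ, p.cont.add q.cont, p.cont_angle.add q.cont_angle,
    p.cont_radius.add q.cont_radius, p.cont_mixed.add q.cont_mixed,
    fun y r φ => (p.deriv_angle y r φ).add (q.deriv_angle y r φ),
    fun y r φ => (p.deriv_radius y r φ).add (q.deriv_radius y r φ),
    fun y r φ => (p.deriv_mixed y r φ).add (q.deriv_mixed y r φ), ?_, ?_, ?_, ?_, ?_⟩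
  · exact fun y hy r φ hr =>
      (abs_add_le _ _).trans (add_le_add (p.bound y hy r φ hr) (q.bound y hy r φ hr))
  · exact fun y hy r φ hr =>
      (abs_add_le _ _).trans (add_le_add (p.bound_angle y hy r φ hr) (q.bound_angle y hy r φ hr))
  · exact fun y hy r φ hr =>
      (abs_add_le _ _).trans (add_le_add (p.bound_radius y hy r φ hr) (q.bound_radius y hy r φ hr))
  · exact fun y hy r φ hr =>
      (abs_add_le _ _).trans (add_le_add (p.bound_mixed y hy r φ hr) (q.bound_mixed y hy r φ hr))
  · exact fun y r φ => by rw [p.periodic, q.periodic]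

theorem abs_mul_le_mul {a b A B : ℝ} (ha : |a| ≤ A) (hb : |b| ≤ B) : |a * b| ≤ A * B := by
  rw [abs_mul]
  exact mul_le_mul ha hb (abs_nonneg _) ((abs_nonneg _).trans ha)

theorem IsSymbol.mul (hP : IsSymbol D R B P) (hQ : IsSymbol D R B' Q) :
    IsSymbol D R (4 * (B * B')) fun y r φ => P y r φ * Q y r φ := by
  obtain ⟨Pφ, Pr, Pφr, p⟩ := hP
  obtain ⟨Qφ, Qr, Qφr, q⟩ := hQ
  have h2 : ∀ {a b A : ℝ}, |a| ≤ A → |b| ≤ A → |a + b| ≤ 4 * A := by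
    intro a b A ha hb
    have := abs_add_le a b
    linarith [abs_nonneg a]
  refine ⟨fun y r φ => Pφ y r φ * Q y r φ + P y r φ * Qφ y r φ,
    fun y r φ => Pr y r φ * Q y r φ + P y r φ * Qr y r φ,
    fun y r φ => (Pφr y r φ * Q y r φ + Pφ y r φ * Qr y r φ) +
      (Pr y r φ * Qφ y r φ + P y r φ * Qφr y r φ), p.cont.mul q.cont,
    (p.cont_angle.mul q.cont).add (p.cont.mul q.cont_angle),
    (p.cont_radius.mul q.cont).add (p.cont.mul q.cont_radius),
    ((p.cont_mixed.mul q.cont).add (p.cont_angle.mul q.cont_radius)).add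
      ((p.cont_radius.mul q.cont_angle).add (p.cont.mul q.cont_mixed)),
    fun y r φ => (p.deriv_angle y r φ).mul (q.deriv_angle y r φ),
    fun y r φ => (p.deriv_radius y r φ).mul (q.deriv_radius y r φ),
    fun y r φ => ((p.deriv_mixed y r φ).mul (q.deriv_radius y r φ)).add
      ((p.deriv_radius y r φ).mul (q.deriv_mixed y r φ)), ?_, ?_, ?_, ?_, ?_⟩
  · intro y hy r φ hr
    have := abs_mul_le_mul (p.bound y hy r φ hr) (q.bound y hy r φ hr)
    linarith [abs_nonneg (P y r φ * Q y r φ)]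
  · exact fun y hy r φ hr => h2 (abs_mul_le_mul (p.bound_angle y hy r φ hr) (q.bound y hy r φ hr))
      (abs_mul_le_mul (p.bound y hy r φ hr) (q.bound_angle y hy r φ hr))
  · exact fun y hy r φ hr => h2 (abs_mul_le_mul (p.bound_radius y hy r φ hr) (q.bound y hy r φ hr))
      (abs_mul_le_mul (p.bound y hy r φ hr) (q.bound_radius y hy r φ hr))
  · intro y hy r φ hr
    have a1 := abs_mul_le_mul (p.bound_mixed y hy r φ hr) (q.bound y hy r φ hr)
    have a2 := abs_mul_le_mul (p.bound_angle y hy r φ hr) (q.bound_radius y hy r φ hr)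
    have a3 := abs_mul_le_mul (p.bound_radius y hy r φ hr) (q.bound_angle y hy r φ hr)
    have a4 := abs_mul_le_mul (p.bound y hy r φ hr) (q.bound_mixed y hy r φ hr)
    refine (abs_add_le _ _).trans ?_
    have b1 := abs_add_le (Pφr y r φ * Q y r φ) (Pφ y r φ * Qr y r φ)
    have b2 := abs_add_le (Pr y r φ * Qφ y r φ) (P y r φ * Qφr y r φ)
    linarith
  · exact fun y r φ => by rw [p.periodic, q.periodic]

/-- In the bilinear form one of the weights is evaluated at the base point `y` itself, that is at `r
= 0`. -/
theorem IsSymbol.freeze (hP : IsSymbol D R B P) (hR : 0 ≤ R) (hB : 0 ≤ B) :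
    IsSymbol D R B fun y _ φ => P y 0 φ := by
  obtain ⟨Pφ, Pr, Pφr, p⟩ := hP
  have h0 : |(0 : ℝ)| ≤ R := by simpa using hR
  refine ⟨fun y _ φ => Pφ y 0 φ, fun _ _ _ => 0, fun _ _ _ => 0,
    p.cont.comp (by fun_prop : Continuous fun q : Plane × ℝ × ℝ => (q.1, (0 : ℝ), q.2.2)),
    p.cont_angle.comp (by fun_prop : Continuous fun q : Plane × ℝ × ℝ => (q.1, (0 : ℝ), q.2.2)),
    by fun_prop, by fun_prop, fun y r φ => p.deriv_angle y 0 φ,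
    fun y r φ => hasDerivAt_const _ _, fun y r φ => hasDerivAt_const _ _,
    fun y hy r φ _ => p.bound y hy 0 φ h0, fun y hy r φ _ => p.bound_angle y hy 0 φ h0,
    ?_, ?_, fun y r φ => p.periodic y 0 φ⟩ <;> intros <;> simpa using hB

theorem abs_exp_sub_one_le_mul (x : ℝ) : |Real.exp x - 1| ≤ |x| * Real.exp |x| := by
  rcases le_total 0 x with h | h
  · rw [abs_of_nonneg h, abs_of_nonneg (by linarith [Real.one_le_exp h])]
    have h1 := Real.add_one_le_exp (-x)
    have h2 : Real.exp (-x) * Real.exp x = 1 := by rw [← Real.exp_add]; simp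
    nlinarith [Real.exp_pos x]
  · rw [abs_of_nonpos h, abs_of_nonpos (by linarith [Real.exp_le_one_iff.2 h])]
    have h1 := Real.add_one_le_exp x
    have h2 : 1 ≤ Real.exp (-x) := Real.one_le_exp (by linarith)
    nlinarith

/-- The exponential of a small symbol is close to one. -/
theorem IsSymbol.exp_neg_sub_one (hP : IsSymbol D R B P) (hB : 0 ≤ B) :
    IsSymbol D R (B * (1 + B) * Real.exp B) fun y r φ => Real.exp (-P y r φ) - 1 := by
  obtain ⟨Pφ, Pr, Pφr, p⟩ := hP
  have he : ∀ y ∈ D, ∀ r φ, |r| ≤ R → |Real.exp (-P y r φ)| ≤ Real.exp B := by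
    intro y hy r φ hr
    rw [abs_of_pos (Real.exp_pos _)]
    exact Real.exp_le_exp.2 ((neg_le_abs _).trans (p.bound y hy r φ hr))
  have hE := Real.exp_pos B
  have h1 : B * Real.exp B ≤ B * (1 + B) * Real.exp B := by
    have : 0 ≤ B * B * Real.exp B := by positivity
    linarith
  refine ⟨fun y r φ => Real.exp (-P y r φ) * -Pφ y r φ, fun y r φ => Real.exp (-P y r φ) * -Pr y r φ,
    fun y r φ => Real.exp (-P y r φ) * (-Pr y r φ) * (-Pφ y r φ) +
      Real.exp (-P y r φ) * -Pφr y r φ,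
    (Real.continuous_exp.comp p.cont.neg).sub continuous_const,
    (Real.continuous_exp.comp p.cont.neg).mul p.cont_angle.neg,
    (Real.continuous_exp.comp p.cont.neg).mul p.cont_radius.neg,
    (((Real.continuous_exp.comp p.cont.neg).mul p.cont_radius.neg).mul p.cont_angle.neg).add
      ((Real.continuous_exp.comp p.cont.neg).mul p.cont_mixed.neg),
    fun y r φ => (p.deriv_angle y r φ).neg.exp.sub_const 1,
    fun y r φ => (p.deriv_radius y r φ).neg.exp.sub_const 1,
    fun y r φ => ((p.deriv_radius y r φ).neg.exp).mul (p.deriv_mixed y r φ).neg, ?_, ?_, ?_, ?_, ?_⟩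
  · intro y hy r φ hr
    refine (abs_exp_sub_one_le_mul _).trans (le_trans ?_ h1)
    rw [abs_neg]
    have := p.bound y hy r φ hr
    gcongr
  · intro y hy r φ hr
    refine (abs_mul_le_mul (he y hy r φ hr) (B := B) ?_).trans (by linarith)
    rw [abs_neg]; exact p.bound_angle y hy r φ hr
  · intro y hy r φ hr
    refine (abs_mul_le_mul (he y hy r φ hr) (B := B) ?_).trans (by linarith)
    rw [abs_neg]; exact p.bound_radius y hy r φ hr
  · intro y hy r φ hr
    have a1 : |Real.exp (-P y r φ) * (-Pr y r φ) * (-Pφ y r φ)| ≤ Real.exp B * B * B :=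
      abs_mul_le_mul (abs_mul_le_mul (he y hy r φ hr)
        (by rw [abs_neg]; exact p.bound_radius y hy r φ hr))
        (by rw [abs_neg]; exact p.bound_angle y hy r φ hr)
    have a2 : |Real.exp (-P y r φ) * -Pφr y r φ| ≤ Real.exp B * B :=
      abs_mul_le_mul (he y hy r φ hr) (by rw [abs_neg]; exact p.bound_mixed y hy r φ hr)
    refine (abs_add_le _ _).trans ?_
    linarith
  · exact fun y r φ => by rw [p.periodic]

end Calculus

/-! ### Integrals of functions on phase space along lines -/

/-- A `C¹` function on phase space which is bounded by `m` with its derivative. -/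
structure IsField (m : ℝ) (g : Plane × ℝ → ℝ) : Prop where
  contDiff : ContDiff ℝ 1 g
  bound : ∀ q, |g q| ≤ m
  bound_fderiv : ∀ q, ‖fderiv ℝ g q‖ ≤ m
  periodic : ∀ y φ, g (y, φ + 2 * Real.pi) = g (y, φ)

section Field

variable {g : Plane × ℝ → ℝ} {m R : ℝ}

theorem IsField.sum {ι : Type*} (s : Finset ι) {g : ι → Plane × ℝ → ℝ}
    (h : ∀ i ∈ s, IsField m (g i)) : IsField (s.card * m) fun q => ∑ i ∈ s, g i q := by
  refine ⟨ContDiff.sum fun i hi => (h i hi).contDiff, fun q => ?_, fun q => ?_, fun y φ => ?_⟩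
  · refine (Finset.abs_sum_le_sum_abs _ _).trans ?_
    rw [← nsmul_eq_mul]
    exact Finset.sum_le_card_nsmul _ _ _ fun i hi => (h i hi).bound q
  · rw [fderiv_fun_sum fun i hi => (h i hi).contDiff.differentiable (by simp) q]
    refine (norm_sum_le _ _).trans ?_
    rw [← nsmul_eq_mul]
    exact Finset.sum_le_card_nsmul _ _ _ fun i hi => (h i hi).bound_fderiv q
  · exact Finset.sum_congr rfl fun i hi => (h i hi).periodic y φ

/-- The derivative of `g (y - τ • dir φ, φ)` in `φ`. -/
def lineDeriv (g : Plane × ℝ → ℝ) (y : Plane) (τ φ : ℝ) : ℝ :=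
  fderiv ℝ g (y - τ • dir φ, φ) (-(τ • dirPerp φ), 1)

theorem hasDerivAt_line (hg : ContDiff ℝ 1 g) (y : Plane) (τ φ : ℝ) :
    HasDerivAt (fun φ => g (y - τ • dir φ, φ)) (lineDeriv g y τ φ) φ := by
  have h1 : HasDerivAt (fun φ : ℝ => (y - τ • dir φ, φ)) (-(τ • dirPerp φ), (1 : ℝ)) φ :=
    (((hasDerivAt_dir φ).const_smul τ).const_sub y).prodMk (hasDerivAt_id φ)
  exact ((hg.differentiable (by simp)) _).hasFDerivAt.comp_hasDerivAt φ h1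

theorem IsField.abs_lineDeriv_le (hg : IsField m g) (y : Plane) (τ φ : ℝ) :
    |lineDeriv g y τ φ| ≤ m * (|τ| + 1) := by
  have hm : 0 ≤ m := (abs_nonneg _).trans (hg.bound 0)
  refine ((fderiv ℝ g (y - τ • dir φ, φ)).le_opNorm _).trans ?_
  refine mul_le_mul (hg.bound_fderiv _) ?_ (norm_nonneg _) hm
  rw [Prod.norm_mk, norm_neg, norm_smul, norm_dirPerp, mul_one, Real.norm_eq_abs, norm_one]
  exact max_le (by linarith) (by linarith [abs_nonneg τ])

theorem continuous_lineDeriv (hg : ContDiff ℝ 1 g) :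
    Continuous fun q : Plane × ℝ × ℝ => lineDeriv g q.1 q.2.1 q.2.2 := by
  have h1 := continuous_dir
  have h2 := continuous_dirPerp
  exact ((hg.continuous_fderiv (by simp)).comp (by fun_prop)).clm_apply (by fun_prop)

theorem continuous_line (hg : Continuous g) :
    Continuous fun q : Plane × ℝ × ℝ => g (q.1 - q.2.1 • dir q.2.2, q.2.2) := by
  have h1 := continuous_dir
  exact hg.comp (by fun_prop)

/-- The integral of `g` over the part of the line behind the point at time `-r`. -/
def backInt (R : ℝ) (g : Plane × ℝ → ℝ) (y : Plane) (r φ : ℝ) : ℝ :=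
  ∫ τ in r..R, g (y - τ • dir φ, φ)

theorem continuous_integral_left {F : Plane → ℝ → ℝ → ℝ}
    (hF : Continuous fun q : Plane × ℝ × ℝ => F q.1 q.2.1 q.2.2) (R : ℝ) :
    Continuous fun q : Plane × ℝ × ℝ => ∫ τ in q.2.1..R, F q.1 τ q.2.2 := by
  simp_rw [fun q : Plane × ℝ × ℝ => intervalIntegral.integral_symm (μ := volume)
    (f := fun τ => F q.1 τ q.2.2) R q.2.1]
  refine Continuous.neg ?_
  refine intervalIntegral.continuous_parametric_intervalIntegral_of_continuous
    (f := fun (q : Plane × ℝ × ℝ) τ => F q.1 τ q.2.2) ?_ (by fun_prop)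
  exact hF.comp (by fun_prop : Continuous fun z : (Plane × ℝ × ℝ) × ℝ => (z.1.1, z.2, z.1.2.2))

theorem hasDerivAt_integral_left {F : ℝ → ℝ} (hF : Continuous F) (r R : ℝ) :
    HasDerivAt (fun r => ∫ τ in r..R, F τ) (-F r) r :=
  intervalIntegral.integral_hasDerivAt_left (hF.intervalIntegrable _ _)
    (hF.stronglyMeasurableAtFilter _ _) hF.continuousAt

theorem abs_intervalIntegral_le {F : ℝ → ℝ} {C r : ℝ} (hr : |r| ≤ R)
    (hF : ∀ τ, |τ| ≤ R → |F τ| ≤ C) : |∫ τ in r..R, F τ| ≤ 2 * R * C := by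
  have hC : 0 ≤ C := (abs_nonneg _).trans (hF r hr)
  obtain ⟨h1, h2⟩ := abs_le.1 hr
  have := intervalIntegral.norm_integral_le_of_norm_le_const (a := r) (b := R) (C := C) (f := F)
    (fun τ hτ => by
      rw [uIoc_of_le h2] at hτ
      exact hF τ (abs_le.2 ⟨by linarith [hτ.1], hτ.2⟩))
  rw [Real.norm_eq_abs, abs_of_nonneg (by linarith : 0 ≤ R - r)] at this
  refine this.trans ?_
  nlinarith

/-- The integral of a field along lines is a symbol. -/
theorem IsField.isSymbol_backInt (hg : IsField m g) (hR : 0 ≤ R) (D : Set Plane) :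
    IsSymbol D R ((2 * R + 1) * (R + 1) * m) (backInt R g) := by
  have hm : 0 ≤ m := (abs_nonneg _).trans (hg.bound 0)
  have hgc := hg.contDiff.continuous
  have hl := continuous_line hgc
  have hl' := continuous_lineDeriv hg.contDiff
  have b1 : m ≤ (2 * R + 1) * (R + 1) * m := by
    have : 1 ≤ (2 * R + 1) * (R + 1) := by nlinarith
    nlinarith
  have b2 : m * (R + 1) ≤ (2 * R + 1) * (R + 1) * m := by
    have : 0 ≤ 2 * R * ((R + 1) * m) := by positivity
    linarith
  have b3 : 2 * R * m ≤ (2 * R + 1) * (R + 1) * m := by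
    have : 0 ≤ (2 * R + 1) * R * m := by positivity
    linarith
  have b4 : 2 * R * (m * (R + 1)) ≤ (2 * R + 1) * (R + 1) * m := by
    have : 0 ≤ (R + 1) * m := by positivity
    linarith
  have hd : ∀ y τ φ, |τ| ≤ R → |lineDeriv g y τ φ| ≤ m * (R + 1) := fun y τ φ hτ =>
    (hg.abs_lineDeriv_le y τ φ).trans (by gcongr)
  have lineC : ∀ (F : Plane → ℝ → ℝ → ℝ), Continuous (fun q : Plane × ℝ × ℝ => F q.1 q.2.1 q.2.2) →
      ∀ y φ, Continuous fun τ => F y τ φ := fun F hF y φ =>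
    hF.comp (by fun_prop : Continuous fun τ : ℝ => (y, τ, φ))
  -- The radial derivative only evaluates the integrand at the lower limit, so the mixed derivative
  -- still involves no more than one derivative of `g`.
  refine ⟨fun y r φ => ∫ τ in r..R, lineDeriv g y τ φ, fun y r φ => -g (y - r • dir φ, φ),
    fun y r φ => -lineDeriv g y r φ,
    continuous_integral_left (F := fun y τ φ => g (y - τ • dir φ, φ)) hl R,
    continuous_integral_left hl' R, hl.neg, hl'.neg, ?_, ?_, ?_, ?_, ?_, ?_, ?_, ?_⟩
  · intro y r φ
    refine (intervalIntegral.hasDerivAt_integral_of_dominated_loc_of_deriv_le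
      (F := fun φ τ => g (y - τ • dir φ, φ)) (F' := fun φ τ => lineDeriv g y τ φ)
      (bound := fun τ => m * (|τ| + 1)) (s := univ) Filter.univ_mem ?_ ?_ ?_ ?_ ?_ ?_).2
    · exact Filter.Eventually.of_forall fun φ =>
        (lineC (fun y τ φ => g (y - τ • dir φ, φ)) hl y φ).aestronglyMeasurable
    · exact (lineC (fun y τ φ => g (y - τ • dir φ, φ)) hl y φ).intervalIntegrable _ _
    · exact (lineC _ hl' y φ).aestronglyMeasurable
    · exact Filter.Eventually.of_forall fun τ _ φ _ => hg.abs_lineDeriv_le y τ φ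
    · exact Continuous.intervalIntegrable (by fun_prop) _ _
    · exact Filter.Eventually.of_forall fun τ _ φ _ => hasDerivAt_line hg.contDiff y τ φ
  · exact fun y r φ => hasDerivAt_integral_left
      (lineC (fun y τ φ => g (y - τ • dir φ, φ)) hl y φ) r R
  · exact fun y r φ => hasDerivAt_integral_left (lineC _ hl' y φ) r R
  · exact fun y _ r φ hr => (abs_intervalIntegral_le hr fun τ _ => hg.bound _).trans b3
  · exact fun y _ r φ hr => (abs_intervalIntegral_le hr fun τ hτ => hd y τ φ hτ).trans b4
  · exact fun y _ r φ _ => by rw [abs_neg]; exact (hg.bound _).trans b1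
  · exact fun y _ r φ hr => by rw [abs_neg]; exact (hd y r φ hr).trans b2
  · intro y r φ
    simp only [backInt, dir_add_two_pi, hg.periodic]

end Field

/-! ### Attenuations on the unfolded plane -/

/-- The action of `flip c` on angles. -/
def turn (c : Fin 2 → ℤ) (φ : ℝ) : ℝ :=
  paritySign (c 0) * paritySign (c 1) * φ + if Even (c 0) then 0 else Real.pi

theorem dir_turn (c : Fin 2 → ℤ) (φ : ℝ) : dir (turn c φ) = flip c (dir φ) := by
  ext i
  rw [flip_apply]
  unfold turn paritySign
  fin_cases i
  · simp only [Fin.zero_eta, dir_zero]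
    split_ifs <;> simp [Real.cos_add]
  · simp only [Fin.mk_one, dir_one]
    split_ifs <;> simp [Real.sin_add]

theorem enorm_angular_le_c2Norm (g : Plane → Plane → ℝ) {x : Plane} (hx : x ∈ square) (φ : ℝ)
    (k : Fin 3) : ‖iteratedFDeriv ℝ (k : ℕ) (angular g) (x, φ)‖ₑ ≤ c2Norm g :=
  le_iSup_of_le k (le_iSup_of_le x (le_iSup_of_le hx (le_iSup_of_le φ le_rfl)))

section C2

variable {g : Plane → Plane → ℝ} {m : ℝ}

theorem abs_angular_le (h : c2Norm g ≤ ENNReal.ofReal m) (hm : 0 ≤ m) {x : Plane}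
    (hx : x ∈ square) (φ : ℝ) : |angular g (x, φ)| ≤ m := by
  have h1 := (enorm_angular_le_c2Norm g hx φ 0).trans h
  rw [← ofReal_norm, ENNReal.ofReal_le_ofReal_iff hm] at h1
  simpa using h1

theorem norm_fderiv_angular_le (h : c2Norm g ≤ ENNReal.ofReal m) (hm : 0 ≤ m) {x : Plane}
    (hx : x ∈ square) (φ : ℝ) : ‖fderiv ℝ (angular g) (x, φ)‖ ≤ m := by
  have h1 := (enorm_angular_le_c2Norm g hx φ 1).trans h
  rw [← ofReal_norm, ENNReal.ofReal_le_ofReal_iff hm] at h1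
  simpa [norm_iteratedFDeriv_one] using h1

end C2

theorem IsAttenuation.sub {σ σ' : Plane → Plane → ℝ} (h : IsAttenuation σ)
    (h' : IsAttenuation σ') : IsAttenuation (σ' - σ) := by
  obtain ⟨h1, S, hS, hSc, h0⟩ := h
  obtain ⟨h1', S', hS', hSc', h0'⟩ := h'
  refine ⟨h1'.sub h1, S' ∪ S, union_subset hS' hS, hSc'.union hSc, fun x hx θ hθ => ?_⟩
  rw [mem_union, not_or] at hx
  simp [h0 x hx.2 θ hθ, h0' x hx.1 θ hθ]

theorem IsAttenuation.eq_zero {σ : Plane → Plane → ℝ} (h : IsAttenuation σ) {x θ : Plane}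
    (hx : x ∉ square) (hθ : ‖θ‖ = 1) : σ x θ = 0 := by
  obtain ⟨-, S, hS, -, h0⟩ := h
  exact h0 x (fun h => hx (hS h)) θ hθ

/-- The norm only controls the attenuation over the square. Off its compact support both it and its
derivative vanish, so the bound is global. -/
theorem IsAttenuation.isField {σ : Plane → Plane → ℝ} {m : ℝ} (h : IsAttenuation σ) (hm : 0 ≤ m)
    (hc : c2Norm σ ≤ ENNReal.ofReal m) : IsField m (angular σ) := by
  obtain ⟨h1, S, hS, hSc, h0⟩ := h
  have hz : ∀ q : Plane × ℝ, q.1 ∉ S → angular σ q = 0 := fun q hq => h0 q.1 hq _ (norm_dir _)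
  refine ⟨h1.of_le (by norm_num), fun q => ?_, fun q => ?_, fun y φ => ?_⟩
  · by_cases hq : q.1 ∈ S
    · exact abs_angular_le hc hm (hS hq) q.2
    · rw [hz q hq, abs_zero]; exact hm
  · by_cases hq : q.1 ∈ S
    · exact norm_fderiv_angular_le hc hm (hS hq) q.2
    · have : angular σ =ᶠ[𝓝 q] fun _ => 0 := by
        have ho : IsOpen {q : Plane × ℝ | q.1 ∉ S} :=
          hSc.isClosed.isOpen_compl.preimage continuous_fst
        filter_upwards [ho.mem_nhds hq] with q' hq'
        exact hz q' hq'
      rw [this.fderiv_eq]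
      simpa using hm
  · simp only [angular, dir_add_two_pi]

/-- A function on the phase space of the square, transplanted to the cell `c`. -/
def transplant (c : Fin 2 → ℤ) (g : Plane × ℝ → ℝ) (q : Plane × ℝ) : ℝ :=
  g (fold c q.1, turn c q.2)

/-- Folding acts as an isometry on points and as `±φ + const` on angles, so it does not increase the
norm of the derivative. -/
theorem IsField.transplant {g : Plane → Plane → ℝ} {m : ℝ} (h : IsField m (angular g))
    (c : Fin 2 → ℤ) : IsField m (transplant c (angular g)) := by
  set L : Plane × ℝ →L[ℝ] Plane × ℝ :=
    ContinuousLinearMap.prodMap ((flip c).toContinuousLinearEquiv : Plane →L[ℝ] Plane)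
      ((paritySign (c 0) * paritySign (c 1)) • ContinuousLinearMap.id ℝ ℝ) with hL
  set Φ : Plane × ℝ → Plane × ℝ := fun q => (fold c q.1, turn c q.2) with hΦ
  have hd : ∀ q, HasFDerivAt Φ L q := by
    intro q
    refine HasFDerivAt.prodMap (f := fold c) (f₂ := turn c) q (hasFDerivAt_fold c q.1) ?_
    exact (((hasFDerivAt_id q.2).const_mul (paritySign (c 0) * paritySign (c 1))).add_const _)
  have hLn : ‖L‖ ≤ 1 := by
    refine ContinuousLinearMap.opNorm_le_bound _ zero_le_one fun v => ?_
    rw [one_mul, Prod.norm_def, Prod.norm_def]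
    refine max_le_max ?_ ?_
    · exact ((flip c).norm_map v.1).le
    · change ‖(paritySign (c 0) * paritySign (c 1)) • v.2‖ ≤ _
      rw [norm_smul, norm_mul, Real.norm_eq_abs, Real.norm_eq_abs, abs_paritySign, abs_paritySign]
      simp
  have hcd : ContDiff ℝ 1 Φ := by
    refine ((contDiff_fold c).comp contDiff_fst).prodMk (ContDiff.comp (g := turn c) ?_ contDiff_snd)
    unfold turn
    fun_prop
  refine ⟨h.contDiff.comp hcd, fun q => h.bound _, fun q => ?_, fun y φ => ?_⟩
  · have h1 := ((h.contDiff.differentiable (by simp)) (Φ q)).hasFDerivAt.comp q (hd q)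
    have h2 : fderiv ℝ (BrokenRay.transplant c (angular g)) q = _ := h1.fderiv
    rw [h2]
    refine (ContinuousLinearMap.opNorm_comp_le _ _).trans ?_
    have := mul_le_mul (h.bound_fderiv (Φ q)) hLn (norm_nonneg _)
      ((norm_nonneg _).trans (h.bound_fderiv (Φ q)))
    rwa [mul_one] at this
  · simp only [BrokenRay.transplant, angular, dir_turn, dir_add_two_pi]

/-- The sum of the transplants of an attenuation to the cells between the square and `c`. -/
def corridor (c : Fin 2 → ℤ) (σ : Plane → Plane → ℝ) (q : Plane × ℝ) : ℝ :=
  ∑ c' ∈ Finset.uIcc 0 c, transplant c' (angular σ) q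

theorem transplant_angular (c : Fin 2 → ℤ) (σ : Plane → Plane → ℝ) (y : Plane) (φ : ℝ) :
    transplant c (angular σ) (y, φ) = σ (fold c y) (flip c (dir φ)) := by
  rw [transplant, angular, dir_turn]

theorem IsAttenuation.transplant_eq_zero {σ : Plane → Plane → ℝ} (h : IsAttenuation σ)
    {c : Fin 2 → ℤ} {y : Plane} (hy : y ∉ cell c) (φ : ℝ) :
    transplant c (angular σ) (y, φ) = 0 :=
  h.eq_zero (fun h => hy (fold_mem_square.1 h)) (norm_dir _)

/-! ### The unfolded region -/

/-- The cells which broken rays with at most `n` reflections can reach. -/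
def box (n : ℕ) : Finset (Fin 2 → ℤ) := Fintype.piFinset fun _ => Finset.Icc (-(n : ℤ)) n

theorem mem_box {n : ℕ} {c : Fin 2 → ℤ} : c ∈ box n ↔ ∀ i, |c i| ≤ n := by
  simp [box, abs_le]

theorem mem_box_of_mem_uIcc {n : ℕ} {c c' : Fin 2 → ℤ} (hc : c ∈ box n)
    (h : c' ∈ Finset.uIcc 0 c) : c' ∈ box n := by
  rw [mem_box] at hc ⊢
  intro i
  have h1 := Finset.mem_uIcc.1 h
  have h2 := h1.1 i
  have h3 := h1.2 i
  have := abs_le.1 (hc i)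
  simp only [Pi.inf_apply, Pi.sup_apply, Pi.zero_apply] at h2 h3
  rw [abs_le]
  omega

/-- A radius which exceeds the distance of two points in cells of the box. -/
def radius (n : ℕ) : ℝ := 4 * (n + 1)

theorem radius_pos (n : ℕ) : 0 < radius n := by unfold radius; positivity

/-- The points of the cells in the box. -/
def region (n : ℕ) : Set Plane := {y | ∀ i, |y i| < n + 1 ∧ ∀ a : ℤ, y i ≠ a}

theorem cell_subset_region {n : ℕ} {c : Fin 2 → ℤ} (hc : c ∈ box n) : cell c ⊆ region n := by
  intro y hy i
  obtain ⟨h1, h2⟩ := hy i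
  have h3 := abs_le.1 (mem_box.1 hc i)
  have h4 : (-(n : ℝ)) ≤ c i := by exact_mod_cast h3.1
  have h5 : (c i : ℝ) ≤ n := by exact_mod_cast h3.2
  refine ⟨abs_lt.2 ⟨by linarith, by linarith⟩, fun a ha => ?_⟩
  rw [ha] at h1 h2
  rw [← Int.cast_one, ← Int.cast_add, Int.cast_lt] at h2
  rw [Int.cast_lt] at h1
  omega

theorem norm_le_of_abs_le {y : Plane} {a : ℝ} (ha : 0 ≤ a) (h : ∀ i, |y i| ≤ a) :
    ‖y‖ ≤ 2 * a := by
  rw [EuclideanSpace.norm_eq, Fin.sum_univ_two, Real.sqrt_le_left (by positivity)]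
  have h' : ∀ i, ‖y i‖ ^ 2 ≤ a ^ 2 := fun i => pow_le_pow_left₀ (norm_nonneg _) (h i) 2
  nlinarith [h' 0, h' 1]

theorem norm_lt_of_mem_region {n : ℕ} {y : Plane} (hy : y ∈ region n) :
    ‖y‖ ≤ radius n / 2 := by
  have := norm_le_of_abs_le (a := n + 1) (by positivity) fun i => (hy i).1.le
  unfold radius
  linarith

theorem abs_lt_radius {n : ℕ} {y z : Plane} (hy : y ∈ region n) (hz : z ∈ region n) {r φ : ℝ}
    (h : z = y - r • dir φ) : |r| < radius n := by
  have h1 : y - z = r • dir φ := by rw [h]; abel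
  have h2 : ‖y - z‖ = |r| := by rw [h1, norm_smul, norm_dir, mul_one, Real.norm_eq_abs]
  have h3 : ‖y - z‖ < radius n := by
    rw [EuclideanSpace.norm_eq, Fin.sum_univ_two, Real.sqrt_lt' (radius_pos n)]
    have h' : ∀ i, ‖(y - z) i‖ ^ 2 ≤ (2 * (n + 1)) ^ 2 := by
      intro i
      refine pow_le_pow_left₀ (norm_nonneg _) ?_ 2
      rw [PiLp.sub_apply, Real.norm_eq_abs]
      refine (abs_sub _ _).trans ?_
      linarith [(hy i).1, (hz i).1]
    have := h' 0
    have := h' 1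
    have : (0 : ℝ) < n + 1 := by positivity
    unfold radius
    nlinarith
  linarith

theorem IsAttenuation.corridor_eq_zero {n : ℕ} {σ : Plane → Plane → ℝ} (h : IsAttenuation σ)
    {c : Fin 2 → ℤ} (hc : c ∈ box n) {y : Plane} (hy : y ∉ region n) (φ : ℝ) :
    corridor c σ (y, φ) = 0 :=
  Finset.sum_eq_zero fun _ hc' => h.transplant_eq_zero
    (fun hy' => hy (cell_subset_region (mem_box_of_mem_uIcc hc hc') hy')) φ

theorem card_uIcc_le {n : ℕ} {c : Fin 2 → ℤ} (hc : c ∈ box n) :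
    (Finset.uIcc 0 c).card ≤ (box n).card :=
  Finset.card_le_card fun _ h => mem_box_of_mem_uIcc hc h

theorem IsAttenuation.isField_corridor {σ : Plane → Plane → ℝ} {m : ℝ}
    (h : IsAttenuation σ) (hm : 0 ≤ m) (hσ : c2Norm σ ≤ ENNReal.ofReal m) {c : Fin 2 → ℤ} :
    IsField ((Finset.uIcc 0 c).card * m) (corridor c σ) :=
  IsField.sum _ fun _ _ => (h.isField hm hσ).transplant _

/-- The attenuation factor along the line behind a point of the cell `c`. -/
def decay (c : Fin 2 → ℤ) (σ : Plane → Plane → ℝ) (q : Plane × ℝ) : ℝ :=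
  Real.exp (-∫ τ in Ioi (0 : ℝ), corridor c σ (q.1 - τ • dir q.2, q.2))

/-- The half line behind `y - r dir φ` is `τ > r` when measured from `y`. Beyond `τ = radius n` it
has left the region, so the integral may be cut off at a fixed end point, whatever the sign of `r`.
-/
theorem IsAttenuation.decay_sub {n : ℕ} {σ : Plane → Plane → ℝ} (h : IsAttenuation σ)
    {c : Fin 2 → ℤ} (hc : c ∈ box n) {y : Plane} (hy : y ∈ region n) {r : ℝ}
    (hr : r ≤ radius n) (φ : ℝ) :
    decay c σ (y - r • dir φ, φ) = Real.exp (-backInt (radius n) (corridor c σ) y r φ) := by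
  rw [decay, backInt, intervalIntegral.integral_of_le hr]
  congr 2
  have h1 : ∫ τ in Ioi (0 : ℝ), corridor c σ (y - r • dir φ - τ • dir φ, φ) =
      ∫ τ in Ioi r, corridor c σ (y - τ • dir φ, φ) := by
    rw [← integral_indicator measurableSet_Ioi, ← integral_indicator measurableSet_Ioi,
      ← integral_add_left_eq_self ((Ioi r).indicator fun τ => corridor c σ (y - τ • dir φ, φ)) r]
    refine integral_congr_ae (Filter.Eventually.of_forall fun τ => ?_)
    simp only [indicator, mem_Ioi, lt_add_iff_pos_right, add_smul, sub_sub]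
  rw [h1]
  refine setIntegral_eq_of_subset_of_forall_sdiff_eq_zero measurableSet_Ioi Ioc_subset_Ioi_self ?_
  intro τ hτ
  refine h.corridor_eq_zero hc (fun hτ' => ?_) φ
  have h2 := abs_lt_radius hy hτ' rfl
  exact hτ.2 ⟨hτ.1, (le_abs_self τ).trans h2.le⟩

theorem IsAttenuation.continuous_corridor {σ : Plane → Plane → ℝ} (h : IsAttenuation σ)
    (c : Fin 2 → ℤ) : Continuous (corridor c σ) := by
  refine continuous_finsetSum _ fun c' _ => h.1.continuous.comp ?_
  have h1 := continuous_fold c'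
  unfold turn
  fun_prop

theorem IsAttenuation.measurable_decay {σ : Plane → Plane → ℝ} (h : IsAttenuation σ)
    (c : Fin 2 → ℤ) : Measurable (decay c σ) := by
  refine Real.measurable_exp.comp (Measurable.neg ?_)
  refine (StronglyMeasurable.integral_prod_right' (ν := volume.restrict (Ioi (0 : ℝ)))
    (f := fun z : (Plane × ℝ) × ℝ => corridor c σ (z.1.1 - z.2 • dir z.1.2, z.1.2)) ?_).measurable
  have hd := continuous_dir
  exact ((h.continuous_corridor c).comp (by fun_prop)).stronglyMeasurable

theorem corridor_sub (c : Fin 2 → ℤ) (σ σ' : Plane → Plane → ℝ) (q : Plane × ℝ) :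
    corridor c (σ' - σ) q = corridor c σ' q - corridor c σ q := by
  simp only [corridor, ← Finset.sum_sub_distrib]
  rfl

theorem backInt_corridor_sub {σ σ' : Plane → Plane → ℝ} (h : IsAttenuation σ)
    (h' : IsAttenuation σ') (c : Fin 2 → ℤ) (R : ℝ) (y : Plane) (r φ : ℝ) :
    backInt R (corridor c (σ' - σ)) y r φ =
      backInt R (corridor c σ') y r φ - backInt R (corridor c σ) y r φ := by
  have hd := continuous_dir
  have hi : ∀ {σ : Plane → Plane → ℝ}, IsAttenuation σ →
      IntervalIntegrable (fun τ => corridor c σ (y - τ • dir φ, φ)) volume r R := fun h =>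
    ((h.continuous_corridor c).comp (by fun_prop :
      Continuous fun τ : ℝ => (y - τ • dir φ, φ))).intervalIntegrable _ _
  rw [backInt, backInt, backInt, ← intervalIntegral.integral_sub (hi h') (hi h)]
  simp only [corridor_sub]

/-- The constant in the bound of the integrals of attenuations along lines. -/
def lineConst (n : ℕ) : ℝ :=
  (2 * radius n + 1) * (radius n + 1) * (box n).card

theorem lineConst_nonneg (n : ℕ) : 0 ≤ lineConst n := by
  have := radius_pos n
  unfold lineConst; positivity

section Decay

variable {n : ℕ} {σ σ' : Plane → Plane → ℝ} {m δ : ℝ} {c : Fin 2 → ℤ}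

theorem IsAttenuation.isSymbol_backInt (h : IsAttenuation σ) (hm : 0 ≤ m)
    (hσ : c2Norm σ ≤ ENNReal.ofReal m) (hc : c ∈ box n) (D : Set Plane) :
    IsSymbol D (radius n) (lineConst n * m) (backInt (radius n) (corridor c σ)) := by
  have hR := radius_pos n
  refine ((h.isField_corridor hm hσ).isSymbol_backInt hR.le D).mono Subset.rfl ?_
  rw [lineConst, mul_assoc _ ((box n).card : ℝ)]
  have := Nat.cast_le (α := ℝ).2 (card_uIcc_le hc)
  gcongr

/-- The bound of the exponential of a symbol with bound `b`, minus one. -/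
def expConst (b : ℝ) : ℝ := b * (1 + b) * Real.exp b

theorem IsAttenuation.isSymbol_exp (h : IsAttenuation σ) (hm : 0 ≤ m)
    (hσ : c2Norm σ ≤ ENNReal.ofReal m) (hc : c ∈ box n) (D : Set Plane) :
    IsSymbol D (radius n) (expConst (lineConst n * m) + 1)
      (fun y r φ => Real.exp (-backInt (radius n) (corridor c σ) y r φ)) := by
  have h1 := ((h.isSymbol_backInt hm hσ hc D).exp_neg_sub_one
    (mul_nonneg (lineConst_nonneg n) hm)).add (isSymbol_one)
  simpa only [sub_add_cancel, expConst] using h1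

/-- The exponentials of the integrals of nearby attenuations differ by a small symbol. -/
theorem IsAttenuation.isSymbol_exp_sub (h : IsAttenuation σ) (h' : IsAttenuation σ') (hm : 0 ≤ m)
    (hσ : c2Norm σ ≤ ENNReal.ofReal m) (hδ : 0 ≤ δ) (hσ' : c2Norm (σ' - σ) ≤ ENNReal.ofReal δ)
    (hc : c ∈ box n) (D : Set Plane) :
    IsSymbol D (radius n)
      (4 * (expConst (lineConst n * δ) * (expConst (lineConst n * m) + 1)))
      (fun y r φ => Real.exp (-backInt (radius n) (corridor c σ') y r φ) -
        Real.exp (-backInt (radius n) (corridor c σ) y r φ)) := by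
  have h1 := ((h.sub h').isSymbol_backInt hδ hσ' hc D).exp_neg_sub_one
    (mul_nonneg (lineConst_nonneg n) hδ)
  have h2 := h1.mul (h.isSymbol_exp hm hσ hc D)
  refine (congrArg _ ?_).mp h2
  funext y r φ
  rw [sub_mul, one_mul, ← Real.exp_add, backInt_corridor_sub h h']
  congr 2
  ring

end Decay

/-! ### Unfolding of broken rays -/

/-- The cell `c` lies in the direction `θ`, as seen from the square. -/
def Oriented (c : Fin 2 → ℤ) (θ : Plane) : Prop := ∀ i, c i = 0 ∨ 0 < (c i : ℝ) * θ i

/-- The number of walls between the square and the cell `c`. -/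
def depth (c : Fin 2 → ℤ) : ℕ := ∑ i, (c i).natAbs

/-- The unfolding of the `j`-th point of the broken ray of `(x, θ)`: the straight line enters the
cell `c` at the time `T`. -/
structure Trace (x θ : Plane) (j : ℕ) (c : Fin 2 → ℤ) (T : ℝ) : Prop where
  oriented : Oriented c θ
  depth_eq : depth c = j
  nonneg : 0 ≤ T
  billiard_eq : billiard^[j] (x, θ) = (fold c (x + T • θ), flip c θ)
  mem : ∀ i, (c i : ℝ) ≤ (x + T • θ) i ∧ (x + T • θ) i ≤ c i + 1
  up : ∀ i, 0 < θ i → (x + T • θ) i < c i + 1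
  down : ∀ i, θ i < 0 → (c i : ℝ) < (x + T • θ) i
  entry : ∃ i, (0 < θ i ∧ (x + T • θ) i = c i) ∨ (θ i < 0 ∧ (x + T • θ) i = c i + 1)

theorem fold_mem_closure_square {c : Fin 2 → ℤ} {y : Plane} :
    fold c y ∈ closure square ↔ ∀ i, (c i : ℝ) ≤ y i ∧ y i ≤ c i + 1 := by
  rw [mem_closure_square]
  refine forall_congr' fun i => ?_
  rw [fold_apply]
  split_ifs
  · constructor <;> rintro ⟨h1, h2⟩ <;> constructor <;> linarith
  · constructor <;> rintro ⟨h1, h2⟩ <;> constructor <;> linarith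

theorem fold_apply_eq_zero_or_one {c : Fin 2 → ℤ} {y : Plane} {i : Fin 2} :
    (fold c y i = 0 ∨ fold c y i = 1) ↔ (y i = c i ∨ y i = c i + 1) := by
  rw [fold_apply]
  split_ifs
  · constructor <;> rintro (h | h)
    · left; linarith
    · right; linarith
    · left; linarith
    · right; linarith
  · constructor <;> rintro (h | h)
    · right; linarith
    · left; linarith
    · right; linarith
    · left; linarith

/-- Folding is an isometry, so the exit time can be computed in the unfolded cell: after the time
`S` the coordinate `i` has passed its wall. -/
theorem exitTime_fold {c : Fin 2 → ℤ} {z θ : Plane} {S : ℝ} (hS : 0 ≤ S)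
    (h : ∀ i, (c i : ℝ) ≤ (z + S • θ) i ∧ (z + S • θ) i ≤ c i + 1) {i : Fin 2}
    (hi : (0 < θ i ∧ (z + S • θ) i = c i + 1) ∨ (θ i < 0 ∧ (z + S • θ) i = c i)) :
    exitTime (fold c z) (flip c θ) = S := by
  refine IsGreatest.csSup_eq ⟨⟨hS, ?_⟩, ?_⟩
  · rw [← fold_add_smul, fold_mem_closure_square]; exact h
  · rintro t ⟨-, ht⟩
    rw [← fold_add_smul, fold_mem_closure_square] at ht
    obtain ⟨h1, h2⟩ := ht i
    simp only [PiLp.add_apply, PiLp.smul_apply, smul_eq_mul] at hi h1 h2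
    by_contra! hlt
    rcases hi with ⟨h3, h4⟩ | ⟨h3, h4⟩ <;> nlinarith

theorem billiard_snd_apply (p : Plane × Plane) (i : Fin 2) : (billiard p).2 i =
    if (billiard p).1 i = 0 ∨ (billiard p).1 i = 1 then -p.2 i else p.2 i := by
  fin_cases i <;> rfl

theorem billiard_fst (p : Plane × Plane) :
    (billiard p).1 = p.1 + exitTime p.1 p.2 • p.2 := rfl

theorem trace_zero {E : Set Plane} {x θ : Plane} (h : (x, θ) ∈ inflow E) : Trace x θ 0 0 0 := by
  obtain ⟨h1, i, hi⟩ := mem_frontier_square.1 h.1.2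
  refine ⟨fun i => Or.inl rfl, by simp [depth], le_rfl, ?_, ?_, ?_, ?_, i, ?_⟩
  · simp [fold_zero_cell, flip_zero_cell]
  · intro i; simpa using h1 i
  · intro i hi
    have : x i ≠ 1 := fun h0 => (neg_of_mem_inflow h h0).not_gt hi
    simpa using lt_of_le_of_ne (h1 i).2 this
  · intro i hi
    have : x i ≠ 0 := fun h0 => (pos_of_mem_inflow h h0).not_gt hi
    simpa using lt_of_le_of_ne (h1 i).1 this.symm
  · rcases hi with hi | hi
    · exact Or.inl ⟨pos_of_mem_inflow h hi, by simpa using hi⟩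
    · exact Or.inr ⟨neg_of_mem_inflow h hi, by simpa using hi⟩

theorem Generic.ne_zero {x θ : Plane} (h : Generic x θ) (i : Fin 2) : θ i ≠ 0 := by
  fin_cases i
  · exact h.1
  · exact h.2.1

/-- The points of a generic line do not have two integral coordinates. -/
theorem Generic.not_integral {x θ : Plane} (h : Generic x θ) (t : ℝ)
    (hi : ∀ i, ∃ a : ℤ, (x + t • θ) i = a) : False := by
  obtain ⟨a, ha⟩ := hi 0
  obtain ⟨b, hb⟩ := hi 1
  exact ((generic_add_smul t).2 h).2.2 a b (by rw [ha, hb]; simp)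

/-- The neighbour of the cell `c` across the wall which is met in the direction `θ`. -/
def nextCell (c : Fin 2 → ℤ) (θ : Plane) (i : Fin 2) : Fin 2 → ℤ :=
  Function.update c i (c i + if 0 < θ i then 1 else -1)

theorem depth_nextCell {c : Fin 2 → ℤ} {θ : Plane} {i : Fin 2} (h : Oriented c θ)
    (hi : θ i ≠ 0) : depth (nextCell c θ i) = depth c + 1 := by
  have h1 : (nextCell c θ i i).natAbs = (c i).natAbs + 1 := by
    rw [nextCell, Function.update_self]
    split_ifs with hp
    · have : 0 ≤ c i := by
        rcases h i with h0 | h0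
        · exact h0.ge
        · exact_mod_cast (pos_of_mul_pos_left h0 hp.le).le
      omega
    · have hn : θ i < 0 := lt_of_le_of_ne (not_lt.1 hp) hi
      have : c i ≤ 0 := by
        rcases h i with h0 | h0
        · exact h0.le
        · have : (c i : ℝ) < 0 := by
            by_contra hc
            nlinarith
          exact_mod_cast this.le
      omega
  have h2 : ∀ k, k ≠ i → nextCell c θ i k = c k := fun k hk => Function.update_of_ne hk _ _
  simp only [depth]
  rw [Fin.sum_univ_two, Fin.sum_univ_two]
  fin_cases i
  · have := h2 1 (by decide)
    simp only [Fin.zero_eta] at *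
    rw [h1, this]; ring
  · have := h2 0 (by decide)
    simp only [Fin.mk_one] at *
    rw [h1, this]; ring

theorem Oriented.nextCell {c : Fin 2 → ℤ} {θ : Plane} {i : Fin 2} (h : Oriented c θ)
    (hi : θ i ≠ 0) : Oriented (nextCell c θ i) θ := by
  intro k
  by_cases hk : k = i
  · subst hk
    right
    rw [BrokenRay.nextCell, Function.update_self]
    push_cast
    split_ifs with hp
    · rcases h k with h0 | h0
      · rw [h0]; simpa using hp
      · linarith
    · have hn : θ k < 0 := lt_of_le_of_ne (not_lt.1 hp) hi
      rcases h k with h0 | h0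
      · rw [h0]; simpa using hn
      · linarith
  · rw [BrokenRay.nextCell, Function.update_of_ne hk]
    exact h k

/-- The wall reached first is unique, since a generic line avoids lattice points. Reflecting there
changes the folding map from that of `c` to that of the neighbouring cell, while the unfolded line
continues straight. -/
theorem Trace.step {x θ : Plane} (hg : Generic x θ) {j : ℕ} {c : Fin 2 → ℤ} {T : ℝ}
    (h : Trace x θ j c T) : ∃ c' T', Trace x θ (j + 1) c' T' := by
  set z := x + T • θ with hz
  -- For each coordinate, the time to the wall ahead. It is positive because `up` and `down` exclude
  -- that the point already lies on that wall.
  have hs : ∀ i, ∃ s : ℝ, 0 < s ∧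
      ((0 < θ i ∧ z i + s * θ i = c i + 1) ∨ (θ i < 0 ∧ z i + s * θ i = c i)) := by
    intro i
    rcases lt_or_gt_of_ne (hg.ne_zero i) with hi | hi
    · refine ⟨(c i - z i) / θ i, div_pos_of_neg_of_neg (by linarith [h.down i hi]) hi,
        Or.inr ⟨hi, ?_⟩⟩
      rw [div_mul_cancel₀ _ hi.ne]; ring
    · refine ⟨(c i + 1 - z i) / θ i, div_pos (by linarith [h.up i hi]) hi, Or.inl ⟨hi, ?_⟩⟩
      rw [div_mul_cancel₀ _ hi.ne']; ring
  choose s hs0 hs using hs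
  obtain ⟨i, hi⟩ := Finite.exists_min s
  set S := s i with hSdef
  have hint : ∀ k, s k = S → ∃ a : ℤ, (x + (T + S) • θ) k = a := by
    intro k hk
    have e : (x + (T + S) • θ) k = z k + s k * θ k := by
      rw [hk, hz]
      simp only [PiLp.add_apply, PiLp.smul_apply, smul_eq_mul]
      ring
    rcases hs k with ⟨-, h2⟩ | ⟨-, h2⟩
    · exact ⟨c k + 1, by rw [e, h2]; push_cast; ring⟩
    · exact ⟨c k, by rw [e, h2]⟩
  -- Equality would put both coordinates at integers at the same time.
  have hlt : ∀ k, k ≠ i → S < s k := by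
    intro k hk
    refine lt_of_le_of_ne (hi k) fun he => ?_
    refine hg.not_integral (T + S) fun l => hint l ?_
    by_cases hl : l = i
    · rw [hl]
    · rw [show l = k by omega, ← he]
  have hxz : x + (T + S) • θ = z + S • θ := by rw [hz, add_smul, add_assoc]
  have hy : ∀ k, (z + S • θ) k = z k + S * θ k := fun k => by simp
  -- inside the cell for the other coordinate
  have hin : ∀ k, k ≠ i → (c k : ℝ) < (z + S • θ) k ∧ (z + S • θ) k < c k + 1 := by
    intro k hk
    have h1 := hlt k hk
    have h2 := h.mem k
    have h3 := hs0 i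
    rw [hy]
    rcases hs k with ⟨h4, h5⟩ | ⟨h4, h5⟩
    · constructor
      · nlinarith [mul_pos h3 h4]
      · nlinarith
    · constructor
      · nlinarith
      · nlinarith [mul_pos_of_neg_of_neg (neg_neg_of_pos h3) h4]
  have hi' : (0 < θ i ∧ (z + S • θ) i = c i + 1) ∨ (θ i < 0 ∧ (z + S • θ) i = c i) := by
    rw [hy]; exact hs i
  have hmem : ∀ k, (c k : ℝ) ≤ (z + S • θ) k ∧ (z + S • θ) k ≤ c k + 1 := by
    intro k
    by_cases hk : k = i
    · subst hk
      rcases hi' with ⟨-, h2⟩ | ⟨-, h2⟩ <;> rw [h2] <;> constructor <;> linarith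
    · exact ⟨(hin k hk).1.le, (hin k hk).2.le⟩
  have hexit : exitTime (fold c z) (flip c θ) = S := exitTime_fold (hs0 i).le hmem hi'
  have hne := hg.ne_zero i
  have hcell_ne : ∀ k, k ≠ i → nextCell c θ i k = c k := fun k hk => Function.update_of_ne hk _ _
  have hcell : ((0 < θ i ∧ nextCell c θ i i = c i + 1) ∨ (θ i < 0 ∧ nextCell c θ i i = c i - 1)) := by
    rw [nextCell, Function.update_self]
    rcases hi' with ⟨h1, -⟩ | ⟨h1, -⟩
    · left; rw [if_pos h1]; exact ⟨h1, rfl⟩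
    · right; rw [if_neg h1.not_gt]; exact ⟨h1, rfl⟩
  -- The folding maps of two adjacent cells agree on their common wall.
  have hfst : fold c z + S • flip c θ = fold (nextCell c θ i) (z + S • θ) := by
    rw [← fold_add_smul]
    ext k
    rw [fold_apply, fold_apply]
    by_cases hk : k = i
    · subst hk
      rcases hcell with ⟨h1, h2⟩ | ⟨h1, h2⟩
      · have h3 : (z + S • θ) k = c k + 1 := by
          rcases hi' with h | h
          · exact h.2
          · linarith [h.1]
        rw [h2, h3]
        simp only [Int.even_add_one]
        push_cast
        split_ifs <;> ring
      · have h3 : (z + S • θ) k = c k := by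
          rcases hi' with h | h
          · linarith [h.1]
          · exact h.2
        rw [h2, h3]
        simp only [Int.even_sub_one]
        push_cast
        split_ifs <;> ring
    · rw [hcell_ne k hk]
  refine ⟨nextCell c θ i, T + S, h.oriented.nextCell hne, ?_, add_nonneg h.nonneg (hs0 i).le, ?_,
    ?_, ?_, ?_, i, ?_⟩
  · rw [depth_nextCell h.oriented hne, h.depth_eq]
  · rw [Function.iterate_succ_apply', h.billiard_eq]
    have e1 : (billiard (fold c z, flip c θ)).1 = fold c (z + S • θ) := by
      rw [billiard_fst, hexit, ← fold_add_smul]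
    refine Prod.ext ?_ ?_
    · rw [billiard_fst, hexit, hfst, hxz]
    · ext k
      rw [billiard_snd_apply, e1]
      simp only [fold_apply_eq_zero_or_one, flip_apply]
      by_cases hk : k = i
      · subst hk
        rw [if_pos (by rcases hi' with h | h; exacts [Or.inr h.2, Or.inl h.2])]
        unfold paritySign
        rcases hcell with ⟨-, h2⟩ | ⟨-, h2⟩ <;> rw [h2]
        · simp only [Int.even_add_one]
          split_ifs <;> ring
        · simp only [Int.even_sub_one]
          split_ifs <;> ring
      · rw [if_neg, hcell_ne k hk]
        rintro (h0 | h0)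
        · linarith [(hin k hk).1]
        · linarith [(hin k hk).2]
  · intro k
    rw [hxz]
    by_cases hk : k = i
    · subst hk
      rcases hcell with ⟨h1, h2⟩ | ⟨h1, h2⟩ <;> rcases hi' with h | h
      · rw [h2, h.2]; push_cast; constructor <;> linarith
      · linarith [h.1]
      · linarith [h.1]
      · rw [h2, h.2]; push_cast; constructor <;> linarith
    · rw [hcell_ne k hk]; exact hmem k
  · intro k hk0
    rw [hxz]
    by_cases hk : k = i
    · subst hk
      rcases hcell with ⟨h1, h2⟩ | ⟨h1, h2⟩ <;> rcases hi' with h | h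
      · rw [h2, h.2]; push_cast; linarith
      · linarith [h.1]
      · linarith [h.1]
      · linarith
    · rw [hcell_ne k hk]; exact (hin k hk).2
  · intro k hk0
    rw [hxz]
    by_cases hk : k = i
    · subst hk
      rcases hcell with ⟨h1, h2⟩ | ⟨h1, h2⟩ <;> rcases hi' with h | h
      · linarith
      · linarith [h.1]
      · linarith [h.1]
      · rw [h2, h.2]; push_cast; linarith
    · rw [hcell_ne k hk]; exact (hin k hk).1
  · rw [hxz]
    rcases hcell with ⟨h1, h2⟩ | ⟨h1, h2⟩ <;> rcases hi' with h | h
    · left; rw [h2, h.2]; push_cast; exact ⟨h1, rfl⟩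
    · linarith [h.1]
    · linarith [h.1]
    · right; rw [h2, h.2]; push_cast; exact ⟨h1, by ring⟩

theorem exists_trace {E : Set Plane} {x θ : Plane} (h : (x, θ) ∈ inflow E) (hg : Generic x θ)
    (j : ℕ) : ∃ c T, Trace x θ j c T := by
  induction j with
  | zero => exact ⟨0, 0, trace_zero h⟩
  | succ j ih =>
    obtain ⟨c, T, hT⟩ := ih
    exact hT.step hg

/-! ### The order in which a line meets the cells -/

section TraceFacts

variable {x θ : Plane} {j k : ℕ} {c c' : Fin 2 → ℤ} {T u u' : ℝ}

theorem Trace.not_isCorner (h : Trace x θ j c T) (hg : Generic x θ) :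
    ¬ IsCorner (billiard^[j] (x, θ)).1 := by
  rw [h.billiard_eq]
  intro hc
  refine hg.not_integral T fun i => ?_
  rcases fold_apply_eq_zero_or_one.1 (hc i) with h1 | h1
  · exact ⟨c i, h1⟩
  · exact ⟨c i + 1, by rw [h1]; push_cast; ring⟩

/-- Just after the entry time the line is in the open cell: on every wall containing the entry point
it points inwards. -/
theorem Trace.exists_mem_cell (h : Trace x θ j c T) (hg : Generic x θ) :
    ∃ u : ℝ, x + u • θ ∈ cell c := by
  suffices H : ∀ i, (0 < fold c (x + T • θ) i ∧ fold c (x + T • θ) i < 1) ∨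
      (fold c (x + T • θ) i = 0 ∧ 0 < flip c θ i) ∨
      (fold c (x + T • θ) i = 1 ∧ flip c θ i < 0) by
    obtain ⟨t, -, ht⟩ := exists_add_smul_mem_square H
    refine ⟨T + t, ?_⟩
    rwa [← fold_add_smul, fold_mem_square, add_assoc, ← add_smul] at ht
  · intro i
    have h1 := h.mem i
    rw [fold_apply, flip_apply]
    unfold paritySign
    rcases lt_or_gt_of_ne (hg.ne_zero i) with hi | hi
    · have h2 := h.down i hi
      rcases h1.2.lt_or_eq with h3 | h3
      · left; split_ifs <;> constructor <;> linarith
      · right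
        split_ifs
        · right; constructor <;> linarith
        · left; constructor <;> linarith
    · have h2 := h.up i hi
      rcases h1.1.lt_or_eq with h3 | h3
      · left; split_ifs <;> constructor <;> linarith
      · right
        split_ifs
        · left; constructor <;> linarith
        · right; constructor <;> linarith

theorem Trace.lt_of_mem_cell (h : Trace x θ j c T) (hu : x + u • θ ∈ cell c) : T < u := by
  obtain ⟨i, hi⟩ := h.entry
  have h1 := hu i
  simp only [PiLp.add_apply, PiLp.smul_apply, smul_eq_mul] at hi h1
  by_contra! hlt
  rcases hi with ⟨h2, h3⟩ | ⟨h2, h3⟩ <;> nlinarith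

/-- Each coordinate is monotone along the line, and an oriented cell index has the sign of the
direction, so its absolute value can only grow with time. -/
theorem natAbs_le_of_mem_cell (hc : Oriented c θ) (hu : x + u • θ ∈ cell c)
    (hu' : x + u' • θ ∈ cell c') (h : u ≤ u') (i : Fin 2) :
    (c i).natAbs ≤ (c' i).natAbs ∧ c i ∈ Finset.uIcc 0 (c' i) := by
  have h1 := hu i
  have h2 := hu' i
  simp only [PiLp.add_apply, PiLp.smul_apply, smul_eq_mul] at h1 h2
  rw [Finset.mem_uIcc]
  rcases lt_trichotomy (θ i) 0 with hi | hi | hi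
  · have h3 : (c' i : ℝ) < c i + 1 := by nlinarith
    rw [← Int.cast_one, ← Int.cast_add, Int.cast_lt] at h3
    have h4 : c i ≤ 0 := by
      rcases hc i with h0 | h0
      · exact h0.le
      · have : (c i : ℝ) < 0 := by
          by_contra hc
          nlinarith
        exact_mod_cast this.le
    constructor
    · omega
    · constructor <;> [exact inf_le_of_right_le (by omega); exact le_sup_of_le_left h4]
  · have h3 : c i = 0 := (hc i).resolve_right (by simp [hi])
    rw [h3]
    simp
  · have h3 : (c i : ℝ) < c' i + 1 := by nlinarith
    rw [← Int.cast_one, ← Int.cast_add, Int.cast_lt] at h3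
    have h4 : 0 ≤ c i := by
      rcases hc i with h0 | h0
      · exact h0.ge
      · exact_mod_cast (pos_of_mul_pos_left h0 hi.le).le
    constructor
    · omega
    · constructor <;> [exact inf_le_of_left_le h4; exact le_sup_of_le_right (by omega)]

theorem depth_le_of_mem_cell (hc : Oriented c θ) (hu : x + u • θ ∈ cell c)
    (hu' : x + u' • θ ∈ cell c') (h : u ≤ u') : depth c ≤ depth c' :=
  Finset.sum_le_sum fun i _ => (natAbs_le_of_mem_cell hc hu hu' h i).1

theorem lt_of_depth_lt (hc' : Oriented c' θ) (hu : x + u • θ ∈ cell c)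
    (hu' : x + u' • θ ∈ cell c') (h : depth c < depth c') : u < u' := by
  by_contra! hle
  exact (depth_le_of_mem_cell hc' hu' hu hle).not_gt h

theorem eq_of_depth_eq_of_le (hc : Oriented c θ) (hu : x + u • θ ∈ cell c)
    (hu' : x + u' • θ ∈ cell c') (h : depth c = depth c') (hle : u ≤ u') : c = c' := by
  have h1 := fun i => natAbs_le_of_mem_cell hc hu hu' hle i
  have h2 := (Finset.sum_eq_sum_iff_of_le fun i _ => (h1 i).1).1 h
  funext i
  have h3 := h2 i (Finset.mem_univ i)
  obtain ⟨h4, h5⟩ := Finset.mem_uIcc.1 (h1 i).2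
  simp only [inf_le_iff, le_sup_iff] at h4 h5
  omega

/-- A line meets at most one oriented cell of given depth. -/
theorem eq_of_depth_eq (hc : Oriented c θ) (hc' : Oriented c' θ) (hu : x + u • θ ∈ cell c)
    (hu' : x + u' • θ ∈ cell c') (h : depth c = depth c') : c = c' := by
  rcases le_total u u' with hle | hle
  · exact eq_of_depth_eq_of_le hc hu hu' h hle
  · exact (eq_of_depth_eq_of_le hc' hu' hu h.symm hle).symm

theorem mem_uIcc_of_depth_le (hc : Oriented c θ) (hc' : Oriented c' θ) (hu : x + u • θ ∈ cell c)
    (hu' : x + u' • θ ∈ cell c') (h : depth c ≤ depth c') : c ∈ Finset.uIcc 0 c' := by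
  rcases h.eq_or_lt with h | h
  · rw [eq_of_depth_eq hc hc' hu hu' h]
    exact Finset.right_mem_uIcc
  · have h1 := natAbs_le_of_mem_cell hc hu hu' (lt_of_depth_lt hc' hu hu' h).le
    rw [Finset.mem_uIcc]
    exact ⟨fun i => (Finset.mem_uIcc.1 (h1 i).2).1, fun i => (Finset.mem_uIcc.1 (h1 i).2).2⟩

theorem natAbs_le_depth (c : Fin 2 → ℤ) (i : Fin 2) : (c i).natAbs ≤ depth c :=
  Finset.single_le_sum (f := fun i => (c i).natAbs) (fun _ _ => Nat.zero_le _) (Finset.mem_univ i)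

theorem mem_box_of_depth_le {n : ℕ} (h : depth c ≤ n) : c ∈ box n := by
  rw [mem_box]
  intro i
  have := natAbs_le_depth c i
  rw [Int.abs_eq_natAbs]
  exact_mod_cast this.trans h

theorem Oriented.of_mem_uIcc (hc : Oriented c θ) (h : c' ∈ Finset.uIcc 0 c) : Oriented c' θ := by
  intro i
  have h1 := (Finset.mem_uIcc.1 h).1 i
  have h2 := (Finset.mem_uIcc.1 h).2 i
  simp only [Pi.inf_apply, Pi.sup_apply, Pi.zero_apply, inf_le_iff, le_sup_iff] at h1 h2
  by_cases h0 : c' i = 0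
  · exact Or.inl h0
  right
  rcases hc i with h3 | h3
  · omega
  · rcases lt_or_ge 0 (c i) with h4 | h4
    · have h5 : 0 < θ i := pos_of_mul_pos_right h3 (Int.cast_nonneg h4.le)
      have h6 : 0 < c' i := by omega
      exact mul_pos (by exact_mod_cast h6) h5
    · have h4' : (c i : ℝ) ≤ 0 := by exact_mod_cast h4
      have h5 : θ i < 0 := by
        by_contra hc
        nlinarith
      have h6 : c' i < 0 := by omega
      exact mul_pos_of_neg_of_neg (by exact_mod_cast h6) h5

theorem depth_le_of_mem_uIcc (h : c' ∈ Finset.uIcc 0 c) : depth c' ≤ depth c := by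
  refine Finset.sum_le_sum fun i _ => ?_
  have h1 := (Finset.mem_uIcc.1 h).1 i
  have h2 := (Finset.mem_uIcc.1 h).2 i
  simp only [Pi.inf_apply, Pi.sup_apply, Pi.zero_apply, inf_le_iff, le_sup_iff] at h1 h2
  omega

end TraceFacts

/-! ### Functions which are constant along lines -/

/-- A `C²` function on phase space which is constant along lines and vanishes on the lines which
do not meet the square. -/
structure IsLineFunction (a : Plane → Plane → ℝ) : Prop where
  contDiff : ContDiff ℝ 2 (angular a)
  const : ∀ (y : Plane) (φ t : ℝ), angular a (y + t • dir φ, φ) = angular a (y, φ)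
  hits : ∀ y φ, angular a (y, φ) ≠ 0 → ∃ t : ℝ, y + t • dir φ ∈ square

theorem IsLineFunction.sub {a a' : Plane → Plane → ℝ} (h : IsLineFunction a)
    (h' : IsLineFunction a') : IsLineFunction (a' - a) := by
  have e : ∀ q, angular (a' - a) q = angular a' q - angular a q := fun _ => rfl
  refine ⟨h'.contDiff.sub h.contDiff, fun y φ t => by rw [e, e, h.const, h'.const],
    fun y φ hne => ?_⟩
  by_cases h0 : angular a (y, φ) = 0
  · exact h'.hits y φ fun h1 => hne (by rw [e, h0, h1, sub_zero])
  · exact h.hits y φ h0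

theorem hasDerivAt_angle {g : Plane × ℝ → ℝ} (hg : ContDiff ℝ 1 g) (y : Plane) (φ : ℝ) :
    HasDerivAt (fun φ => g (y, φ)) (lineDeriv g y 0 φ) φ := by
  simpa using hasDerivAt_line hg y 0 φ

theorem continuous_angleDeriv {g : Plane × ℝ → ℝ} (hg : ContDiff ℝ 1 g) :
    Continuous fun q : Plane × ℝ => lineDeriv g q.1 0 q.2 :=
  (continuous_lineDeriv hg).comp (by fun_prop : Continuous fun q : Plane × ℝ => (q.1, (0 : ℝ), q.2))

theorem norm_le_two_of_mem_square {x : Plane} (hx : x ∈ square) : ‖x‖ ≤ 2 := by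
  have := norm_le_of_abs_le (y := x) zero_le_one fun i =>
    abs_le.2 ⟨by linarith [(hx i).1], (hx i).2.le⟩
  linarith

section LineFunction

variable {a : Plane → Plane → ℝ} {m : ℝ}

theorem IsLineFunction.abs_le (h : IsLineFunction a) (hm : 0 ≤ m)
    (ha : c2Norm a ≤ ENNReal.ofReal m) (y : Plane) (φ : ℝ) : |angular a (y, φ)| ≤ m := by
  by_cases h0 : angular a (y, φ) = 0
  · rw [h0, abs_zero]; exact hm
  · obtain ⟨t, ht⟩ := h.hits y φ h0
    rw [← h.const y φ t]
    exact abs_angular_le ha hm ht φ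

/-- The norm controls the function only over the square, but constancy along lines moves any point
there. Varying the angle about the distant base point adds the displacement along the line to the
derivative, whence the factor `‖y‖ + 3`. -/
theorem IsLineFunction.abs_deriv_le (h : IsLineFunction a) (hm : 0 ≤ m)
    (ha : c2Norm a ≤ ENNReal.ofReal m) (y : Plane) (φ : ℝ) :
    |lineDeriv (angular a) y 0 φ| ≤ m * (‖y‖ + 3) := by
  have h1 : ContDiff ℝ 1 (angular a) := h.contDiff.of_le (by norm_num)
  set H := {φ : ℝ | ∃ t : ℝ, y + t • dir φ ∈ square} with hH
  have hin : ∀ φ ∈ H, |lineDeriv (angular a) y 0 φ| ≤ m * (‖y‖ + 3) := by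
    rintro φ ⟨t, ht⟩
    -- The time `t` is held fixed while the angle varies; constancy on every nearby line shows that
    -- the two functions of the angle coincide.
    have e1 : lineDeriv (angular a) y 0 φ = lineDeriv (angular a) y (-t) φ := by
      refine (hasDerivAt_angle h1 y φ).unique ((hasDerivAt_line h1 y (-t) φ).congr_of_eventuallyEq
        (Filter.Eventually.of_forall fun φ' => ?_))
      simp only [neg_smul, sub_neg_eq_add]
      rw [h.const]
    rw [e1, lineDeriv, neg_smul, neg_smul, sub_neg_eq_add, neg_neg]
    refine ((fderiv ℝ (angular a) (y + t • dir φ, φ)).le_opNorm _).trans ?_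
    refine mul_le_mul (norm_fderiv_angular_le ha hm ht φ) ?_ (norm_nonneg _) hm
    rw [Prod.norm_mk, norm_smul, norm_dirPerp, mul_one, norm_one]
    have h2 : ‖t • dir φ‖ ≤ 2 + ‖y‖ := by
      rw [show t • dir φ = (y + t • dir φ) - y by abel]
      exact (norm_sub_le _ _).trans (add_le_add (norm_le_two_of_mem_square ht) le_rfl)
    rw [norm_smul, norm_dir, mul_one] at h2
    exact max_le (by linarith) (by linarith [norm_nonneg y])
  by_cases hφ : φ ∈ closure H
  · have hc : IsClosed {φ : ℝ | |lineDeriv (angular a) y 0 φ| ≤ m * (‖y‖ + 3)} :=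
      isClosed_le ((continuous_angleDeriv h1).comp
        (by fun_prop : Continuous fun φ : ℝ => (y, φ))).abs continuous_const
    exact closure_minimal hin hc hφ
  · have e : (fun φ => angular a (y, φ)) =ᶠ[𝓝 φ] fun _ => 0 := by
      filter_upwards [isClosed_closure.isOpen_compl.mem_nhds hφ] with φ' hφ'
      by_contra hne
      exact hφ' (subset_closure (h.hits y φ' hne))
    rw [(hasDerivAt_angle h1 y φ).unique ((hasDerivAt_const φ (0 : ℝ)).congr_of_eventuallyEq e),
      abs_zero]
    positivity

end LineFunction

/-- If `b` takes only the values `0` and `a`, then it is dominated by `a` with its derivative. -/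
theorem abs_le_of_dense {b a b' a' : ℝ → ℝ} (hb : ∀ φ, HasDerivAt b (b' φ) φ)
    (ha : ∀ φ, HasDerivAt a (a' φ) φ) {S : Set ℝ} (hS : Dense S)
    (h : ∀ φ ∈ S, b φ = 0 ∨ b φ = a φ) (φ : ℝ) : |b φ| ≤ |a φ| ∧ |b' φ| ≤ |a' φ| := by
  have hbc : Continuous b := continuous_iff_continuousAt.2 fun φ => (hb φ).continuousAt
  have hac : Continuous a := continuous_iff_continuousAt.2 fun φ => (ha φ).continuousAt
  have h1 : ∀ φ, b φ = 0 ∨ b φ = a φ := by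
    intro φ
    have hc : IsClosed {φ | b φ * (b φ - a φ) = 0} :=
      isClosed_eq (hbc.mul (hbc.sub hac)) continuous_const
    have h2 : S ⊆ {φ | b φ * (b φ - a φ) = 0} := fun φ hφ => by
      rw [mem_ofPred_eq, mul_eq_zero, sub_eq_zero]
      exact h φ hφ
    have h3 : φ ∈ {φ | b φ * (b φ - a φ) = 0} := closure_minimal h2 hc (hS φ)
    rwa [mem_ofPred_eq, mul_eq_zero, sub_eq_zero] at h3
  have h2 : ∀ φ, |b φ| ≤ |a φ| := by
    intro φ
    rcases h1 φ with h0 | h0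
    · rw [h0, abs_zero]; exact abs_nonneg _
    · rw [h0]
  refine ⟨h2 φ, ?_⟩
  by_cases h0 : b φ = 0
  · by_cases ha0 : a φ = 0
    · have e : ∀ t, |slope b φ t| ≤ |slope a φ t| := by
        intro t
        rw [slope_def_field, slope_def_field, h0, ha0, sub_zero, sub_zero, abs_div, abs_div]
        exact div_le_div_of_nonneg_right (h2 t) (abs_nonneg _)
      exact le_of_tendsto_of_tendsto (hasDerivAt_iff_tendsto_slope.1 (hb φ)).abs
        (hasDerivAt_iff_tendsto_slope.1 (ha φ)).abs (Filter.Eventually.of_forall e)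
    · have e : b =ᶠ[𝓝 φ] fun _ => 0 := by
        have : b φ ≠ a φ := by rw [h0]; exact Ne.symm ha0
        filter_upwards [(isOpen_ne_fun hbc hac).mem_nhds this] with t ht
        exact (h1 t).resolve_right ht
      rw [(hb φ).unique ((hasDerivAt_const φ (0 : ℝ)).congr_of_eventuallyEq e), abs_zero]
      exact abs_nonneg _
  · have e : b =ᶠ[𝓝 φ] a := by
      filter_upwards [(isOpen_ne_fun hbc continuous_const).mem_nhds h0] with t ht
      exact (h1 t).resolve_left ht
    rw [(hb φ).unique ((ha φ).congr_of_eventuallyEq e)]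

/-! ### Generic directions -/

/-- The equation says `sin (φ - arctan w) = 0`. -/
theorem countable_sin_eq_mul_cos (w : ℝ) : {φ : ℝ | Real.sin φ = w * Real.cos φ}.Countable := by
  refine (countable_range fun n : ℤ => (n : ℝ) * Real.pi + Real.arctan w).mono fun φ hφ => ?_
  have hc := Real.cos_arctan_pos w
  have h1 : Real.sin (φ - Real.arctan w) = 0 := by
    have h2 : Real.sin (Real.arctan w) = w * Real.cos (Real.arctan w) := by
      rw [← Real.tan_mul_cos hc.ne', Real.tan_arctan]
    rw [Real.sin_sub, h2, hφ]
    ring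
  obtain ⟨n, hn⟩ := Real.sin_eq_zero_iff.1 h1
  exact ⟨n, by simp only; linarith⟩

theorem countable_cos_eq_zero : {φ : ℝ | Real.cos φ = 0}.Countable := by
  refine (countable_range fun n : ℤ => (2 * n + 1) * Real.pi / 2).mono fun φ hφ => ?_
  obtain ⟨n, hn⟩ := Real.cos_eq_zero_iff.1 hφ
  exact ⟨n, hn.symm⟩

/-- From a point without integral coordinates, only countably many directions point at a lattice
point or along an axis. -/
theorem dense_generic {n : ℕ} {y : Plane} (hy : y ∈ region n) :
    Dense {φ : ℝ | Generic y (dir φ)} := by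
  have h : {φ : ℝ | Generic y (dir φ)}ᶜ ⊆ {φ : ℝ | Real.cos φ = 0} ∪
      ({φ : ℝ | Real.sin φ = 0 * Real.cos φ} ∪ ⋃ a : ℤ, ⋃ b : ℤ,
        {φ : ℝ | Real.sin φ = (y 1 - b) / (y 0 - a) * Real.cos φ}) := by
    intro φ hφ
    by_contra hn
    simp only [mem_union, mem_iUnion, mem_ofPred_eq, not_or, not_exists, zero_mul] at hn
    refine hφ ⟨hn.1, hn.2.1, fun a b hab => hn.2.2 a b ?_⟩
    have h0 : y 0 - a ≠ 0 := sub_ne_zero.2 ((hy 0).2 a)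
    rw [dir_zero, dir_one] at hab
    field_simp
    linarith
  have hc := (countable_cos_eq_zero.union ((countable_sin_eq_mul_cos 0).union
    (countable_iUnion fun a : ℤ => countable_iUnion fun b : ℤ =>
      countable_sin_eq_mul_cos ((y 1 - b) / (y 0 - a))))).mono h
  simpa using hc.dense_compl ℝ

/-- A function which takes only the values `0` and `a` on generic lines is a symbol with a bound
given by `a`. -/
theorem IsLineFunction.isSymbol {n : ℕ} {a : Plane → Plane → ℝ} {m : ℝ} (h : IsLineFunction a)
    (hm : 0 ≤ m) (ha : c2Norm a ≤ ENNReal.ofReal m) {b : Plane × ℝ → ℝ} (hb : ContDiff ℝ 1 b)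
    (hper : ∀ y φ, b (y, φ + 2 * Real.pi) = b (y, φ))
    (hba : ∀ y ∈ region n, ∀ φ, Generic y (dir φ) → b (y, φ) = 0 ∨ b (y, φ) = angular a (y, φ)) :
    IsSymbol (region n) (radius n) (m * (radius n + 3)) fun y _ φ => b (y, φ) := by
  have hR := radius_pos n
  have h1 : ContDiff ℝ 1 (angular a) := h.contDiff.of_le (by norm_num)
  have hd : ∀ y ∈ region n, ∀ φ, |b (y, φ)| ≤ |angular a (y, φ)| ∧
      |lineDeriv b y 0 φ| ≤ |lineDeriv (angular a) y 0 φ| := fun y hy φ =>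
    abs_le_of_dense (hasDerivAt_angle hb y) (hasDerivAt_angle h1 y) (dense_generic hy)
      (fun φ hφ => hba y hy φ hφ) φ
  have hc : Continuous fun q : Plane × ℝ × ℝ => (q.1, q.2.2) := by fun_prop
  have hB : 0 ≤ m * (radius n + 3) := by positivity
  refine ⟨fun y _ φ => lineDeriv b y 0 φ, fun _ _ _ => 0, fun _ _ _ => 0,
    hb.continuous.comp hc, (continuous_angleDeriv hb).comp hc, by fun_prop, by fun_prop,
    fun y _ φ => hasDerivAt_angle hb y φ, fun y r φ => hasDerivAt_const _ _,
    fun y r φ => hasDerivAt_const _ _, ?_, ?_, ?_, ?_, fun y _ φ => hper y φ⟩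
  · intro y hy r φ _
    refine ((hd y hy φ).1.trans (h.abs_le hm ha y φ)).trans ?_
    nlinarith
  · intro y hy r φ _
    refine ((hd y hy φ).2.trans (h.abs_deriv_le hm ha y φ)).trans ?_
    have := norm_lt_of_mem_region hy
    gcongr
    linarith
  · intros; simpa using hB
  · intros; simpa using hB

/-! ### Cutoffs and the number of reflections -/

/-- `β j` is the part of the cutoff `α` on the broken rays with at least `j` reflections. -/
structure IsLevels (E : Set Plane) (Nmax : ℕ) (α : Plane → Plane → ℝ) (β : ℕ → Plane × ℝ → ℝ) :
    Prop where
  contDiff : ∀ j, ContDiff ℝ 2 (β j)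
  const : ∀ (j : ℕ) (y : Plane) (φ t : ℝ), β j (y + t • dir φ, φ) = β j (y, φ)
  periodic : ∀ j y φ, β j (y, φ + 2 * Real.pi) = β j (y, φ)
  support : ∀ j q, β j q ≠ 0 → ∃ t : ℝ, (q.1 + t • dir q.2, dir q.2) ∈ inflow E
  eq_ite : ∀ j x φ, (x, dir φ) ∈ inflow E → Generic x (dir φ) →
    β j (x, φ) = if j ≤ reflections E (x, dir φ) then angular α (x, φ) else 0
  eq_zero : ∀ j q, Nmax < j → β j q = 0
  zero_eq : β 0 = angular α

/-- `β j` is the sum of the beam cutoffs with reflection number at least `j`. This is as smooth as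
the beams, although the number of reflections itself is discontinuous. -/
theorem IsCutoff.exists_levels {E : Set Plane} {Nmax : ℕ} {α : Plane → Plane → ℝ}
    (h : IsCutoff E Nmax α) : ∃ β, IsLevels E Nmax α β := by
  obtain ⟨n, a, ha, rfl⟩ := h
  choose N hN hNeq using fun k => (ha k).constant
  have hsum : ∀ q, angular (∑ k, a k) q = ∑ k, angular (a k) q := fun q => by
    simp only [angular, Finset.sum_apply]
  refine ⟨fun j q => ∑ k with j ≤ N k, angular (a k) q, fun j => ContDiff.sum fun k _ =>
    (ha k).contDiff, fun j y φ t => Finset.sum_congr rfl fun k _ =>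
    (ha k).const_on_lines y (dir φ) t (norm_dir φ), ?_, ?_, ?_, ?_, ?_⟩
  · intro j y φ
    simp only [angular, dir_add_two_pi]
  · intro j q hq
    obtain ⟨k, -, hk⟩ := Finset.exists_ne_zero_of_sum_ne_zero hq
    exact (ha k).support q.1 (dir q.2) (norm_dir _) hk
  · intro j x φ hx hg
    -- A generic ray never hits a corner, so the exemption in the definition of a beam cutoff does
    -- not apply.
    have hk : ∀ k, angular (a k) (x, φ) ≠ 0 → reflections E (x, dir φ) = N k := by
      intro k hk
      refine hNeq k (x, dir φ) hx hk fun i _ _ => ?_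
      obtain ⟨c, T, hT⟩ := exists_trace hx hg i
      exact hT.not_isCorner hg
    rw [Finset.sum_filter, hsum]
    split_ifs with hj
    · refine Finset.sum_congr rfl fun k _ => ?_
      split_ifs with hjk
      · rfl
      · by_contra hne
        exact hjk (hk k (Ne.symm hne) ▸ hj)
    · refine Finset.sum_eq_zero fun k _ => ?_
      split_ifs with hjk
      · by_contra hne
        exact hj (hk k hne ▸ hjk)
      · rfl
  · intro j q hj
    refine Finset.sum_eq_zero fun k hk => ?_
    exact absurd ((Finset.mem_filter.1 hk).2.trans (hN k)) hj.not_ge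
  · funext q
    simp [hsum]

theorem exists_mem_square_of_inflow {E : Set Plane} {y : Plane} {φ t : ℝ}
    (h : (y + t • dir φ, dir φ) ∈ inflow E) : ∃ t : ℝ, y + t • dir φ ∈ square := by
  obtain ⟨-, -, s, -, hs⟩ := h
  exact ⟨t + s, by rwa [add_smul, ← add_assoc]⟩

section Levels

variable {E : Set Plane} {Nmax : ℕ} {α α' : Plane → Plane → ℝ} {β β' : ℕ → Plane × ℝ → ℝ} {m : ℝ}

theorem IsLevels.isLineFunction (h : IsLevels E Nmax α β) : IsLineFunction α := by
  refine ⟨h.zero_eq ▸ h.contDiff 0, h.zero_eq ▸ h.const 0, fun y φ hne => ?_⟩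
  rw [← h.zero_eq] at hne
  obtain ⟨t, ht⟩ := h.support 0 _ hne
  exact exists_mem_square_of_inflow ht

theorem IsLevels.eq_of_inflow (h : IsLevels E Nmax α β) {y : Plane} {φ t : ℝ}
    (hg : Generic y (dir φ)) (ht : (y + t • dir φ, dir φ) ∈ inflow E) (j : ℕ) :
    β j (y, φ) =
      if j ≤ reflections E (y + t • dir φ, dir φ) then angular α (y, φ) else 0 := by
  rw [← h.const j y φ t, h.eq_ite j _ φ ht ((generic_add_smul t).2 hg), h.isLineFunction.const]

/-- The bound involves only `α`, not its decomposition into beams, whose number and size are not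
controlled. -/
theorem IsLevels.isSymbol (h : IsLevels E Nmax α β) (hm : 0 ≤ m)
    (hα : c2Norm α ≤ ENNReal.ofReal m) (n j : ℕ) :
    IsSymbol (region n) (radius n) (m * (radius n + 3)) fun y _ φ => β j (y, φ) := by
  refine h.isLineFunction.isSymbol hm hα ((h.contDiff j).of_le (by norm_num)) (h.periodic j)
    fun y _ φ hg => ?_
  by_cases h0 : β j (y, φ) = 0
  · exact Or.inl h0
  obtain ⟨t, ht⟩ := h.support j _ h0
  have := h.eq_of_inflow hg ht j
  split_ifs at this with hj
  · exact Or.inr this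
  · exact Or.inl this

/-- The number of reflections depends on the ray and on `E` only, so both level functions are
switched on for the same lines and the difference is `0` or `α' - α`, even if the two decompositions
are unrelated. -/
theorem IsLevels.isSymbol_sub (h : IsLevels E Nmax α β) (h' : IsLevels E Nmax α' β') (hm : 0 ≤ m)
    (hα : c2Norm (α' - α) ≤ ENNReal.ofReal m) (n j : ℕ) :
    IsSymbol (region n) (radius n) (m * (radius n + 3))
      fun y _ φ => β' j (y, φ) - β j (y, φ) := by
  refine (h.isLineFunction.sub h'.isLineFunction).isSymbol (b := fun q => β' j q - β j q) hm hα
    (((h'.contDiff j).sub (h.contDiff j)).of_le (by norm_num))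
    (fun y φ => by rw [h.periodic, h'.periodic]) fun y _ φ hg => ?_
  by_cases h0 : ∃ t : ℝ, (y + t • dir φ, dir φ) ∈ inflow E
  · obtain ⟨t, ht⟩ := h0
    rw [h.eq_of_inflow hg ht j, h'.eq_of_inflow hg ht j]
    split_ifs
    · exact Or.inr rfl
    · exact Or.inl (sub_self 0)
  · left
    rw [by_contra fun hne => h0 (h.support j (y, φ) hne),
      by_contra fun hne => h0 (h'.support j (y, φ) hne), sub_self]

end Levels

/-! ### The broken ray transform on the unfolded plane -/

section HalfLine

variable {F : Type*} [NormedAddCommGroup F] [NormedSpace ℝ F] {G : ℝ → F}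

theorem integral_Ioi_add {T : ℝ} (h : ∀ s ≤ T, G s = 0) :
    ∫ τ in Ioi (0 : ℝ), G (T + τ) = ∫ s, G s := by
  rw [setIntegral_eq_integral_of_forall_compl_eq_zero, integral_add_left_eq_self]
  intro τ hτ
  rw [mem_Ioi, not_lt] at hτ
  exact h _ (by linarith)

theorem integral_Ioi_sub {u : ℝ} (h : ∀ s, u ≤ s → G s = 0) :
    ∫ τ in Ioi (0 : ℝ), G (u - τ) = ∫ s, G s := by
  rw [setIntegral_eq_integral_of_forall_compl_eq_zero, integral_sub_left_eq_self]
  intro τ hτ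
  rw [mem_Ioi, not_lt] at hτ
  exact h _ (by linarith)

end HalfLine

theorem IsAttenuation.integrable_line {σ : Plane → Plane → ℝ} (h : IsAttenuation σ)
    (c : Fin 2 → ℤ) (x : Plane) (φ : ℝ) :
    Integrable fun s : ℝ => transplant c (angular σ) (x + s • dir φ, φ) := by
  have hc : Continuous fun s : ℝ => transplant c (angular σ) (x + s • dir φ, φ) := by
    have h1 := continuous_fold c
    exact h.1.continuous.comp (by fun_prop :
      Continuous fun s : ℝ => (fold c (x + s • dir φ), turn c φ))
  by_cases hex : ∃ t : ℝ, x + t • dir φ ∈ cell c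
  · obtain ⟨t₀, h₀⟩ := hex
    refine hc.integrable_of_hasCompactSupport
      (HasCompactSupport.of_support_subset_isCompact (isCompact_Icc (a := t₀ - 2) (b := t₀ + 2)) ?_)
    intro t ht
    have ht' : x + t • dir φ ∈ cell c := by
      by_contra hn
      exact ht (h.transplant_eq_zero hn φ)
    have h1 := norm_cell_sub_le ht' h₀
    rw [add_sub_add_left_eq_sub, ← sub_smul, norm_smul, norm_dir, mul_one, Real.norm_eq_abs,
      abs_le] at h1
    exact ⟨by linarith [h1.1], by linarith [h1.2]⟩
  · have : (fun s : ℝ => transplant c (angular σ) (x + s • dir φ, φ)) = fun _ => 0 := by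
      funext s
      exact h.transplant_eq_zero (fun hs => hex ⟨s, hs⟩) φ
    rw [this]
    exact integrable_zero _ _ _

/-! ### The broken ray transform as a sum over cells -/

section Ray

variable {E : Set Plane} {σ : Plane → Plane → ℝ} {x : Plane} {φ : ℝ}
  {c : ℕ → Fin 2 → ℤ} {T : ℕ → ℝ}

/-- Only cells met by the line contribute, and a line meets at most one oriented cell of each depth,
namely the one in its trace. -/
theorem sum_uIcc_eq_sum_range (hT : ∀ j, Trace x (dir φ) j (c j) (T j)) (hg : Generic x (dir φ))
    {s : Finset (Fin 2 → ℤ)} {N : ℕ} {M : Type*} [AddCommMonoid M] {F : (Fin 2 → ℤ) → M}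
    (hs : ∀ m ≤ N, c m ∈ s) (hF : ∀ c' ∈ s, F c' ≠ 0 → Oriented c' (dir φ) ∧ depth c' ≤ N ∧
      ∃ u : ℝ, x + u • dir φ ∈ cell c') :
    ∑ c' ∈ s, F c' = ∑ m ∈ Finset.range (N + 1), F (c m) := by
  classical
  rw [← Finset.sum_image (f := F) (g := c) (s := Finset.range (N + 1))]
  · symm
    refine Finset.sum_subset ?_ ?_
    · intro c' hc'
      obtain ⟨m, hm, rfl⟩ := Finset.mem_image.1 hc'
      exact hs m (Nat.lt_succ_iff.1 (Finset.mem_range.1 hm))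
    · intro c' hc' hn
      by_contra hne
      obtain ⟨h1, h2, u, hu⟩ := hF c' hc' hne
      refine hn (Finset.mem_image.2 ⟨depth c', Finset.mem_range.2 (by omega), ?_⟩)
      obtain ⟨u', hu'⟩ := (hT (depth c')).exists_mem_cell hg
      exact eq_of_depth_eq (hT _).oriented h1 hu' hu (hT _).depth_eq
  · intro a _ b _ hab
    rw [← (hT a).depth_eq, ← (hT b).depth_eq, hab]

theorem Trace.transplant_eq {j : ℕ} {c : Fin 2 → ℤ} {T : ℝ} (hT : Trace x (dir φ) j c T) (t : ℝ) :
    σ ((billiard^[j] (x, dir φ)).1 + t • (billiard^[j] (x, dir φ)).2)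
      (billiard^[j] (x, dir φ)).2 = transplant c (angular σ) (x + (T + t) • dir φ, φ) := by
  rw [hT.billiard_eq, transplant_angular, ← fold_add_smul, add_smul, add_assoc]

/-- The complete segments before the `j`-th one and the part of the current segment together make up
the unfolded line behind the point. Cells of the rectangle between the square and `c j` that the
line misses contribute nothing to the corridor. -/
theorem weight_eq_decay (hσ : IsAttenuation σ) (hT : ∀ j, Trace x (dir φ) j (c j) (T j))
    (hg : Generic x (dir φ)) {j : ℕ} {t : ℝ} (hu : x + (T j + t) • dir φ ∈ cell (c j)) :
    weight σ (x, dir φ) j t = decay (c j) σ (x + (T j + t) • dir φ, φ) := by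
  have hrev : ∀ τ : ℝ, x + (T j + t) • dir φ - τ • dir φ = x + (T j + t - τ) • dir φ := by
    intro τ
    rw [sub_smul, add_sub_assoc]
  rw [weight, decay, ← Real.exp_add, ← neg_add]
  simp only [(hT _).transplant_eq, corridor, hrev]
  have hint : ∀ c', Integrable (fun τ : ℝ =>
      transplant c' (angular σ) (x + (T j + t - τ) • dir φ, φ)) (volume.restrict (Ioi 0)) :=
    fun c' => ((hσ.integrable_line c' x φ).comp_sub_left (T j + t)).integrableOn
  rw [integral_finsetSum _ fun c' _ => hint c', sum_uIcc_eq_sum_range (M := ℝ) hT hg (N := j),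
    Finset.sum_range_succ]
  · refine congrArg Real.exp (congrArg Neg.neg (congrArg₂ (· + ·) ?_ ?_))
    · refine Finset.sum_congr rfl fun m hm => ?_
      have hm' := Finset.mem_range.1 hm
      rw [integral_Ioi_add (G := fun s => transplant (c m) (angular σ) (x + s • dir φ, φ)),
        integral_Ioi_sub (G := fun s => transplant (c m) (angular σ) (x + s • dir φ, φ))]
      · intro s hs
        -- Cells of smaller depth are left before the point is reached, so the integral over the
        -- past equals the one over the whole line.
        refine hσ.transplant_eq_zero (fun hs' => ?_) φ
        refine (lt_of_depth_lt (hT j).oriented hs' hu ?_).not_ge hs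
        rw [(hT m).depth_eq, (hT j).depth_eq]
        exact hm'
      · intro s hs
        exact hσ.transplant_eq_zero (fun hs' => ((hT m).lt_of_mem_cell hs').not_ge hs) φ
    · simp only [add_sub_assoc]
  · intro m hm
    obtain ⟨u, hu'⟩ := (hT m).exists_mem_cell hg
    refine mem_uIcc_of_depth_le (hT m).oriented (hT j).oriented hu' hu ?_
    rw [(hT m).depth_eq, (hT j).depth_eq]
    exact hm
  · intro c' hc' hne
    refine ⟨(hT j).oriented.of_mem_uIcc hc', (depth_le_of_mem_uIcc hc').trans_eq (hT j).depth_eq,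
      ?_⟩
    by_contra! hn
    refine hne ?_
    simp_rw [hσ.transplant_eq_zero (hn _)]
    simp

/-- The entry time into the cell is the origin of time on the segment; before it the lifted function
vanishes, so the half line may be completed to the line. -/
theorem integral_segment_eq (hσ : IsAttenuation σ) (hT : ∀ j, Trace x (dir φ) j (c j) (T j))
    (hg : Generic x (dir φ)) (f : Plane → ℂ) (j : ℕ) :
    ∫ t in Ioi (0 : ℝ), (weight σ (x, dir φ) j t : ℂ) * square.indicator f
      ((billiard^[j] (x, dir φ)).1 + t • (billiard^[j] (x, dir φ)).2) =
    ∫ s : ℝ, (decay (c j) σ (x + s • dir φ, φ) : ℂ) * lift (c j) f (x + s • dir φ) := by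
  rw [← integral_Ioi_add (T := T j)]
  · refine integral_congr_ae (Filter.Eventually.of_forall fun t => ?_)
    simp only
    rw [(hT j).billiard_eq]
    simp only
    rw [← fold_add_smul, add_assoc, ← add_smul]
    change _ * lift (c j) f (x + (T j + t) • dir φ) = _
    by_cases hu : x + (T j + t) • dir φ ∈ cell (c j)
    · rw [weight_eq_decay hσ hT hg hu]
    · rw [lift_of_notMem hu, mul_zero, mul_zero]
  · intro s hs
    rw [lift_of_notMem fun hs' => ((hT j).lt_of_mem_cell hs').not_ge hs, mul_zero]

end Ray

open Classical in
/-- The indicator function of the directions in which the cell `c` is seen from the square. -/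
def orient (c : Fin 2 → ℤ) (φ : ℝ) : ℝ := if Oriented c (dir φ) then 1 else 0

/-- The weight of the broken ray transform in the cell `c`. -/
def rayWeight (c : Fin 2 → ℤ) (β : ℕ → Plane × ℝ → ℝ) (σ : Plane → Plane → ℝ) (q : Plane × ℝ) : ℝ :=
  orient c q.2 * (β (depth c) q * decay c σ q)

theorem measurable_orient (c : Fin 2 → ℤ) : Measurable (orient c) := by
  classical
  refine Measurable.ite ?_ measurable_const measurable_const
  unfold Oriented
  rw [ofPred_forall]
  refine MeasurableSet.iInter fun i => ?_
  rw [ofPred_or]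
  refine MeasurableSet.union (MeasurableSet.const _) ?_
  have hd := continuous_dir
  have : Continuous fun φ : ℝ => (c i : ℝ) * dir φ i := by fun_prop
  exact (isOpen_lt continuous_const this).measurableSet

theorem abs_orient_le (c : Fin 2 → ℤ) (φ : ℝ) : |orient c φ| ≤ 1 := by
  unfold orient
  split_ifs <;> simp

/-- The broken ray transform is a sum of integrals along the straight line. -/
theorem IsLevels.mul_rayTransform_eq {E : Set Plane} {Nmax : ℕ} {α σ : Plane → Plane → ℝ}
    {β : ℕ → Plane × ℝ → ℝ} (h : IsLevels E Nmax α β) (hσ : IsAttenuation σ) {x : Plane} {φ : ℝ}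
    (hx : (x, dir φ) ∈ inflow E) (hg : Generic x (dir φ)) (f : Plane → ℂ) :
    (α x (dir φ) : ℂ) * rayTransform σ E (square.indicator f) (x, dir φ) =
      ∑ c ∈ box Nmax, ∫ s : ℝ, rayWeight c β σ (x + s • dir φ, φ) • lift c f (x + s • dir φ) := by
  choose c T hT using fun j => exists_trace hx hg j
  have hβ : ∀ j s, β j (x + s • dir φ, φ) =
      if j ≤ reflections E (x, dir φ) then angular α (x, φ) else 0 := fun j s => by
    rw [h.const, h.eq_ite j x φ hx hg]
  by_cases h0 : α x (dir φ) = 0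
  · rw [h0, Complex.ofReal_zero, zero_mul]
    symm
    refine Finset.sum_eq_zero fun c _ => ?_
    have e : ∀ s : ℝ, rayWeight c β σ (x + s • dir φ, φ) = 0 := by
      intro s
      have : angular α (x, φ) = 0 := h0
      rw [rayWeight, hβ, this, ite_self, zero_mul, mul_zero]
    simp only [e, zero_smul, integral_zero]
  -- The level function with index equal to the number of reflections is `α ≠ 0` here, whereas all
  -- levels beyond `Nmax` vanish.
  · have hN : reflections E (x, dir φ) ≤ Nmax := by
      by_contra! hlt
      have h1 := h.eq_ite (reflections E (x, dir φ)) x φ hx hg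
      rw [if_pos le_rfl, h.eq_zero _ _ hlt] at h1
      exact h0 h1.symm
    rw [sum_uIcc_eq_sum_range (M := ℂ) hT hg (N := reflections E (x, dir φ)), rayTransform, Finset.mul_sum]
    · refine Finset.sum_congr rfl fun j hj => ?_
      rw [integral_segment_eq hσ hT hg, ← integral_const_mul]
      refine integral_congr_ae (Filter.Eventually.of_forall fun s => ?_)
      simp only
      rw [rayWeight, hβ, (hT j).depth_eq, if_pos (Nat.lt_succ_iff.1 (Finset.mem_range.1 hj)), orient,
        if_pos (hT j).oriented, one_mul, Complex.real_smul]
      push_cast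
      rw [mul_assoc]
      rfl
    · intro m hm
      exact mem_box_of_depth_le ((hT m).depth_eq.trans_le (hm.trans hN))
    · intro c' _ hne
      have hs : ∃ s : ℝ, rayWeight c' β σ (x + s • dir φ, φ) • lift c' f (x + s • dir φ) ≠ 0 := by
        by_contra! hn
        exact hne (by simp only [hn, integral_zero])
      obtain ⟨s, hs⟩ := hs
      have hw := left_ne_zero_of_smul hs
      refine ⟨?_, ?_, s, ?_⟩
      · by_contra hn
        rw [rayWeight, orient, if_neg hn, zero_mul] at hw
        exact hw rfl
      · by_contra hn
        rw [rayWeight, hβ, if_neg hn, zero_mul, mul_zero] at hw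
        exact hw rfl
      · by_contra hn
        rw [lift_of_notMem hn, smul_zero] at hs
        exact hs rfl

theorem IsLevels.ae_mul_rayTransform_eq {E : Set Plane} (hE : MeasurableSet E) {Nmax : ℕ}
    {α σ : Plane → Plane → ℝ} {β : ℕ → Plane × ℝ → ℝ} (h : IsLevels E Nmax α β)
    (hσ : IsAttenuation σ) (f : Plane → ℂ) :
    ∀ᵐ p ∂inflowMeasure E, (α p.1 p.2 : ℂ) * rayTransform σ E (square.indicator f) p =
      ∑ c ∈ box Nmax, segInt c (rayWeight c β σ) f p := by
  filter_upwards [ae_mem_inflow hE, ae_norm_eq_one E, ae_generic E] with p hp h1 hg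
  obtain ⟨x, θ⟩ := p
  have e : dir (angle θ) = θ := dir_angle h1
  have := h.mul_rayTransform_eq hσ (x := x) (φ := angle θ) (by rwa [e]) (by rwa [e]) f
  simp only [segInt, flow]
  rwa [e] at this

/-! ### The bilinear estimate -/

/-- The weight `w` in the cell `c` is given by the symbol `P` along the lines of directions in which
`c` is seen from the square. -/
structure IsWeight (E : Set Plane) (n : ℕ) (c : Fin 2 → ℤ) (w : Plane × ℝ → ℝ)
    (P : Plane → ℝ → ℝ → ℝ) (B : ℝ) : Prop where
  measurable : Measurable w
  symbol : IsSymbol (region n) (radius n) B P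
  nonneg : 0 ≤ B
  eq_symbol : ∀ y ∈ region n, ∀ r φ, r ≤ radius n →
    w (y - r • dir φ, φ) = orient c φ * P y r φ
  support : ∀ q, w q ≠ 0 → ∃ t : ℝ, (q.1 + t • dir q.2, dir q.2) ∈ inflow E
  vanish : ∀ y r φ, P y r φ ≠ 0 → ∃ t : ℝ, y + t • dir φ ∈ square

theorem IsSymbol.congr {D : Set Plane} {R B : ℝ} {P Q : Plane → ℝ → ℝ → ℝ} (h : IsSymbol D R B P)
    (e : ∀ y r φ, Q y r φ = P y r φ) : IsSymbol D R B Q := by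
  have : Q = P := funext fun y => funext fun r => funext fun φ => e y r φ
  rwa [this]

section Weight

variable {E : Set Plane} {n : ℕ} {c c' : Fin 2 → ℤ} {w w' : Plane × ℝ → ℝ}
  {P P' : Plane → ℝ → ℝ → ℝ} {B B' : ℝ}

theorem IsWeight.eq_zero_symbol (h : IsWeight E n c w P B) {y : Plane} (hy : y ∈ region n) (φ : ℝ) :
    w (y, φ) = orient c φ * P y 0 φ := by
  have := h.eq_symbol y hy 0 φ (radius_pos n).le
  rwa [zero_smul, sub_zero] at this

theorem IsWeight.abs_le (h : IsWeight E n c w P B) (hc : c ∈ box n) (q : Plane × ℝ)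
    (hq : q.1 ∈ cell c) : |w q| ≤ B := by
  obtain ⟨Pφ, Pr, Pφr, hP⟩ := h.symbol
  have hy := cell_subset_region hc hq
  have e : w q = orient c q.2 * P q.1 0 q.2 := h.eq_zero_symbol hy q.2
  rw [e]
  refine abs_mul_le_of_abs_le_one (abs_orient_le _ _) (hP.bound q.1 hy 0 q.2 ?_)
  rw [abs_zero]; exact (radius_pos n).le

theorem IsWeight.sub (h : IsWeight E n c w P B) (h' : IsWeight E n c w' P' B') {D : ℝ}
    (hD : 0 ≤ D) (hs : IsSymbol (region n) (radius n) D fun y r φ => P' y r φ - P y r φ) :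
    IsWeight E n c (w' - w) (fun y r φ => P' y r φ - P y r φ) D := by
  refine ⟨h'.measurable.sub h.measurable, hs, hD, fun y hy r φ hr => ?_, fun q hq => ?_,
    fun y r φ hne => ?_⟩
  · rw [Pi.sub_apply, h.eq_symbol y hy r φ hr, h'.eq_symbol y hy r φ hr, mul_sub]
  · by_cases h0 : w q = 0
    · exact h'.support q fun h1 => hq (by rw [Pi.sub_apply, h0, h1, sub_zero])
    · exact h.support q h0
  · by_cases h0 : P y r φ = 0
    · exact h'.vanish y r φ fun h1 => hne (by rw [h0, h1, sub_zero])
    · exact h.vanish y r φ h0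

end Weight

theorem continuous_dir_apply (i : Fin 2) : Continuous fun φ : ℝ => dir φ i := by
  have := continuous_dir
  fun_prop

theorem orient_eventually_eq {c : Fin 2 → ℤ} {φ : ℝ} (h : ∀ i, c i ≠ 0 → dir φ i ≠ 0) :
    ∀ᶠ φ' in 𝓝 φ, orient c φ' = orient c φ := by
  have hi : ∀ i, ∀ᶠ φ' in 𝓝 φ, (c i = 0 ∨ 0 < (c i : ℝ) * dir φ' i) ↔
      (c i = 0 ∨ 0 < (c i : ℝ) * dir φ i) := by
    intro i
    by_cases h0 : c i = 0
    · simp [h0]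
    have hc : Continuous fun φ : ℝ => (c i : ℝ) * dir φ i :=
      continuous_const.mul (continuous_dir_apply i)
    have hne : (c i : ℝ) * dir φ i ≠ 0 := mul_ne_zero (Int.cast_ne_zero.2 h0) (h i h0)
    rcases lt_or_gt_of_ne hne with hlt | hgt
    · filter_upwards [(isOpen_lt hc continuous_const).mem_nhds hlt] with φ' hφ'
      simp only [h0, false_or]
      constructor <;> intro <;> linarith
    · filter_upwards [(isOpen_lt continuous_const hc).mem_nhds hgt] with φ' hφ'
      simp [hφ', hgt]
  filter_upwards [Filter.eventually_all.2 hi] with φ' hφ'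
  have : Oriented c (dir φ') ↔ Oriented c (dir φ) := forall_congr' hφ'
  by_cases h1 : Oriented c (dir φ)
  · rw [orient, orient, if_pos h1, if_pos (this.2 h1)]
  · rw [orient, orient, if_neg h1, if_neg fun h2 => h1 (this.1 h2)]

theorem exists_dist_square {c : Fin 2 → ℤ} {i : Fin 2} (hi : c i ≠ 0) {y : Plane} (hy : y ∈ cell c) :
    ∃ d : ℝ, 0 < d ∧ ∀ x ∈ square, d ≤ |x i - y i| := by
  obtain ⟨h1, h2⟩ := hy i
  rcases lt_or_gt_of_ne hi with h | h
  · have h3 : (c i : ℝ) + 1 ≤ 0 := by exact_mod_cast h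
    refine ⟨-y i, by linarith, fun x hx => ?_⟩
    exact le_trans (by linarith [(hx i).1]) (le_abs_self _)
  · have h3 : (1 : ℝ) ≤ c i := by exact_mod_cast h
    refine ⟨y i - 1, by linarith, fun x hx => ?_⟩
    exact le_trans (by linarith [(hx i).2]) (neg_le_abs _)

/-- A line meeting the square does so within time `2 + ‖y‖`. For directions almost perpendicular to
the `i`-th axis this is too short to cover the gap between `y` and the square in that coordinate. -/
theorem eventually_not_hits {c : Fin 2 → ℤ} {i : Fin 2} (hi : c i ≠ 0) {y : Plane} (hy : y ∈ cell c)
    {φ : ℝ} (hφ : dir φ i = 0) : ∀ᶠ φ' in 𝓝 φ, ¬ ∃ t : ℝ, y + t • dir φ' ∈ square := by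
  obtain ⟨d, hd, hdx⟩ := exists_dist_square hi hy
  have hc : Continuous fun φ' : ℝ => (2 + ‖y‖) * |dir φ' i| :=
    continuous_const.mul (continuous_dir_apply i).abs
  have h0 : (2 + ‖y‖) * |dir φ i| < d := by rw [hφ, abs_zero, mul_zero]; exact hd
  filter_upwards [(isOpen_lt hc continuous_const).mem_nhds h0] with φ' hφ'
  rintro ⟨t, ht⟩
  have h1 := hdx _ ht
  have h2 : |t| ≤ 2 + ‖y‖ := by
    have e : t • dir φ' = (y + t • dir φ') - y := by abel
    have : ‖t • dir φ'‖ ≤ 2 + ‖y‖ := by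
      rw [e]
      exact (norm_sub_le _ _).trans (add_le_add (norm_le_two_of_mem_square ht) le_rfl)
    rwa [norm_smul, norm_dir, mul_one, Real.norm_eq_abs] at this
  rw [PiLp.add_apply, PiLp.smul_apply, smul_eq_mul, add_sub_cancel_left, abs_mul] at h1
  have h3 : |t| * |dir φ' i| ≤ (2 + ‖y‖) * |dir φ' i| := by gcongr
  exact (h1.trans h3).not_gt hφ'

section Test

variable {ψ : Plane → ℂ} {c : Fin 2 → ℤ}

/-- A smooth function with compact support in the square. -/
structure IsTest (ψ : Plane → ℂ) : Prop where
  contDiff : ContDiff ℝ ∞ ψ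
  compact : ∃ S ⊆ square, IsCompact S ∧ ∀ x ∉ S, ψ x = 0

theorem IsTest.hasCompactSupport (h : IsTest ψ) : HasCompactSupport ψ := by
  obtain ⟨S, -, hS, h0⟩ := h.compact
  exact HasCompactSupport.intro hS h0

theorem IsTest.eq_zero (h : IsTest ψ) {x : Plane} (hx : x ∉ square) : ψ x = 0 := by
  obtain ⟨S, hs, hS, h0⟩ := h.compact
  exact h0 x fun hx' => hx (hs hx')

theorem IsTest.fderiv_eq_zero (h : IsTest ψ) {x : Plane} (hx : x ∉ square) : fderiv ℝ ψ x = 0 := by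
  obtain ⟨S, hs, hS, h0⟩ := h.compact
  have : ψ =ᶠ[𝓝 x] fun _ => 0 := by
    filter_upwards [hS.isClosed.isOpen_compl.mem_nhds fun hx' => hx (hs hx')] with y hy
    exact h0 y hy
  rw [this.fderiv_eq]
  simp

theorem IsTest.continuous_fderiv (h : IsTest ψ) (e : Plane) :
    Continuous fun x => fderiv ℝ ψ x e :=
  (h.contDiff.continuous_fderiv (by simp)).clm_apply continuous_const

theorem IsTest.contDiff_comp_fold (h : IsTest ψ) (c : Fin 2 → ℤ) :
    ContDiff ℝ ∞ (ψ ∘ fold c) := h.contDiff.comp (contDiff_fold c)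

theorem IsTest.comp_fold_eq_zero (h : IsTest ψ) {y : Plane} (hy : y ∉ cell c) :
    (ψ ∘ fold c) y = 0 := h.eq_zero fun h => hy (fold_mem_square.1 h)

theorem IsTest.hasCompactSupport_comp_fold (h : IsTest ψ) {n : ℕ} (hc : c ∈ box n) :
    HasCompactSupport (ψ ∘ fold c) := by
  refine HasCompactSupport.intro (isCompact_closedBall (0 : Plane) (radius n / 2)) fun y hy => ?_
  refine h.comp_fold_eq_zero fun hy' => hy ?_
  rw [mem_closedBall_zero_iff]
  exact norm_lt_of_mem_region (cell_subset_region hc hy')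

theorem IsTest.lift_fderiv (h : IsTest ψ) (c : Fin 2 → ℤ) (e y : Plane) :
    lift c (fun x => fderiv ℝ ψ x e) y = fderiv ℝ (ψ ∘ fold c) y ((flip c).symm e) := by
  have h1 := ((h.contDiff.differentiable (by simp)) (fold c y)).hasFDerivAt.comp y
    (hasFDerivAt_fold c y)
  rw [h1.fderiv]
  change lift c (fun x => fderiv ℝ ψ x e) y = fderiv ℝ ψ (fold c y) (flip c ((flip c).symm e))
  rw [LinearIsometryEquiv.apply_symm_apply, lift]
  by_cases hy : fold c y ∈ square
  · rw [indicator_of_mem hy]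
  · rw [indicator_of_notMem hy, h.fderiv_eq_zero hy]
    rfl

theorem IsTest.eLpNorm_comp_fold (h : IsTest ψ) (c : Fin 2 → ℤ) :
    eLpNorm (ψ ∘ fold c) 2 volume = eLpNorm ψ 2 (volume.restrict square) := by
  have e : square.indicator ψ = ψ := indicator_eq_self.2 fun x hx => by
    by_contra hn
    exact hx (h.eq_zero hn)
  rw [← eLpNorm_indicator_eq_eLpNorm_restrict isOpen_square.measurableSet, e]
  exact eLpNorm_comp_measurePreserving h.contDiff.continuous.aestronglyMeasurable
    (measurePreserving_fold c)

end Test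

theorem dir_neg_pi : dir (-Real.pi) = dir Real.pi := by
  rw [← dir_add_two_pi (-Real.pi)]
  congr 1
  ring

theorem orient_neg_pi (c : Fin 2 → ℤ) : orient c (-Real.pi) = orient c Real.pi := by
  unfold orient
  rw [dir_neg_pi]

/-- The constant in the bilinear estimate. -/
def bilinearConst (n : ℕ) : ℝ := 48 * Real.pi * (radius n + 2)

theorem bilinearConst_nonneg (n : ℕ) : 0 ≤ bilinearConst n := by
  have := radius_pos n
  have := Real.pi_pos
  unfold bilinearConst; positivity

/-- After Santaló's formula this is the key estimate for the symbol `P' y 0 φ * P y r φ`, with the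
product of the two direction indicators as the jumping factor. The product rule for symbols supplies
the factor `4` in `bilinearConst`. -/
theorem IsWeight.norm_bilinear_le {E : Set Plane} {n : ℕ} {c c' : Fin 2 → ℤ} {w w' : Plane × ℝ → ℝ}
    {P P' : Plane → ℝ → ℝ → ℝ} {B B' : ℝ} (hE : MeasurableSet E) (hc : c ∈ box n) (hc' : c' ∈ box n)
    (hw : IsWeight E n c w P B) (hw' : IsWeight E n c' w' P' B') {f ψ : Plane → ℂ}
    (hf : StronglyMeasurable f) (hf2 : MemLp f 2 (volume.restrict square)) (hψ : IsTest ψ)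
    {e : Plane} (he : ‖e‖ ≤ 1) :
    ‖∫ p, (starRingEnd ℂ) (segInt c' w' f p) * segInt c w (fun x => fderiv ℝ ψ x e) p
        ∂inflowMeasure E‖ ≤ bilinearConst n * (B' * B) *
      ((eLpNorm f 2 (volume.restrict square)).toReal *
        (eLpNorm ψ 2 (volume.restrict square)).toReal) := by
  have hR := radius_pos n
  have hcont := hψ.continuous_fderiv e
  obtain ⟨H, hH⟩ : ∃ H, ∀ x, ‖fderiv ℝ ψ x e‖ ≤ H :=
    hcont.bounded_above_of_compact_support (hψ.hasCompactSupport.fderiv_apply ℝ e)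
  have hH0 : 0 ≤ H := (norm_nonneg _).trans (hH 0)
  rw [integral_conj_segInt_mul hE hw.measurable hw'.measurable hw.nonneg (hw.abs_le hc)
    (hw'.abs_le hc') hw'.support hf hf2 hcont.stronglyMeasurable hH0 fun x _ => hH x]
  set A : Plane → ℝ → ℝ → ℝ := fun y r φ => P' y 0 φ * P y r φ with hA
  set o : ℝ → ℝ := fun φ => orient c' φ * orient c φ with ho
  set ψc := ψ ∘ fold c with hψc
  -- The direction of differentiation is reflected together with the cell.
  set e' := (flip c).symm e with he'
  have hsupp : ∀ y ∈ cell c', ∀ r φ, radius n ≤ |r| → y - r • dir φ ∉ cell c := by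
    intro y hy r φ hr hz
    exact (abs_lt_radius (cell_subset_region hc' hy) (cell_subset_region hc hz) rfl).not_ge hr
  have hinner : ∀ y ∈ cell c', ∀ φ, w' (y, φ) • lineInt c w (fun x => fderiv ℝ ψ x e) (y, φ) =
      ∫ r in -radius n..radius n, (o φ * A y r φ) • fderiv ℝ ψc (y - r • dir φ) e' := by
    intro y hy φ
    have hyr := cell_subset_region hc' hy
    rw [lineInt, ← integral_smul, intervalIntegral.integral_of_le (by linarith),
      ← setIntegral_eq_integral_of_forall_compl_eq_zero (s := Ioc (-radius n) (radius n))]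
    · refine setIntegral_congr_fun measurableSet_Ioc fun r hr => ?_
      simp only
      rw [hψ.lift_fderiv, hw.eq_symbol y hyr r φ hr.2, hw'.eq_zero_symbol hyr, smul_smul]
      congr 1
      simp only [ho, hA]
      ring
    · intro r hr
      rw [lift_of_notMem, smul_zero, smul_zero]
      refine hsupp y hy r φ ?_
      by_contra! hlt
      exact hr ⟨(abs_lt.1 hlt).1, (abs_lt.1 hlt).2.le⟩
  have hcongr : ∫ y in cell c', (starRingEnd ℂ) (lift c' f y) * ∫ φ in (-Real.pi)..Real.pi,
        w' (y, φ) • lineInt c w (fun x => fderiv ℝ ψ x e) (y, φ) =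
      ∫ y in cell c', (starRingEnd ℂ) (lift c' f y) * ∫ φ in (-Real.pi)..Real.pi,
        ∫ r in -radius n..radius n, (o φ * A y r φ) • fderiv ℝ ψc (y - r • dir φ) e' :=
    setIntegral_congr_fun (isOpen_cell c').measurableSet fun y hy => by
      simp only [hinner y hy]
  rw [hcongr]
  have hsymb : IsSymbol (cell c') (radius n) (4 * (B' * B)) A :=
    ((hw'.symbol.freeze hR.le hw'.nonneg).mul hw.symbol).mono (cell_subset_region hc') le_rfl
  have hnorm : ∀ᵐ y : Plane, ‖(starRingEnd ℂ) (lift c' f y)‖ = ‖lift c' f y‖ :=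
    Filter.Eventually.of_forall fun y => RCLike.norm_conj _
  have hfc : MemLp (fun y => (starRingEnd ℂ) (lift c' f y)) 2 volume :=
    (memLp_lift c' hf hf2).congr_norm
      (RCLike.continuous_conj.comp_stronglyMeasurable (stronglyMeasurable_lift c' hf)).aestronglyMeasurable
      (hnorm.mono fun y hy => hy.symm)
  have hfi : Integrable fun y => (starRingEnd ℂ) (lift c' f y) :=
    (integrable_lift c' hf2).congr' hfc.1 (hnorm.mono fun y hy => hy.symm)
  have key := hsymb.norm_integral_fderiv_le (o := o) (ψ := ψc) (e := e') hR
    (mul_nonneg (by norm_num) (mul_nonneg hw'.nonneg hw.nonneg)) (isOpen_cell c').measurableSet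
    ((measurable_orient c').mul (measurable_orient c))
    (fun φ => abs_mul_le_of_abs_le_one (abs_orient_le c' φ) (abs_orient_le c φ))
    (by simp only [ho, orient_neg_pi]) (hψ.contDiff_comp_fold c)
    (hψ.hasCompactSupport_comp_fold hc) (by rwa [he', LinearIsometryEquiv.norm_map]) ?_
    (fun y hy r φ hr => hψ.comp_fold_eq_zero (hsupp y hy r φ hr)) hfc hfi.integrableOn
  · rw [hψ.eLpNorm_comp_fold, eLpNorm_congr_norm_ae hnorm, eLpNorm_lift c' hf] at key
    refine key.trans_eq ?_
    rw [bilinearConst]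
    ring
  · intro y hy r φ
    -- The indicators can jump only at directions with a vanishing component along which one of the
    -- cells is displaced from the square.
    by_cases hdir : ∀ i, (c' i ≠ 0 ∨ c i ≠ 0) → dir φ i ≠ 0
    · left
      filter_upwards [orient_eventually_eq fun i hi => hdir i (Or.inl hi),
        orient_eventually_eq fun i hi => hdir i (Or.inr hi)] with φ' h1 h2
      simp only [ho, h1, h2]
    · right
      push Not at hdir
      obtain ⟨i, hi, h0⟩ := hdir
      -- If only `c` is displaced, points of the line at time `r` stay in the strip over the unit
      -- interval and miss `c`, so `ψ` vanishes there. If `c'` is displaced, nearby lines through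
      -- `y` miss the square, so the symbol `P'` vanishes.
      by_cases hi' : c' i = 0
      · have hci : c i ≠ 0 := hi.resolve_left (not_not.2 hi')
        have hy' := hy i
        rw [hi', Int.cast_zero, zero_add] at hy'
        have hcz : Continuous fun φ' : ℝ => (y - r • dir φ') i := by
          have := continuous_dir
          fun_prop
        have hz : (y - r • dir φ) i ∈ Ioo (0 : ℝ) 1 := by
          simpa [h0] using hy'
        filter_upwards [(isOpen_Ioo.preimage hcz).mem_nhds hz] with φ' hφ'
        refine Or.inr (hψ.comp_fold_eq_zero fun hcell => ?_)
        obtain ⟨h1, h2⟩ := hφ'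
        obtain ⟨h3, h4⟩ := hcell i
        have h5 : (c i : ℝ) < 1 := h3.trans h2
        have h6 : (0 : ℝ) < c i + 1 := h1.trans h4
        have h7 : c i < 1 := by exact_mod_cast h5
        have h8 : 0 < c i + 1 := by exact_mod_cast h6
        omega
      · filter_upwards [eventually_not_hits hi' hy h0] with φ' hφ'
        left
        have : P' y 0 φ' = 0 := by
          by_contra hne
          exact hφ' (hw'.vanish y 0 φ' hne)
        simp only [hA, this, zero_mul]

/-! ### The weights of the broken ray transform -/

section RayWeight

variable {E : Set Plane} {Nmax : ℕ} {α α' σ σ' : Plane → Plane → ℝ}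
  {β β' : ℕ → Plane × ℝ → ℝ} {m δ δ₀ : ℝ} {c : Fin 2 → ℤ}

/-- The symbol of the weight `rayWeight c β σ`. -/
def raySymbol (n : ℕ) (c : Fin 2 → ℤ) (β : ℕ → Plane × ℝ → ℝ) (σ : Plane → Plane → ℝ) (y : Plane)
    (r φ : ℝ) : ℝ :=
  β (depth c) (y, φ) * Real.exp (-backInt (radius n) (corridor c σ) y r φ)

theorem IsLevels.isWeight (h : IsLevels E Nmax α β) (hσ : IsAttenuation σ) {n : ℕ} (hc : c ∈ box n)
    {B : ℝ} (hB : 0 ≤ B) (hs : IsSymbol (region n) (radius n) B (raySymbol n c β σ)) :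
    IsWeight E n c (rayWeight c β σ) (raySymbol n c β σ) B := by
  refine ⟨?_, hs, hB, fun y hy r φ hr => ?_, fun q hq => ?_, fun y r φ hne => ?_⟩
  · exact ((measurable_orient c).comp measurable_snd).mul
      ((h.contDiff _).continuous.measurable.mul (hσ.measurable_decay c))
  · have h1 : β (depth c) (y - r • dir φ, φ) = β (depth c) (y, φ) := by
      rw [sub_eq_add_neg, ← neg_smul, h.const]
    rw [rayWeight, raySymbol, hσ.decay_sub hc hy hr, h1]
  · exact h.support (depth c) q (left_ne_zero_of_mul (right_ne_zero_of_mul hq))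
  · obtain ⟨t, ht⟩ := h.support (depth c) (y, φ) (left_ne_zero_of_mul hne)
    exact exists_mem_square_of_inflow ht

/-- The bound of the symbols of the weights, for data with `C²` norm at most `m`. -/
def weightConst (n : ℕ) (m : ℝ) : ℝ :=
  4 * (m * (radius n + 3) * (expConst (lineConst n * m) + 1))

/-- The Lipschitz constant of the exponentials of integrals of attenuations. -/
def expDiffConst (n : ℕ) (m δ₀ : ℝ) : ℝ :=
  4 * (lineConst n * (1 + lineConst n * δ₀) * Real.exp (lineConst n * δ₀) *
    (expConst (lineConst n * m) + 1))

/-- The Lipschitz constant of the symbols of the weights. -/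
def weightDiffConst (n : ℕ) (m δ₀ : ℝ) : ℝ :=
  4 * ((radius n + 3) * (δ₀ * expDiffConst n m δ₀)) +
    4 * ((radius n + 3) * (expConst (lineConst n * m) + 1)) +
    4 * (m * (radius n + 3) * expDiffConst n m δ₀)

theorem expConst_nonneg {b : ℝ} (hb : 0 ≤ b) : 0 ≤ expConst b := by
  unfold expConst; positivity

theorem weightConst_nonneg (n : ℕ) (hm : 0 ≤ m) : 0 ≤ weightConst n m := by
  have := radius_pos n
  have := expConst_nonneg (mul_nonneg (lineConst_nonneg n) hm)
  unfold weightConst; positivity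

theorem expDiffConst_nonneg (n : ℕ) (hm : 0 ≤ m) (hδ₀ : 0 ≤ δ₀) : 0 ≤ expDiffConst n m δ₀ := by
  have := lineConst_nonneg n
  have := expConst_nonneg (mul_nonneg (lineConst_nonneg n) hm)
  unfold expDiffConst; positivity

theorem weightDiffConst_nonneg (n : ℕ) (hm : 0 ≤ m) (hδ₀ : 0 ≤ δ₀) :
    0 ≤ weightDiffConst n m δ₀ := by
  have := radius_pos n
  have := expConst_nonneg (mul_nonneg (lineConst_nonneg n) hm)
  have := expDiffConst_nonneg n hm hδ₀
  unfold weightDiffConst; positivity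

theorem IsLevels.isSymbol_raySymbol (h : IsLevels E Nmax α β) (hσ : IsAttenuation σ) (hm : 0 ≤ m)
    (hα : c2Norm α ≤ ENNReal.ofReal m) (hσm : c2Norm σ ≤ ENNReal.ofReal m) {n : ℕ}
    (hc : c ∈ box n) : IsSymbol (region n) (radius n) (weightConst n m) (raySymbol n c β σ) :=
  (h.isSymbol hm hα n (depth c)).mul (hσ.isSymbol_exp hm hσm hc _)

/-- The difference of the products is expanded as `(β' - β)(e' - e) + (β' - β) e + β (e' - e)`, with
`e, e'` the exponentials. Only norms of the unprimed data and of differences are then needed. -/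
theorem IsLevels.isSymbol_raySymbol_sub (h : IsLevels E Nmax α β) (h' : IsLevels E Nmax α' β')
    (hσ : IsAttenuation σ) (hσ' : IsAttenuation σ') (hm : 0 ≤ m) (hα : c2Norm α ≤ ENNReal.ofReal m)
    (hσm : c2Norm σ ≤ ENNReal.ofReal m) (hδ : 0 ≤ δ) (hδ₀ : δ ≤ δ₀)
    (hα' : c2Norm (α' - α) ≤ ENNReal.ofReal δ) (hσδ : c2Norm (σ' - σ) ≤ ENNReal.ofReal δ) {n : ℕ}
    (hc : c ∈ box n) : IsSymbol (region n) (radius n) (weightDiffConst n m δ₀ * δ)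
      fun y r φ => raySymbol n c β' σ' y r φ - raySymbol n c β σ y r φ := by
  have hL := lineConst_nonneg n
  have hR := radius_pos n
  have hE := expConst_nonneg (mul_nonneg hL hm)
  have hX := expDiffConst_nonneg n hm (hδ.trans hδ₀)
  have s1 := h.isSymbol_sub h' hδ hα' n (depth c)
  have s2 := hσ.isSymbol_exp_sub hσ' hm hσm hδ hσδ hc (region n)
  -- `expConst b` carries a factor `b`; this gives the linear factor `δ`, and `δ ≤ δ₀` is used in
  -- the remaining factors.
  have hle : 4 * (expConst (lineConst n * δ) * (expConst (lineConst n * m) + 1)) ≤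
      δ * expDiffConst n m δ₀ := by
    have e : δ * expDiffConst n m δ₀ = 4 * (lineConst n * δ * (1 + lineConst n * δ₀) *
      Real.exp (lineConst n * δ₀) * (expConst (lineConst n * m) + 1)) := by
      rw [expDiffConst]; ring
    rw [e]
    have hδ' : 0 ≤ δ₀ := hδ.trans hδ₀
    unfold expConst at hE ⊢
    gcongr
  have s3 := s2.mono Subset.rfl hle
  have s4 := ((s1.mul s3).add (s1.mul (hσ.isSymbol_exp hm hσm hc (region n)))).add
    ((h.isSymbol hm hα n (depth c)).mul s3)
  refine (s4.congr fun y r φ => ?_).mono Subset.rfl ?_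
  · simp only [raySymbol]
    ring
  rw [weightDiffConst]
  have : δ * (radius n + 3) * (δ * expDiffConst n m δ₀) ≤
      (radius n + 3) * (δ₀ * expDiffConst n m δ₀) * δ := by
    have : (radius n + 3) * expDiffConst n m δ₀ * δ * δ ≤
        (radius n + 3) * expDiffConst n m δ₀ * δ * δ₀ := by gcongr
    linarith
  linarith

end RayWeight

/-! ### Sums of integral operators -/

section Operators

variable {E : Set Plane} {n : ℕ} {w w' : (Fin 2 → ℤ) → Plane × ℝ → ℝ}
  {P P' : (Fin 2 → ℤ) → Plane → ℝ → ℝ → ℝ} {B B' : ℝ}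

/-- The operators `J c` are the integral operators with the weights `w c`. -/
def IsSegmentFamily (E : Set Plane) (n : ℕ) (w : (Fin 2 → ℤ) → Plane × ℝ → ℝ)
    (J : (Fin 2 → ℤ) → L2Square →L[ℂ] L2Inflow E) : Prop :=
  ∀ c ∈ box n, ∀ f : L2Square, J c f =ᵐ[inflowMeasure E] segInt c (w c) f

theorem exists_segmentFamily (hB : 0 ≤ B) (hw : ∀ c ∈ box n, IsWeight E n c (w c) (P c) B) :
    ∃ J, IsSegmentFamily E n w J ∧ ‖∑ c ∈ box n, J c‖ ≤ (box n).card * (6 * B) := by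
  have h : ∀ c, ∃ J : L2Square →L[ℂ] L2Inflow E, c ∈ box n →
      ‖J‖ ≤ 6 * B ∧ ∀ f : L2Square, J f =ᵐ[inflowMeasure E] segInt c (w c) f := by
    intro c
    by_cases hc : c ∈ box n
    · obtain ⟨J, hJ⟩ := exists_segmentOperator E c (hw c hc).measurable hB ((hw c hc).abs_le hc)
      exact ⟨J, fun _ => hJ⟩
    · exact ⟨0, fun h => absurd h hc⟩
  choose J hJ using h
  refine ⟨J, fun c hc => (hJ c hc).2, ?_⟩
  refine (norm_sum_le _ _).trans ?_
  rw [← nsmul_eq_mul]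
  exact Finset.sum_le_card_nsmul _ _ _ fun c hc => (hJ c hc).1

theorem IsSegmentFamily.ae_sum_eq {J : (Fin 2 → ℤ) → L2Square →L[ℂ] L2Inflow E}
    (h : IsSegmentFamily E n w J) (f : L2Square) :
    (∑ c ∈ box n, J c) f =ᵐ[inflowMeasure E] fun p => ∑ c ∈ box n, segInt c (w c) f p := by
  rw [_root_.sum_apply]
  suffices H : ∀ s ⊆ box n, (∑ c ∈ s, J c f : L2Inflow E) =ᵐ[inflowMeasure E]
      fun p => ∑ c ∈ s, segInt c (w c) f p from H _ (Finset.Subset.refl _)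
  intro s
  induction s using Finset.induction_on with
  | empty =>
    intro _
    simp only [Finset.sum_empty]
    exact Lp.coeFn_zero _ _ _
  | insert c s hcs ih =>
    intro hs
    rw [Finset.insert_subset_iff] at hs
    rw [Finset.sum_insert hcs]
    filter_upwards [Lp.coeFn_add (J c f) (∑ c ∈ s, J c f), h c hs.1 f, ih hs.2] with p h1 h2 h3
    rw [h1, Pi.add_apply, h2, h3, Finset.sum_insert hcs]

theorem ae_segInt_add_segInt_sub (hw : ∀ c ∈ box n, IsWeight E n c (w c) (P c) B)
    (hw' : ∀ c ∈ box n, IsWeight E n c (w' c) (P' c) B') (f : L2Square) {c : Fin 2 → ℤ}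
    (hc : c ∈ box n) : ∀ᵐ p ∂inflowMeasure E,
      segInt c (w c) f p + segInt c (w' c - w c) f p = segInt c (w' c) f p := by
  have hf := Lp.stronglyMeasurable f
  have hf2 := Lp.memLp f
  filter_upwards [ae_integrable_line E (hw c hc).measurable hf hf2 ((hw c hc).abs_le hc),
    ae_integrable_line E (hw' c hc).measurable hf hf2 ((hw' c hc).abs_le hc)] with p h1 h2
  have e : segInt c (w' c - w c) f p = segInt c (w' c) f p - segInt c (w c) f p := by
    rw [segInt, segInt, segInt, ← integral_sub h2 h1]
    refine integral_congr_ae (Filter.Eventually.of_forall fun t => ?_)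
    simp only [Pi.sub_apply, sub_smul]
  rw [e, add_sub_cancel]

theorem memLp_of_isTest {ψ : Plane → ℂ} (h : IsTest ψ) : MemLp ψ 2 (volume.restrict square) :=
  h.contDiff.continuous.memLp_of_hasCompactSupport h.hasCompactSupport

theorem memLp_fderiv {ψ : Plane → ℂ} (h : IsTest ψ) (e : Plane) :
    MemLp (fun x => fderiv ℝ ψ x e) 2 (volume.restrict square) :=
  (h.continuous_fderiv e).memLp_of_hasCompactSupport (h.hasCompactSupport.fderiv_apply ℝ e)

/-- The pairing is expanded into `(box n).card ^ 2` bilinear forms, one for each pair of cells. -/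
theorem IsSegmentFamily.norm_inner_le (hE : MeasurableSet E)
    (hw : ∀ c ∈ box n, IsWeight E n c (w c) (P c) B)
    (hw' : ∀ c ∈ box n, IsWeight E n c (w' c) (P' c) B')
    {J J' : (Fin 2 → ℤ) → L2Square →L[ℂ] L2Inflow E} (hJ : IsSegmentFamily E n w J)
    (hJ' : IsSegmentFamily E n w' J') (f : L2Square) {ψ : Plane → ℂ} (hψ : IsTest ψ) {e : Plane}
    (he : ‖e‖ ≤ 1) :
    ‖inner ℂ ((∑ c ∈ box n, J' c) f) ((∑ c ∈ box n, J c) (memLp_fderiv hψ e).toLp)‖ ≤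
      (box n).card ^ 2 * (bilinearConst n * (B' * B)) * (‖f‖ * ‖(memLp_of_isTest hψ).toLp‖) := by
  rw [_root_.sum_apply, _root_.sum_apply, sum_inner]
  simp only [inner_sum]
  have hterm : ∀ c' ∈ box n, ∀ c ∈ box n,
      ‖inner ℂ (J' c' f) (J c (memLp_fderiv hψ e).toLp)‖ ≤ bilinearConst n * (B' * B) *
        (‖f‖ * ‖(memLp_of_isTest hψ).toLp‖) := by
    intro c' hc' c hc
    have h := (hw c hc).norm_bilinear_le hE hc hc' (hw' c' hc') (Lp.stronglyMeasurable f)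
      (Lp.memLp f) hψ he
    rw [Lp.norm_toLp, Lp.norm_def]
    refine le_trans (le_of_eq ?_) h
    rw [L2.inner_def]
    congr 1
    refine integral_congr_ae ?_
    filter_upwards [hJ' c' hc' f, hJ c hc (memLp_fderiv hψ e).toLp,
      segInt_ae_congr (c := c) (w := w c) E (memLp_fderiv hψ e).coeFn_toLp] with p h1 h2 h3
    rw [h1, h2, h3, RCLike.inner_apply, mul_comm]
  set X := bilinearConst n * (B' * B) * (‖f‖ * ‖(memLp_of_isTest hψ).toLp‖) with hX
  calc _ ≤ ∑ c' ∈ box n, ∑ c ∈ box n, X :=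
        (norm_sum_le _ _).trans (Finset.sum_le_sum fun c' hc' =>
          (norm_sum_le _ _).trans (Finset.sum_le_sum fun c hc => hterm c' hc' c hc))
    _ = _ := by
        rw [Finset.sum_const, Finset.sum_const, nsmul_eq_mul, nsmul_eq_mul, hX]
        ring

end Operators

/-! ### Weak derivatives by duality -/

/-- The bound makes `ℓ` vanish on the kernel of `J`, so it descends to the range of `J`. Hahn–Banach
extends it with the same norm, and the Riesz theorem represents it. -/
theorem exists_inner_eq_of_norm_le {V H : Type*} [AddCommGroup V] [Module ℂ V]
    [NormedAddCommGroup H] [InnerProductSpace ℂ H] [CompleteSpace H] (J : V →ₗ[ℂ] H)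
    (ℓ : V →ₗ[ℂ] ℂ) {κ : ℝ} (hκ : 0 ≤ κ) (h : ∀ v, ‖ℓ v‖ ≤ κ * ‖J v‖) :
    ∃ g : H, ‖g‖ ≤ κ ∧ ∀ v, ℓ v = inner ℂ g (J v) := by
  obtain ⟨s, hs⟩ := LinearMap.exists_rightInverse_of_surjective J.rangeRestrict
    J.range_rangeRestrict
  have hJs : ∀ x : LinearMap.range J, J (s x) = x := fun x =>
    congrArg Subtype.val (LinearMap.congr_fun hs x)
  let ℓ' : LinearMap.range J →L[ℂ] ℂ := (ℓ.comp s).mkContinuous κ fun x => by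
    have := h (s x)
    rwa [hJs] at this
  obtain ⟨L, hL, hLn⟩ := exists_extension_norm_eq _ ℓ'
  refine ⟨(InnerProductSpace.toDual ℂ H).symm L, ?_, fun v => ?_⟩
  · rw [LinearIsometryEquiv.norm_map, hLn]
    exact LinearMap.mkContinuous_norm_le _ hκ _
  · rw [InnerProductSpace.toDual_symm_apply]
    have h1 : L (J v) = ℓ (s ⟨J v, v, rfl⟩) := hL ⟨J v, v, rfl⟩
    -- The chosen preimage of `J v` differs from `v` by an element of the kernel of `J`.
    have h2 : ℓ v - ℓ (s ⟨J v, v, rfl⟩) = 0 := by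
      have := h (v - s ⟨J v, v, rfl⟩)
      rw [map_sub, map_sub, hJs, sub_self, norm_zero, mul_zero] at this
      exact norm_le_zero_iff.1 this
    rw [h1, ← sub_eq_zero, h2]

/-- The space of smooth functions with compact support in the square. -/
def testSpace : Submodule ℂ (Plane → ℂ) where
  carrier := {ψ | IsTest ψ}
  add_mem' := by
    rintro a b ⟨ha, S, hS, hSc, h0⟩ ⟨hb, S', hS', hSc', h0'⟩
    refine ⟨ha.add hb, S ∪ S', union_subset hS hS', hSc.union hSc', fun x hx => ?_⟩
    rw [mem_union, not_or] at hx
    rw [Pi.add_apply, h0 x hx.1, h0' x hx.2, add_zero]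
  zero_mem' := ⟨contDiff_const, ∅, empty_subset _, isCompact_empty, fun _ _ => rfl⟩
  smul_mem' := by
    rintro a b ⟨hb, S, hS, hSc, h0⟩
    refine ⟨hb.const_smul a, S, hS, hSc, fun x hx => ?_⟩
    rw [Pi.smul_apply, h0 x hx, smul_zero]

/-- The class in `L²(Ω)` of a test function. -/
def testToL2 : testSpace →ₗ[ℂ] L2Square where
  toFun ψ := (memLp_of_isTest ψ.2).toLp
  map_add' _ _ := rfl
  map_smul' _ _ := rfl

/-- The class in `L²(Ω)` of a directional derivative of a test function. -/
def testDeriv (e : Plane) : testSpace →ₗ[ℂ] L2Square where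
  toFun ψ := (memLp_fderiv ψ.2 e).toLp
  map_add' a b := by
    rw [← MemLp.toLp_add]
    refine MemLp.toLp_congr _ _ (Filter.Eventually.of_forall fun x => ?_)
    have ha := (a.2.contDiff.differentiable (by simp)) x
    have hb := (b.2.contDiff.differentiable (by simp)) x
    change fderiv ℝ ((a : Plane → ℂ) + (b : Plane → ℂ)) x e = _
    rw [fderiv_add ha hb]
    rfl
  map_smul' k a := by
    rw [RingHom.id_apply, ← MemLp.toLp_const_smul]
    refine MemLp.toLp_congr _ _ (Filter.Eventually.of_forall fun x => ?_)
    have ha := (a.2.contDiff.differentiable (by simp)) x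
    change fderiv ℝ (k • (a : Plane → ℂ)) x e = _
    rw [fderiv_const_smul ha]
    rfl

theorem isTest_ofReal {ψ : Plane → ℝ} (h : ContDiff ℝ ∞ ψ) (hc : HasCompactSupport ψ)
    (hs : tsupport ψ ⊆ square) : IsTest fun x => (ψ x : ℂ) :=
  ⟨Complex.ofRealCLM.contDiff.comp h, tsupport ψ, hs, hc, fun x hx => by
    simp [image_eq_zero_of_notMem_tsupport hx]⟩

theorem fderiv_ofReal_apply {ψ : Plane → ℝ} (h : ContDiff ℝ ∞ ψ) (x e : Plane) :
    fderiv ℝ (fun x => (ψ x : ℂ)) x e = (fderiv ℝ ψ x e : ℂ) := by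
  have h1 := (Complex.ofRealCLM.hasFDerivAt (x := ψ x)).comp x
    ((h.differentiable (by simp)) x).hasFDerivAt
  have h2 : fderiv ℝ (fun x => (ψ x : ℂ)) x = _ := h1.fderiv
  rw [h2]
  rfl

theorem inner_toLp_eq (u : L2Square) {h : Plane → ℂ} (hh : MemLp h 2 (volume.restrict square))
    (hr : ∀ x, (starRingEnd ℂ) (h x) = h x) :
    inner ℂ u hh.toLp = (starRingEnd ℂ) (∫ x in square, u x * h x) := by
  rw [L2.inner_def, ← integral_conj]
  refine integral_congr_ae ?_
  filter_upwards [hh.coeFn_toLp] with x hx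
  rw [hx, RCLike.inner_apply, map_mul, hr, mul_comm]

/-- The weak derivative represents the functional `ψ ↦ ⟨u, ∂ᵢψ⟩`, which by assumption is bounded in
the `L²` norm of `ψ`; the sign in the definition accounts for `-g`. -/
theorem exists_isWeakPartial (u : L2Square) (i : Fin 2) {κ : ℝ} (hκ : 0 ≤ κ)
    (h : ∀ (ψ : Plane → ℂ) (hψ : IsTest ψ),
      ‖inner ℂ u (memLp_fderiv hψ (EuclideanSpace.single i 1)).toLp‖ ≤
        κ * ‖(memLp_of_isTest hψ).toLp‖) :
    ∃ g : L2Square, ‖g‖ ≤ κ ∧ IsWeakPartial u g i := by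
  obtain ⟨g, hg, hgi⟩ := exists_inner_eq_of_norm_le testToL2
    (((innerSL ℂ u : L2Square →L[ℂ] ℂ) : L2Square →ₗ[ℂ] ℂ).comp
      (testDeriv (EuclideanSpace.single i 1))) hκ fun ψ => h ψ ψ.2
  refine ⟨-g, by rwa [norm_neg], fun ψ h1 h2 h3 => ?_⟩
  have ht := isTest_ofReal h1 h2 h3
  have e : inner ℂ u (memLp_fderiv ht (EuclideanSpace.single i 1)).toLp =
      inner ℂ g (memLp_of_isTest ht).toLp := hgi ⟨_, ht⟩
  rw [inner_toLp_eq _ _ fun x => by rw [fderiv_ofReal_apply h1]; exact Complex.conj_ofReal _,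
    inner_toLp_eq _ _ fun x => Complex.conj_ofReal _] at e
  have e' := (starRingEnd ℂ).injective e
  simp only [fderiv_ofReal_apply h1] at e'
  rw [e', ← integral_neg]
  refine integral_congr_ae ?_
  filter_upwards [Lp.coeFn_neg g] with x hx
  rw [hx, Pi.neg_apply, neg_mul, neg_neg]

theorem h1Norm_le (u : L2Square) {a b : ℝ} (ha : ‖u‖ ≤ a) (hb : 0 ≤ b)
    (h : ∀ (i : Fin 2) (ψ : Plane → ℂ) (hψ : IsTest ψ),
      ‖inner ℂ u (memLp_fderiv hψ (EuclideanSpace.single i 1)).toLp‖ ≤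
        b * ‖(memLp_of_isTest hψ).toLp‖) : h1Norm u ≤ ENNReal.ofReal (a + 2 * b) := by
  choose g hg hgw using fun i => exists_isWeakPartial u i hb (h i)
  refine (iInf₂_le g hgw).trans (ENNReal.ofReal_le_ofReal ?_)
  have ha0 : 0 ≤ a := (norm_nonneg _).trans ha
  rw [Real.sqrt_le_left (by positivity), Fin.sum_univ_two]
  have h1 := pow_le_pow_left₀ (norm_nonneg _) ha 2
  have h2 := pow_le_pow_left₀ (norm_nonneg _) (hg 0) 2
  have h3 := pow_le_pow_left₀ (norm_nonneg _) (hg 1) 2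
  -- Each of the two partial derivatives has norm at most `b`, and `a² + 2 b² ≤ (a + 2 b)²`.
  nlinarith [mul_nonneg ha0 hb]

/-! ### The stability estimate -/

section Normal

variable {E : Set Plane} (A D : L2Square →L[ℂ] L2Inflow E)

/-- Every term contains `D`, which is the source of the factor `δ` in the final estimate. -/
theorem normalOperator_add_sub_apply (f : L2Square) :
    (normalOperator (A + D) - normalOperator A) f =
      ContinuousLinearMap.adjoint (A + D) (D f) + ContinuousLinearMap.adjoint D (A f) := by
  simp only [normalOperator, map_add, sub_apply, ContinuousLinearMap.comp_apply, add_apply]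
  abel

theorem norm_normalOperator_add_sub_le {a d : ℝ} (hA : ‖A‖ ≤ a) (hD : ‖D‖ ≤ d) (f : L2Square) :
    ‖(normalOperator (A + D) - normalOperator A) f‖ ≤ (2 * a + d) * d * ‖f‖ := by
  have hd : 0 ≤ d := (norm_nonneg _).trans hD
  have ha : 0 ≤ a := (norm_nonneg _).trans hA
  rw [normalOperator_add_sub_apply]
  have h1 : ‖ContinuousLinearMap.adjoint (A + D)‖ ≤ a + d := by
    rw [LinearIsometryEquiv.norm_map]
    exact (norm_add_le _ _).trans (add_le_add hA hD)
  have h2 : ‖ContinuousLinearMap.adjoint D‖ ≤ d := by rwa [LinearIsometryEquiv.norm_map]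
  calc _ ≤ ‖ContinuousLinearMap.adjoint (A + D) (D f)‖ + ‖ContinuousLinearMap.adjoint D (A f)‖ :=
        norm_add_le _ _
    _ ≤ (a + d) * (d * ‖f‖) + d * (a * ‖f‖) :=
        add_le_add (ContinuousLinearMap.le_of_opNorm_le_of_le _ h1
          (ContinuousLinearMap.le_of_opNorm_le _ hD f))
          (ContinuousLinearMap.le_of_opNorm_le_of_le _ h2
          (ContinuousLinearMap.le_of_opNorm_le _ hA f))
    _ = _ := by ring

theorem inner_normalOperator_add_sub (f h : L2Square) :
    inner ℂ ((normalOperator (A + D) - normalOperator A) f) h =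
      inner ℂ (D f) (A h) + inner ℂ (D f) (D h) + inner ℂ (A f) (D h) := by
  rw [normalOperator_add_sub_apply, inner_add_left, ContinuousLinearMap.adjoint_inner_left,
    ContinuousLinearMap.adjoint_inner_left, add_apply, inner_add_right]

end Normal

/-- Stability of the normal operator for nearby attenuations and cutoffs. -/
theorem exists_rayOperators {E : Set Plane} (hE : MeasurableSet E) (n : ℕ)
    {σ σ' α α' : Plane → Plane → ℝ} {m δ δ₀ : ℝ} (hm : 0 ≤ m) (hδ : 0 ≤ δ) (hδ₀ : δ ≤ δ₀)
    (hσ : IsAttenuation σ) (hσ' : IsAttenuation σ') (hα : IsCutoff E n α) (hα' : IsCutoff E n α')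
    (hσm : c2Norm σ ≤ ENNReal.ofReal m) (hαm : c2Norm α ≤ ENNReal.ofReal m)
    (hσδ : c2Norm (σ' - σ) ≤ ENNReal.ofReal δ) (hαδ : c2Norm (α' - α) ≤ ENNReal.ofReal δ) :
    ∃ A A' : L2Square →L[ℂ] L2Inflow E, IsRayOperator σ E α A ∧ IsRayOperator σ' E α' A' ∧
      ∀ f : L2Square, h1Norm ((normalOperator A' - normalOperator A) f) ≤ ENNReal.ofReal
        ((36 + 2 * bilinearConst n) * (box n).card ^ 2 *
          (2 * weightConst n m + weightDiffConst n m δ₀ * δ₀) * weightDiffConst n m δ₀ *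
          δ * ‖f‖) := by
  obtain ⟨β, hβ⟩ := hα.exists_levels
  obtain ⟨β', hβ'⟩ := hα'.exists_levels
  set b := weightConst n m with hb
  set d := weightDiffConst n m δ₀ with hd
  set N : ℝ := ((box n).card : ℝ) with hN
  have hb0 : 0 ≤ b := weightConst_nonneg n hm
  have hd0 : 0 ≤ d := weightDiffConst_nonneg n hm (hδ.trans hδ₀)
  have hκ := bilinearConst_nonneg n
  have hδ₀0 : 0 ≤ δ₀ := hδ.trans hδ₀
  have hdδ : d * δ ≤ d * δ₀ := by gcongr
  have hdδ0 : 0 ≤ d * δ := by positivity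
  have hw : ∀ c ∈ box n, IsWeight E n c (rayWeight c β σ) (raySymbol n c β σ) b := fun c hc =>
    hβ.isWeight hσ hc hb0 (hβ.isSymbol_raySymbol hσ hm hαm hσm hc)
  have hs : ∀ c ∈ box n, IsSymbol (region n) (radius n) (d * δ)
      fun y r φ => raySymbol n c β' σ' y r φ - raySymbol n c β σ y r φ := fun c hc =>
    hβ.isSymbol_raySymbol_sub hβ' hσ hσ' hm hαm hσm hδ hδ₀ hαδ hσδ hc
  -- The primed data have no norm bound of their own; theirs comes from the unprimed symbols and the
  -- difference.
  have hw' : ∀ c ∈ box n, IsWeight E n c (rayWeight c β' σ') (raySymbol n c β' σ') (b + d * δ) :=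
    fun c hc => hβ'.isWeight hσ' hc (by positivity)
      (((hw c hc).symbol.add (hs c hc)).congr fun y r φ => by ring)
  have hwd : ∀ c ∈ box n, IsWeight E n c (rayWeight c β' σ' - rayWeight c β σ)
      (fun y r φ => raySymbol n c β' σ' y r φ - raySymbol n c β σ y r φ) (d * δ) := fun c hc =>
    (hw c hc).sub (hw' c hc) hdδ0 (hs c hc)
  obtain ⟨J, hJ, hJn⟩ := exists_segmentFamily hb0 hw
  obtain ⟨J', hJ', hJn'⟩ := exists_segmentFamily hdδ0 hwd
  set A := ∑ c ∈ box n, J c with hA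
  set D := ∑ c ∈ box n, J' c with hD
  refine ⟨A, A + D, fun f => ?_, fun f => ?_, fun f => ?_⟩
  · filter_upwards [hJ.ae_sum_eq f, hβ.ae_mul_rayTransform_eq hE hσ f] with p h1 h2
    rw [h1, h2]
  · rw [add_apply]
    filter_upwards [Lp.coeFn_add (A f) (D f), hJ.ae_sum_eq f, hJ'.ae_sum_eq f,
      hβ'.ae_mul_rayTransform_eq hE hσ' f,
      (Finset.eventually_all (box n)).2 fun c hc => ae_segInt_add_segInt_sub hw hw' f hc]
      with p h1 h2 h3 h4 h5
    rw [h1, Pi.add_apply, h2, h3, h4, ← Finset.sum_add_distrib]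
    exact Finset.sum_congr rfl h5
  -- One factor `δ` is kept, and the other is replaced by `δ₀`. The number `36` in the final
  -- constant is the square of the `6` in the operator norms, and the `2` counts the partial
  -- derivatives.
  · have hcoef : ∀ x : ℝ, 0 ≤ x → (2 * b + d * δ) * d * δ * x ≤ (2 * b + d * δ₀) * d * δ * x := by
      intro x hx
      gcongr
    have h1 := norm_normalOperator_add_sub_le A D hJn hJn' f
    have h2 : ∀ (i : Fin 2) (ψ : Plane → ℂ) (hψ : IsTest ψ),
        ‖inner ℂ ((normalOperator (A + D) - normalOperator A) f)
          (memLp_fderiv hψ (EuclideanSpace.single i 1)).toLp‖ ≤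
        N ^ 2 * bilinearConst n * ((2 * b + d * δ₀) * d * δ * ‖f‖) *
          ‖(memLp_of_isTest hψ).toLp‖ := by
      intro i ψ hψ
      have he : ‖(EuclideanSpace.single i 1 : Plane)‖ ≤ 1 := by simp
      have i1 := IsSegmentFamily.norm_inner_le hE hw hwd hJ hJ' f hψ he
      have i2 := IsSegmentFamily.norm_inner_le hE hwd hwd hJ' hJ' f hψ he
      have i3 := IsSegmentFamily.norm_inner_le hE hwd hw hJ' hJ f hψ he
      rw [inner_normalOperator_add_sub]
      refine (norm_add₃_le.trans (add_le_add (add_le_add i1 i2) i3)).trans ?_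
      have h3 := hcoef (‖f‖ * ‖(memLp_of_isTest hψ).toLp‖) (by positivity)
      have h4 := mul_le_mul_of_nonneg_left h3 (mul_nonneg (sq_nonneg N) hκ)
      linarith
    refine (h1Norm_le _ h1 (by positivity) h2).trans (ENNReal.ofReal_le_ofReal ?_)
    have h3 := mul_le_mul_of_nonneg_left (hcoef ‖f‖ (norm_nonneg _)) (sq_nonneg N)
    linarith

end BrokenRay

end

theorem mainTheorem6
    (E : Set BrokenRay.Plane)
    (hE : ∃ O : Set BrokenRay.Plane, IsOpen O ∧ E = O ∩ frontier BrokenRay.square)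
    (K : Set BrokenRay.Plane) (hK : IsCompact K) (hKsub : K ⊆ BrokenRay.square)
    (Nmax : ℕ) (M δ₀ : ℝ) :
    ∃ C : ℝ, 0 < C ∧
      ∀ (σ σ' α α' : BrokenRay.Plane → BrokenRay.Plane → ℝ) (δ : ℝ),
        BrokenRay.IsAttenuation σ → BrokenRay.IsAttenuation σ' →
        BrokenRay.IsCutoff E Nmax α → BrokenRay.IsCutoff E Nmax α' →
        BrokenRay.c2Norm σ ≤ ENNReal.ofReal M → BrokenRay.c2Norm α ≤ ENNReal.ofReal M →
        0 < δ → δ ≤ δ₀ →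
        BrokenRay.c2Norm (σ' - σ) ≤ ENNReal.ofReal δ →
        BrokenRay.c2Norm (α' - α) ≤ ENNReal.ofReal δ →
        ∃ A A' : BrokenRay.L2Square →L[ℂ] BrokenRay.L2Inflow E,
          BrokenRay.IsRayOperator σ E α A ∧ BrokenRay.IsRayOperator σ' E α' A' ∧
          ∀ f : BrokenRay.L2Square,
            (∀ᵐ x ∂((volume : Measure BrokenRay.Plane).restrict BrokenRay.square),
              x ∉ K → f x = 0) →
            BrokenRay.h1Norm
                ((BrokenRay.normalOperator A' - BrokenRay.normalOperator A) f) ≤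
              ENNReal.ofReal (C * δ * ‖f‖) := by
  have hEm : MeasurableSet E := by
    obtain ⟨O, hO, rfl⟩ := hE
    exact hO.measurableSet.inter isClosed_frontier.measurableSet
  -- `max M 0` serves as a nonnegative bound for the norms, since `M` may be negative.
  set C := (36 + 2 * BrokenRay.bilinearConst Nmax) * (BrokenRay.box Nmax).card ^ 2 *
    (2 * BrokenRay.weightConst Nmax (max M 0) +
      BrokenRay.weightDiffConst Nmax (max M 0) δ₀ * δ₀) *
    BrokenRay.weightDiffConst Nmax (max M 0) δ₀ with hC
  -- `C` itself need not be positive, since `δ₀` is arbitrary at this stage.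
  refine ⟨|C| + 1, by positivity, ?_⟩
  intro σ σ' α α' δ hσ hσ' hα hα' hσm hαm hδ hδ₀ hσδ hαδ
  have hM : ENNReal.ofReal M ≤ ENNReal.ofReal (max M 0) :=
    ENNReal.ofReal_le_ofReal (le_max_left _ _)
  obtain ⟨A, A', hA, hA', h⟩ := BrokenRay.exists_rayOperators hEm Nmax (le_max_right M 0) hδ.le hδ₀
    hσ hσ' hα hα' (hσm.trans hM) (hαm.trans hM) hσδ hαδ
  refine ⟨A, A', hA, hA', fun f _ => (h f).trans (ENNReal.ofReal_le_ofReal ?_)⟩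
  rw [← hC]
  gcongr
  linarith [le_abs_self C]
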